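/- Let $K$ be a field of characteristic zero. A \emph{quartic monoid surface} of $\mathbb{P}^3_K$ is a surface $F=0$, with $F\in K[x,y,z,t]$ a form of degree four, which has a $K$-rational point $O$ of multiplicity exactly three (the triple point). We consider quartic monoid surfaces with no singularities other than the triple point (also over the algebraic closure $\overline{K}$), and count the lines of $\mathbb{P}^3_K$ (that is, the lines defined over $K$) contained in them. Two surfaces $F=0$ and $G=0$ are \emph{projectively equivalent} if an element of $\mathrm{GL}(4,K)$, acting by linear change of coordinates, turns $F$ into a nonzero scalar multiple of $G$. For $a\in K$ put $$\begin{aligned} Q(a) ={}& 2ax^3y+4ax^2y^2+2axy^3-(2a-1)(a-2)x^3z-(5a^2-17a+5)x^2yz\\ &-3(a^2-4a+1)xy^2z+ay^3z-3(2a-1)(a-2)x^2z^2-(7a^2-19a+7)xyz^2\\ &+2ay^2z^2-2(2a-1)(a-2)xz^3+ayz^3-2atx^2y-2atxy^2+2(2a-1)(a-2)tx^2z\\ &+4(a^2-3a+1)txyz-2aty^2z+2(2a-1)(a-2)txz^2-2atyz^2, \end{aligned}$$ $$\begin{aligned} F_3(a) ={}& (a-1)x^3+(2a^2+6a-1)x^2y-3(a-1)x^2z+(a^2+4a+1)xy^2+2(a-1)xz^2\\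 &-2a(a+4)xyz+(a+1)y^3-3(a+1)y^2z+2(a+1)yz^2,\\ F_4(a) ={}& y\,(3ax-2az+x-y)(2ax+ay-2az+3x+y-2z)(ax+2x+2y-2z). \end{aligned}$$ Then the following hold. (1) The maximum number of lines contained in a quartic monoid surface of $\mathbb{P}^3_K$ with no singularities other than its triple point is $31$ (every such surface contains at most $31$ lines, and the value $31$ is attained). (2) Every quartic monoid surface of $\mathbb{P}^3_K$ with no singularities other than its triple point and with the maximum number $31$ of lines is projectively equivalent to the surface $Q(a)=0$ for some $a\in K\setminus\{-1,0,\tfrac12,1,2\}$. (3) The parameter $b$ of the family $tF_3(a)+bF_4(a)=0$ can be normalised away: for all $a\in K\setminus\{-2,-1,-\tfrac12,0,1\}$ and all $b\in K\setminus\{0\}$, the surface $tF_3(a)+bF_4(a)=0$ is projectively equivalent to $Q(-a)=0$. -/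

import Mathlib

open MvPolynomial

noncomputable section

namespace QuarticMonoid

/-- Polynomials in four variables: the homogeneous coordinates of projective three-space are
`x = X 0`, `y = X 1`, `z = X 2`, `t = X 3`. A surface is given by its equation,
and a point by a nonzero vector of homogeneous coordinates. -/
abbrev Poly4 (K : Type*) [Field K] : Type _ := MvPolynomial (Fin 4) K

variable {K : Type*} [Field K]

/-- The iterated partial derivative of `F` along the list `l` of variables. -/
def iterPartial (F : Poly4 K) (l : List (Fin 4)) : Poly4 K :=
  l.foldr (fun i G => pderiv i G) F

/-- In characteristic zero: the surface `F = 0` has multiplicity exactly three at the point with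
homogeneous coordinates `p`, that is, all partial derivatives of order at most two (including `F`
itself) vanish at `p`, and some partial derivative of order three does not. -/
def IsTriplePoint (F : Poly4 K) (p : Fin 4 → K) : Prop :=
  p ≠ 0 ∧ (∀ l : List (Fin 4), l.length ≤ 2 → eval p (iterPartial F l) = 0) ∧
    ∃ l : List (Fin 4), l.length = 3 ∧ eval p (iterPartial F l) ≠ 0

/-- `F = 0` is a quartic surface with a triple point at `p`
(a triple point forces `F` to be nonzero). -/
def IsQuarticMonoid (F : Poly4 K) (p : Fin 4 → K) : Prop :=
  F.IsHomogeneous 4 ∧ IsTriplePoint F p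

/-- Every singular point of the surface `F = 0`, with coordinates in an algebraic closure of the
base field, is the point `p`. -/
def NoOtherSingularity (F : Poly4 K) (p : Fin 4 → K) : Prop :=
  ∀ v : Fin 4 → AlgebraicClosure K, v ≠ 0 → aeval v F = 0 →
    (∀ i, aeval v (pderiv i F) = 0) →
      ∃ c : AlgebraicClosure K, v = fun i => c * algebraMap K (AlgebraicClosure K) (p i)

/-- The lines of projective three-space over `K` (the two-dimensional subspaces of `K ^ 4`) that
are contained in the surface `F = 0`. Over an infinite field a line is contained in the surface
as soon as all its points over that field are. -/
def lines (F : Poly4 K) : Set (Submodule K (Fin 4 → K)) :=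
  {L | Module.finrank K L = 2 ∧ ∀ v ∈ L, eval v F = 0}

/-- The form obtained from `F` by the linear change of coordinates with matrix `M`. -/
def changeCoord (M : Matrix (Fin 4) (Fin 4) K) (F : Poly4 K) : Poly4 K :=
  bind₁ (fun i => ∑ j, C (M i j) * X j) F

/-- The surfaces `F = 0` and `G = 0` are projectively equivalent over `K`: an invertible linear
change of coordinates turns one equation into a nonzero multiple of the other. -/
def ProjEquiv (F G : Poly4 K) : Prop :=
  ∃ (M : GL (Fin 4) K) (c : K), c ≠ 0 ∧ changeCoord (M : Matrix (Fin 4) (Fin 4) K) F = C c * G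

/-- The quartic form `Q(a)`. -/
def Q (a : K) : Poly4 K :=
  let x : Poly4 K := X 0
  let y : Poly4 K := X 1
  let z : Poly4 K := X 2
  let t : Poly4 K := X 3
  C (2 * a) * x ^ 3 * y + C (4 * a) * x ^ 2 * y ^ 2 + C (2 * a) * x * y ^ 3
    - C ((2 * a - 1) * (a - 2)) * x ^ 3 * z
    - C (5 * a ^ 2 - 17 * a + 5) * x ^ 2 * y * z
    - C (3 * (a ^ 2 - 4 * a + 1)) * x * y ^ 2 * z + C a * y ^ 3 * z
    - C (3 * (2 * a - 1) * (a - 2)) * x ^ 2 * z ^ 2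
    - C (7 * a ^ 2 - 19 * a + 7) * x * y * z ^ 2 + C (2 * a) * y ^ 2 * z ^ 2
    - C (2 * (2 * a - 1) * (a - 2)) * x * z ^ 3 + C a * y * z ^ 3
    - C (2 * a) * t * x ^ 2 * y - C (2 * a) * t * x * y ^ 2
    + C (2 * (2 * a - 1) * (a - 2)) * t * x ^ 2 * z
    + C (4 * (a ^ 2 - 3 * a + 1)) * t * x * y * z - C (2 * a) * t * y ^ 2 * z
    + C (2 * (2 * a - 1) * (a - 2)) * t * x * z ^ 2 - C (2 * a) * t * y * z ^ 2

/-- The cubic form `F₃(a)`. -/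
def F3 (a : K) : Poly4 K :=
  let x : Poly4 K := X 0
  let y : Poly4 K := X 1
  let z : Poly4 K := X 2
  C (a - 1) * x ^ 3 + C (2 * a ^ 2 + 6 * a - 1) * x ^ 2 * y - C (3 * (a - 1)) * x ^ 2 * z
    + C (a ^ 2 + 4 * a + 1) * x * y ^ 2 + C (2 * (a - 1)) * x * z ^ 2
    - C (2 * a * (a + 4)) * x * y * z + C (a + 1) * y ^ 3
    - C (3 * (a + 1)) * y ^ 2 * z + C (2 * (a + 1)) * y * z ^ 2

/-- The quartic form `F₄(a)`, a product of four linear forms. -/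
def F4 (a : K) : Poly4 K :=
  let x : Poly4 K := X 0
  let y : Poly4 K := X 1
  let z : Poly4 K := X 2
  y * (C (3 * a) * x - C (2 * a) * z + x - y)
    * (C (2 * a) * x + C a * y - C (2 * a) * z + 3 * x + y - 2 * z)
    * (C a * x + 2 * x + 2 * y - 2 * z)

/-- The two-parameter family `t F₃(a) + b F₄(a)`. -/
def Qab (a b : K) : Poly4 K := X 3 * F3 a + C b * F4 a

end QuarticMonoid

end

/-! Projection from the triple point O turns the count into plane geometry. With O = (0:0:0:1) the
surface is t f + g = 0 for a plane cubic f and a plane quartic g. Lines through O correspond to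
common zeros of f and g. A line off O is the graph t = l of a linear form over a plane line c; there
l f + g = 0, so l is determined on c unless f vanishes on c. Smoothness away from O makes f and g
coprime (`isRelPrime_of_smoothOff`), so they have at most twelve common zeros
(`card_le_of_isRelPrime`). It also makes c meet f transversally wherever f is smooth, so that c is a
trisecant: it cuts f in three distinct common zeros. A singular point of f that is a common zero
lies under at most one graph. Hence the number of lines is at most the number of common zeros, plus
the number of those singular on f, plus the number of trisecants through the others
(`encard_lines_le_add`).

Trisecants form a partial triple system on the common zeros. If f contains no line and there are
twelve zeros, three disjoint trisecants a, b, c give g = l f + a b c m in the manner of Cayley and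
Bacharach (`exists_eq_add_of_isTrisecant`), so the three remaining points lie on m: the complement
of three disjoint triples is a triple. Such a system has at most 19 triples, and with 19 it consists
of the triples of distinct elements with sum zero in (ℤ/2)² × ℤ/3, where the label 4b + v stands for
(v, b) (`TripleSystem.exists_labelling`). Indeed 19 triples leave nine pairs uncovered; an isolated
uncovered pair is impossible, so these pairs form three stars with three leaves, and a parity
condition implied by the closure property cuts the rest down to a finite search. Thus 12 + 19 = 31
is the bound, and fewer smooth zeros give fewer lines.

For uniqueness, four of the twelve points are moved to a standard frame, a fifth carries one
parameter a, and the incidences construct the others (`IsModel.exists_matrix`). Ten points determine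
the cubic, and modulo f the quartic is a multiple of a product of four lines; a change of t absorbs
the rest, which gives the family `Qab a b`. An explicit substitution carries this to `Q (-a)`.

The count is made over the algebraic closure. Extension of scalars is injective on lines, so a
surface with 31 lines over K has no others over the closure; the lines joining O to the twelve
points are then defined over K, and so are the points. The surface `Qab 2 1`, whose twelve points
have integral coordinates, attains the bound. -/

namespace TripleSystem

/-! ### Counting in partial triple systems. -/

open Finset

variable {V : Type*} [DecidableEq V]

/-- A family of three-element sets, any two of which share at most one element. -/
structure IsPartial (T : Finset (Finset V)) : Prop where
  card_eq : ∀ t ∈ T, t.card = 3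
  eq_of_mem : ∀ s ∈ T, ∀ t ∈ T, ∀ a b, a ≠ b → a ∈ s → b ∈ s → a ∈ t → b ∈ t → s = t

/-- The number of triples through a point. -/
def deg (T : Finset (Finset V)) (v : V) : ℕ := (T.filter (v ∈ ·)).card

/-- The points not joined to `v` by a triple. -/
def free [Fintype V] (T : Finset (Finset V)) (v : V) : Finset V :=
  univ.filter fun w => w ≠ v ∧ ∀ t ∈ T, v ∈ t → w ∉ t

lemma mem_free [Fintype V] {T : Finset (Finset V)} {v w : V} :
    w ∈ free T v ↔ w ≠ v ∧ ∀ t ∈ T, v ∈ t → w ∉ t := by simp [free]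

lemma mem_free_comm [Fintype V] {T : Finset (Finset V)} {v w : V} :
    w ∈ free T v ↔ v ∈ free T w := by
  simp only [mem_free, ne_comm (a := w)]
  exact and_congr_right fun _ => ⟨fun h t ht hw hv => h t ht hv hw, fun h t ht hw hv => h t ht hv hw⟩

/-- The triples through `v`, with `v` removed, are disjoint pairs that partition the points joined
to `v`. -/
lemma card_free [Fintype V] {T : Finset (Finset V)} (hT : IsPartial T) (v : V) :
    (free T v).card + 2 * deg T v + 1 = Fintype.card V := by
  have h1 : ((T.filter (v ∈ ·)).biUnion fun t => t.erase v).card = 2 * deg T v := by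
    rw [card_biUnion, sum_congr rfl (g := fun _ => 2), sum_const, smul_eq_mul, mul_comm, deg]
    · intro t ht
      rw [mem_filter] at ht
      rw [card_erase_of_mem ht.2, hT.card_eq t ht.1]
    · intro s hs t ht hst
      rw [mem_coe, mem_filter] at hs ht
      rw [Function.onFun, disjoint_left]
      intro w hw hw'
      rw [mem_erase] at hw hw'
      exact hst (hT.eq_of_mem s hs.1 t ht.1 v w hw.1.symm hs.2 hw.2 ht.2 hw'.2)
  have h2 : Disjoint (free T v) ((T.filter (v ∈ ·)).biUnion fun t => t.erase v) := by
    rw [disjoint_left]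
    intro w hw hw'
    simp only [mem_biUnion, mem_filter, mem_erase] at hw'
    obtain ⟨t, ⟨ht, hv⟩, -, hwt⟩ := hw'
    exact (mem_free.1 hw).2 t ht hv hwt
  have h3 : (free T v) ∪ ((T.filter (v ∈ ·)).biUnion fun t => t.erase v) = univ.erase v := by
    ext w
    simp only [mem_union, mem_free, mem_biUnion, mem_filter, mem_erase, mem_univ, and_true]
    constructor
    · rintro (h | ⟨t, -, h, -⟩)
      · exact h.1
      · exact h
    · intro h
      by_cases hw : ∃ t ∈ T, v ∈ t ∧ w ∈ t
      · obtain ⟨t, ht, h1, h2⟩ := hw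
        exact Or.inr ⟨t, ⟨ht, h1⟩, h, h2⟩
      · push Not at hw
        exact Or.inl ⟨h, hw⟩
  rw [← h1, ← card_union_of_disjoint h2, h3, card_erase_of_mem (mem_univ v), card_univ]
  have : 0 < Fintype.card V := Fintype.card_pos_iff.2 ⟨v⟩
  omega

lemma sum_card_inter {T : Finset (Finset V)} (A : Finset V) :
    ∑ t ∈ T, (t ∩ A).card = ∑ a ∈ A, deg T a := by
  simp only [deg, card_filter]
  rw [sum_comm]
  refine sum_congr rfl fun t _ => ?_
  rw [inter_comm, ← filter_mem_eq_inter, card_filter]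

lemma sum_deg [Fintype V] {T : Finset (Finset V)} (hT : IsPartial T) :
    ∑ v, deg T v = 3 * T.card := by
  rw [← sum_card_inter, sum_congr rfl (g := fun _ => 3), sum_const, smul_eq_mul, mul_comm]
  intro t ht
  rw [inter_univ, hT.card_eq t ht]

lemma three_mul_card_le [Fintype V] {T : Finset (Finset V)} (hT : IsPartial T) :
    3 * T.card ≤ Fintype.card V * ((Fintype.card V - 1) / 2) := by
  rw [← sum_deg hT, ← smul_eq_mul, ← card_univ, ← sum_const]
  refine sum_le_sum fun v _ => ?_
  have := card_free hT v
  rw [card_univ]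
  omega

/-- Degrees alone only give 18. With at least 18 triples the free degrees are even and sum to 110 -
6|T| ≤ 2, which is not zero since 6 does not divide 110; but freeness is symmetric, so one nonzero
free degree brings a second and the sum is at least 4. The bound 17 keeps eleven smooth zeros
together with one singular zero below 31 lines. -/
lemma card_le_of_card_eq_eleven [Fintype V] {T : Finset (Finset V)} (hT : IsPartial T)
    (hV : Fintype.card V = 11) : T.card ≤ 17 := by
  by_contra! h
  have hf : ∑ v, ((free T v).card + 2 * deg T v + 1) = 11 * 11 := by
    rw [sum_congr rfl fun v _ => card_free hT v, sum_const, card_univ, hV]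
    rfl
  rw [sum_add_distrib, sum_add_distrib, ← mul_sum, sum_deg hT] at hf
  simp only [sum_const, card_univ, hV, smul_eq_mul] at hf
  have hsum : ∑ v, (free T v).card ≤ 2 := by omega
  have hev : ∀ v, Even (free T v).card := fun v => by
    have := card_free hT v
    rw [hV] at this
    exact ⟨5 - deg T v, by omega⟩
  have hne : ∃ v, (free T v).card ≠ 0 := by
    by_contra! h0
    simp only [h0, sum_const_zero] at hf
    omega
  obtain ⟨v, hv⟩ := hne
  obtain ⟨w, hw⟩ := card_pos.1 (Nat.pos_of_ne_zero hv)
  have hw' := mem_free_comm.1 hw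
  have h2 : ∀ u, (free T u).card ≠ 0 → 2 ≤ (free T u).card := fun u hu => by
    obtain ⟨r, hr⟩ := hev u
    omega
  have hle : (free T v).card + (free T w).card ≤ ∑ v, (free T v).card := by
    rw [← sum_pair (f := fun v => (free T v).card) (mem_free.1 hw).1.symm]
    exact sum_le_sum_of_subset (subset_univ _)
  have := h2 v hv
  have := h2 w (card_pos.2 ⟨v, hw'⟩).ne'
  omega

/-- If every triple meets `J` in exactly one point, there are few triples. -/
lemma two_mul_card_le_of_transversal [Fintype V] {T : Finset (Finset V)} (hT : IsPartial T)
    (J : Finset V) (hJ : ∀ t ∈ T, (t ∩ J).card = 1) :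
    T.card ≤ J.card * ((Fintype.card V - J.card) / 2) := by
  have h1 : T.card = ∑ a ∈ J, deg T a := by
    rw [← sum_card_inter, sum_congr rfl hJ, sum_const, smul_eq_mul, mul_one]
  rw [h1, ← smul_eq_mul, ← sum_const]
  refine sum_le_sum fun v hv => ?_
  -- No triple contains two points of `J`, so the rest of `J` is free from `v`, which lowers the
  -- degree bound to half of |V| - |J|.
  have hsub : J.erase v ⊆ free T v := by
    intro w hw
    rw [mem_erase] at hw
    refine mem_free.2 ⟨hw.1, fun t ht hvt hwt => ?_⟩
    have : 1 < (t ∩ J).card := one_lt_card.2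
      ⟨v, mem_inter.2 ⟨hvt, hv⟩, w, mem_inter.2 ⟨hwt, hw.2⟩, hw.1.symm⟩
    have := hJ t ht
    omega
  have h2 := card_le_card hsub
  rw [card_erase_of_mem hv] at h2
  have h3 := card_free hT v
  have h4 : 0 < J.card := card_pos.2 ⟨v, hv⟩
  omega

/-- A pair lies in at most one triple, so choosing for each triple a listed pair inside it is
injective. -/
lemma card_le_of_hitting {T : Finset (Finset V)} (hT : IsPartial T) (l : List (V × V))
    (hl : ∀ t ∈ T, ∃ p ∈ l, p.1 ≠ p.2 ∧ p.1 ∈ t ∧ p.2 ∈ t) : T.card ≤ l.length := by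
  obtain rfl | ⟨t₀, ht₀⟩ := T.eq_empty_or_nonempty
  · simp
  have : Nonempty (V × V) := ⟨(hl t₀ ht₀).choose⟩
  choose! f hf1 hf2 hf3 hf4 using hl
  calc T.card ≤ l.toFinset.card :=
        card_le_card_of_injOn f (fun t ht => by simpa using hf1 t ht) fun s hs t ht hst =>
          hT.eq_of_mem s hs t ht (f s).1 (f s).2 (hf2 s hs) (hf3 s hs) (hf4 s hs)
            (hst ▸ hf3 t ht) (hst ▸ hf4 t ht)
    _ ≤ l.length := l.toFinset_card_le

/-- The number of triples disjoint from two given disjoint triples. -/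
lemma card_disjoint_triples [Fintype V] {T : Finset (Finset V)} (hT : IsPartial T)
    {A B : Finset V} (hA : A ∈ T) (hB : B ∈ T) (hAB : Disjoint A B) :
    ((T.filter fun t => Disjoint t A ∧ Disjoint t B).card : ℤ) =
      T.card + 4 - ∑ a ∈ A, (deg T a : ℤ) - ∑ b ∈ B, (deg T b : ℤ) +
        ∑ a ∈ A, ∑ b ∈ B, if b ∈ free T a then 0 else 1 := by
  -- Each joined pair (a, b) lies in exactly one triple, so the products of the intersection sizes
  -- count joined pairs.
  have hcov : ∑ t ∈ T, ((t ∩ A).card : ℤ) * (t ∩ B).card =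
      ∑ a ∈ A, ∑ b ∈ B, if b ∈ free T a then 0 else 1 := by
    have h1 : ∀ t ∈ T, ((t ∩ A).card : ℤ) * (t ∩ B).card =
        ∑ a ∈ A, ∑ b ∈ B, if a ∈ t ∧ b ∈ t then 1 else 0 := by
      intro t _
      rw [inter_comm t A, inter_comm t B, ← filter_mem_eq_inter, ← filter_mem_eq_inter,
        card_filter, card_filter]
      push_cast
      rw [sum_mul_sum]
      refine sum_congr rfl fun a _ => sum_congr rfl fun b _ => ?_
      by_cases ha : a ∈ t <;> by_cases hb : b ∈ t <;> simp [ha, hb]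
    rw [sum_congr rfl h1, sum_comm]
    refine sum_congr rfl fun a ha => ?_
    rw [sum_comm]
    refine sum_congr rfl fun b hb => ?_
    have hne : b ≠ a := fun h => disjoint_left.1 hAB ha (h ▸ hb)
    split_ifs with hfree
    · refine sum_eq_zero fun t ht => if_neg fun h => (mem_free.1 hfree).2 t ht h.1 h.2
    · have : ∃ t ∈ T, a ∈ t ∧ b ∈ t := by
        by_contra! h
        exact hfree (mem_free.2 ⟨hne, h⟩)
      obtain ⟨t, ht, h1, h2⟩ := this
      rw [sum_eq_single_of_mem t ht, if_pos ⟨h1, h2⟩]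
      intro s hs hst
      exact if_neg fun h => hst (hT.eq_of_mem s hs t ht a b hne.symm h.1 h.2 h1 h2)
  have hsmall : ∀ s ∈ T, ∀ t ∈ T, s ≠ t → (s ∩ t).card ≤ 1 := by
    intro s hs t ht hst
    refine card_le_one.2 fun a ha b hb => ?_
    by_contra hab
    rw [mem_inter] at ha hb
    exact hst (hT.eq_of_mem s hs t ht a b hab ha.1 hb.1 ha.2 hb.2)
  have hne : A ≠ B := by
    rintro rfl
    have := hT.card_eq A hA
    rw [disjoint_self_iff_empty] at hAB
    simp [hAB] at this
  -- The summand is the indicator of being disjoint from both, except at `A` and `B`, where it is (1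
  -- - 3)(1 - 0) = -2. Expanding the product gives the degree sums and the joined pairs.
  have hmain : ∑ t ∈ T, ((1 : ℤ) - (t ∩ A).card) * (1 - (t ∩ B).card) =
      ((T.filter fun t => Disjoint t A ∧ Disjoint t B).card : ℤ) - 4 := by
    have h1 : ∀ t ∈ T, ((1 : ℤ) - (t ∩ A).card) * (1 - (t ∩ B).card) =
        (if Disjoint t A ∧ Disjoint t B then 1 else 0) - (if t = A then 2 else 0)
          - if t = B then 2 else 0 := by
      intro t ht
      by_cases htA : t = A
      · subst htA
        have hd : ¬ (Disjoint t t ∧ Disjoint t B) := by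
          rintro ⟨h, -⟩
          rw [disjoint_self_iff_empty] at h
          have := hT.card_eq t ht
          simp [h] at this
        rw [if_neg hd, if_pos rfl, if_neg hne, inter_self, hT.card_eq t ht,
          disjoint_iff_inter_eq_empty.1 hAB]
        simp
      · by_cases htB : t = B
        · subst htB
          have hd : ¬ (Disjoint t A ∧ Disjoint t t) := by
            rintro ⟨-, h⟩
            rw [disjoint_self_iff_empty] at h
            have := hT.card_eq t ht
            simp [h] at this
          rw [if_neg hd, if_pos rfl, if_neg hne.symm, inter_self, hT.card_eq t ht,
            disjoint_iff_inter_eq_empty.1 hAB.symm]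
          simp
        · rw [if_neg htA, if_neg htB]
          have h1 := hsmall t ht A hA htA
          have h2 := hsmall t ht B hB htB
          simp only [disjoint_iff_inter_eq_empty, ← card_eq_zero]
          generalize (t ∩ A).card = x at *
          generalize (t ∩ B).card = y at *
          interval_cases x <;> interval_cases y <;> simp
    rw [sum_congr rfl h1, sum_sub_distrib, sum_sub_distrib, sum_ite_eq' T A, sum_ite_eq' T B,
      if_pos hA, if_pos hB, card_filter]
    push_cast
    ring
  have hexp : ∑ t ∈ T, ((1 : ℤ) - (t ∩ A).card) * (1 - (t ∩ B).card) =
      T.card - ∑ t ∈ T, ((t ∩ A).card : ℤ) - ∑ t ∈ T, ((t ∩ B).card : ℤ)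
        + ∑ t ∈ T, ((t ∩ A).card : ℤ) * (t ∩ B).card := by
    rw [card_eq_sum_ones]
    push_cast
    rw [← sum_sub_distrib, ← sum_sub_distrib, ← sum_add_distrib]
    exact sum_congr rfl fun t _ => by ring
  have hA' := congrArg (Nat.cast : ℕ → ℤ) (sum_card_inter (T := T) A)
  have hB' := congrArg (Nat.cast : ℕ → ℤ) (sum_card_inter (T := T) B)
  push_cast at hA' hB'
  rw [hcov, hA', hB'] at hexp
  linarith

/-- If the complement of three disjoint triples is always a triple, then the number of triples
disjoint from two given disjoint triples is even. -/
lemma even_disjoint_triples [Fintype V] {T : Finset (Finset V)} (hT : IsPartial T)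
    (hc : ∀ a ∈ T, ∀ b ∈ T, ∀ c ∈ T, Disjoint a b → Disjoint c a → Disjoint c b →
      (a ∪ b ∪ c)ᶜ ∈ T)
    {A B : Finset V} (hA : A ∈ T) (hB : B ∈ T) (hAB : Disjoint A B) :
    Even (T.filter fun t => Disjoint t A ∧ Disjoint t B).card := by
  rw [← ZMod.natCast_eq_zero_iff_even, card_eq_sum_ones]
  push_cast
  -- The map `t ↦ (A ∪ B ∪ t)ᶜ` is an involution without fixed points on the counted triples, so the
  -- ones cancel in pairs in `ZMod 2`.
  refine sum_involution (fun t _ => (A ∪ B ∪ t)ᶜ) (fun t _ => by decide) ?_ ?_ ?_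
  · intro t ht _ h
    have h1 : t.card = 3 := hT.card_eq t (mem_filter.1 ht).1
    obtain ⟨x, hx⟩ := card_pos.1 (by omega : 0 < t.card)
    have hx' := hx
    rw [← h] at hx'
    simp [hx] at hx'
  · intro t ht
    rw [mem_filter] at ht ⊢
    refine ⟨hc A hA B hB t ht.1 hAB ht.2.1 ht.2.2, ?_, ?_⟩
    · rw [disjoint_left]
      intro x hx hxA
      simp [hxA] at hx
    · rw [disjoint_left]
      intro x hx hxA
      simp [hxA] at hx
  · intro t ht
    rw [mem_filter] at ht
    ext x
    have h1 := fun hx : x ∈ t => Finset.disjoint_left.1 ht.2.1 hx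
    have h2 := fun hx : x ∈ t => Finset.disjoint_left.1 ht.2.2 hx
    simp only [mem_compl, mem_union]
    tauto

end TripleSystem

namespace TripleSystem

/-! ### Triple systems on twelve labels: excluded triples and a verified search. -/

open Finset

/-- The properties of the relation "`a`, `b`, `c` form a triple" of a partial triple system on
twelve points in which the complement of three disjoint triples is a triple. -/
structure TripleRel (L : Fin 12 → Fin 12 → Fin 12 → Prop) : Prop where
  swap : ∀ a b c, L a b c → L b a c
  rot : ∀ a b c, L a b c → L b c a
  ne : ∀ a b c, L a b c → a ≠ b
  uniq : ∀ a b c d, L a b c → L a b d → c = d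
  compl : ∀ a b c d e f g h i j k l, ([a, b, c, d, e, f, g, h, i, j, k, l] : List (Fin 12)).Nodup →
    L a b c → L d e f → L g h i → L j k l

/-- The triple `a b c` shares exactly two elements with a triple of the list. -/
def conflict (K : List (Fin 12 × Fin 12 × Fin 12)) (a b c : Fin 12) : Bool :=
  K.any fun l =>
    let m := fun u => u == l.1 || u == l.2.1 || u == l.2.2
    (m a && m b && !m c) || (m a && m c && !m b) || (m b && m c && !m a)

/-- The triple `a b c` is excluded by a list of triples. -/
def excluded (K : List (Fin 12 × Fin 12 × Fin 12)) (a b c : Fin 12) : Bool :=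
  conflict K a b c || K.any fun l => K.any fun r =>
    match (List.finRange 12).filter fun u =>
      !(u == l.1 || u == l.2.1 || u == l.2.2 || u == r.1 || u == r.2.1 || u == r.2.2 ||
        u == a || u == b || u == c) with
    | [p, q, s] => conflict K p q s
    | _ => false

variable {L : Fin 12 → Fin 12 → Fin 12 → Prop}

/-- Unordered form of `uniq`: each placement of `a`, `b` among `x`, `y`, `z` is rotated or swapped
into uniqueness of the third point. -/
lemma TripleRel.third (hL : TripleRel L) {x y z a b c : Fin 12} (hK : L x y z) (h : L a b c)
    (ha : a = x ∨ a = y ∨ a = z) (hb : b = x ∨ b = y ∨ b = z) : c = x ∨ c = y ∨ c = z := by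
  have hab := hL.ne _ _ _ h
  have h1 := hL.swap _ _ _ hK
  have h2 := hL.rot _ _ _ hK
  have h3 := hL.rot _ _ _ h2
  have h4 := hL.rot _ _ _ h1
  have h5 := hL.rot _ _ _ h4
  obtain rfl | rfl | rfl := ha <;> obtain rfl | rfl | rfl := hb <;> try exact absurd rfl hab
  · exact Or.inr (Or.inr (hL.uniq _ _ _ _ h hK))
  · exact Or.inr (Or.inl (hL.uniq _ _ _ _ h h4))
  · exact Or.inr (Or.inr (hL.uniq _ _ _ _ h h1))
  · exact Or.inl (hL.uniq _ _ _ _ h h2)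
  · exact Or.inr (Or.inl (hL.uniq _ _ _ _ h h3))
  · exact Or.inl (hL.uniq _ _ _ _ h h5)

lemma TripleRel.conflict_eq_false (hL : TripleRel L) {K : List (Fin 12 × Fin 12 × Fin 12)}
    (hK : ∀ l ∈ K, L l.1 l.2.1 l.2.2) {a b c : Fin 12} (h : L a b c) :
    conflict K a b c = false := by
  rw [conflict, List.any_eq_false]
  intro l hl
  have hr := hL.rot _ _ _ h
  have h1 := hL.third (hK l hl) h
  have h2 := hL.third (hK l hl) hr
  have h3 := hL.third (hK l hl) (hL.rot _ _ _ hr)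
  have hm : ∀ u, (u == l.1 || u == l.2.1 || u == l.2.2) = true ↔
      u = l.1 ∨ u = l.2.1 ∨ u = l.2.2 := fun u => by simp [or_assoc]
  rw [← hm, ← hm, ← hm] at h1 h2 h3
  dsimp only
  revert h1 h2 h3
  generalize (a == l.1 || a == l.2.1 || a == l.2.2) = x
  generalize (b == l.1 || b == l.2.1 || b == l.2.2) = y
  generalize (c == l.1 || c == l.2.1 || c == l.2.2) = w
  cases x <;> cases y <;> cases w <;> simp

/-- If two known triples and `a b c` leave exactly three labels, all twelve labels are distinct, so
by closure these three form a triple, which cannot conflict with a known one. -/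
lemma TripleRel.excluded_eq_false (hL : TripleRel L) {K : List (Fin 12 × Fin 12 × Fin 12)}
    (hK : ∀ l ∈ K, L l.1 l.2.1 l.2.2) {a b c : Fin 12} (h : L a b c) :
    excluded K a b c = false := by
  rw [excluded, Bool.or_eq_false_iff]
  refine ⟨hL.conflict_eq_false hK h, ?_⟩
  rw [List.any_eq_false]
  intro l hl
  rw [Bool.not_eq_true, List.any_eq_false]
  intro r hr
  rw [Bool.not_eq_true]
  split
  · rename_i p q s hpqs
    refine hL.conflict_eq_false hK ?_
    refine hL.compl l.1 l.2.1 l.2.2 r.1 r.2.1 r.2.2 a b c p q s ?_ (hK l hl) (hK r hr) h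
    -- A list of length twelve that contains every label has no repetition.
    rw [← Multiset.coe_nodup, ← Multiset.toFinset_card_eq_card_iff_nodup]
    have : ∀ u : Fin 12, u ∈ ([l.1, l.2.1, l.2.2, r.1, r.2.1, r.2.2, a, b, c, p, q, s] :
        List (Fin 12)) := by
      intro u
      have hu : u ∈ (List.finRange 12).filter (fun u =>
        !(u == l.1 || u == l.2.1 || u == l.2.2 || u == r.1 || u == r.2.1 || u == r.2.2 ||
        u == a || u == b || u == c)) ↔ u ∈ [p, q, s] := by rw [hpqs]
      simp only [List.mem_filter, List.mem_finRange, true_and, Bool.not_eq_true',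
        Bool.or_eq_false_iff, beq_eq_false_iff_ne, ne_eq, List.mem_cons, List.not_mem_nil,
        or_false] at hu ⊢
      tauto
    rw [show Multiset.toFinset _ = univ from eq_univ_iff_forall.2 fun u => by
      rw [Multiset.mem_toFinset]; exact this u]
    simp
  · rfl

/-- The points of the four-element blocks `{0, 1, 2, 3}`, `{4, 5, 6, 7}`, `{8, 9, 10, 11}` that
form a star with centre `0`, `4`, `8`. -/
def star (i j : Fin 12) : Bool :=
  i.val / 4 == j.val / 4 && i != j && (i.val % 4 == 0 || j.val % 4 == 0)

/-- The degree of a vertex when the free pairs are those of `star`. -/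
def starDeg (i : Fin 12) : ℕ := if i.val % 4 = 0 then 4 else 5

def cov (i j : Fin 12) : ℕ := if star i j then 0 else 1

/-- Two triples that contradict the parity of the number of triples disjoint from both. -/
def oddPair (l r : Fin 12 × Fin 12 × Fin 12) : Bool :=
  !(l.1 == r.1 || l.1 == r.2.1 || l.1 == r.2.2 || l.2.1 == r.1 || l.2.1 == r.2.1 ||
    l.2.1 == r.2.2 || l.2.2 == r.1 || l.2.2 == r.2.1 || l.2.2 == r.2.2) &&
  -- The count of `card_disjoint_triples` modulo 2 for 19 triples; the summand 4 and the signs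
  -- disappear.
  (19 + starDeg l.1 + starDeg l.2.1 + starDeg l.2.2 + starDeg r.1 + starDeg r.2.1 + starDeg r.2.2
    + cov l.1 r.1 + cov l.1 r.2.1 + cov l.1 r.2.2 + cov l.2.1 r.1 + cov l.2.1 r.2.1
    + cov l.2.1 r.2.2 + cov l.2.2 r.1 + cov l.2.2 r.2.1 + cov l.2.2 r.2.2) % 2 == 1

/-- The triple `a b c` cannot be added to the list. -/
def starBad (K : List (Fin 12 × Fin 12 × Fin 12)) (a b c : Fin 12) : Bool :=
  star a b || star a c || star b c || a == b || a == c || b == c || conflict K a b c ||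
    K.any (oddPair (a, b, c))

/-- Search for a triple system containing the given triples, covering the given pairs. -/
def refute : List (Fin 12 × Fin 12) → List (Fin 12 × Fin 12 × Fin 12) → Bool
  -- When the pairs are used up, no contradiction has been found. Before that, the guard makes sure
  -- that the pair has a third point, and every choice of it has to fail.
  | [], _ => false
  | p :: ps, K => !star p.1 p.2 && p.1 != p.2 && (List.finRange 12).all fun z =>
      starBad K p.1 p.2 z || refute ps ((p.1, p.2, z) :: K)

/-- A triple relation whose free pairs are those of `star`. -/
structure StarRel (L : Fin 12 → Fin 12 → Fin 12 → Prop) : Prop extends TripleRel L where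
  star : ∀ a b c, L a b c → star a b = false
  cover : ∀ a b, a ≠ b → TripleSystem.star a b = false → ∃ c, L a b c
  parity : ∀ l r : Fin 12 × Fin 12 × Fin 12, L l.1 l.2.1 l.2.2 → L r.1 r.2.1 r.2.2 →
    oddPair l r = false

lemma StarRel.starBad_eq_false (hL : StarRel L) {K : List (Fin 12 × Fin 12 × Fin 12)}
    (hK : ∀ l ∈ K, L l.1 l.2.1 l.2.2) {a b c : Fin 12} (h : L a b c) :
    starBad K a b c = false := by
  have h2 := hL.rot _ _ _ h
  have h3 := hL.rot _ _ _ (hL.swap _ _ _ h)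
  simp only [starBad, Bool.or_eq_false_iff, beq_eq_false_iff_ne, ne_eq, List.any_eq_false]
  exact ⟨⟨⟨⟨⟨⟨⟨hL.star _ _ _ h, hL.star _ _ _ h3⟩, hL.star _ _ _ h2⟩, hL.ne _ _ _ h⟩,
    hL.ne _ _ _ h3⟩, hL.ne _ _ _ h2⟩, hL.conflict_eq_false hK h⟩,
    fun l hl => by rw [hL.parity (a, b, c) l h (hK l hl)]; simp⟩

/-- The search branches over the third point of each listed pair; for an actual system the branch of
the true third points survives. -/
lemma StarRel.refute_sound (hL : StarRel L) (ps : List (Fin 12 × Fin 12)) :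
    ∀ K : List (Fin 12 × Fin 12 × Fin 12), (∀ l ∈ K, L l.1 l.2.1 l.2.2) →
      refute ps K = false := by
  induction ps with
  | nil => exact fun _ _ => rfl
  | cons p ps ih =>
    intro K hK
    by_contra h
    rw [Bool.not_eq_false, refute, Bool.and_eq_true, Bool.and_eq_true] at h
    obtain ⟨⟨h1, h2⟩, h3⟩ := h
    obtain ⟨z, hz⟩ := hL.cover p.1 p.2 (by simpa using h2) (by simpa using h1)
    rw [List.all_eq_true] at h3
    have h4 := h3 z (List.mem_finRange z)
    rw [hL.starBad_eq_false hK hz, Bool.false_or, ih] at h4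
    · exact Bool.false_ne_true h4
    · intro l hl
      rcases List.mem_cons.1 hl with rfl | hl
      · exact hz
      · exact hK l hl

/-- Any third point of 0 and 4 other than 8 dies in a search over six further pairs. -/
lemma StarRel.centres (hL : StarRel L) : L 0 4 8 := by
  obtain ⟨z, hz⟩ := hL.cover 0 4 (by decide) (by decide)
  -- The label 9 replaces 10 when `z` is 10, so that the pairs searched are not already covered by
  -- the first triple.
  have h1 := hL.refute_sound [(0, 8), (1, 2), (0, 5), (0, 6), (0, if z = 10 then 9 else 10),
    (4, if z = 10 then 9 else 10)] [(0, 4, z)] (by simpa using hz)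
  have h2 := hL.starBad_eq_false (K := []) (by simp) hz
  have key : ∀ z : Fin 12, z ≠ 8 → starBad [] 0 4 z = false →
      refute [(0, 8), (1, 2), (0, 5), (0, 6), (0, if z = 10 then 9 else 10),
        (4, if z = 10 then 9 else 10)] [(0, 4, z)] = true := by
    decide +kernel
  by_cases h8 : z = 8
  · exact h8 ▸ hz
  · rw [key z h8 h2] at h1
    exact absurd h1 (by decide)

end TripleSystem

namespace TripleSystem

/-! ### Rigidity of the star pattern. -/

open Finset

variable {L : Fin 12 → Fin 12 → Fin 12 → Prop}

/-- A relabelling that respects blocks and centres preserves the star pattern, hence free pairs,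
degrees and parities. It serves to bring matchings between leaves into standard position. -/
lemma StarRel.comp (hL : StarRel L) {s : Fin 12 → Fin 12} (hs : Function.Injective s)
    (hdiv : ∀ i, (s i).val / 4 = i.val / 4) (hmod : ∀ i, ((s i).val % 4 = 0) = (i.val % 4 = 0)) :
    StarRel fun a b c => L (s a) (s b) (s c) := by
  have hbeq : ∀ i j, (s i == s j) = (i == j) := fun i j => by
    rw [Bool.eq_iff_iff, beq_iff_eq, beq_iff_eq, hs.eq_iff]
  have hstar : ∀ i j, TripleSystem.star (s i) (s j) = TripleSystem.star i j := fun i j => by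
    have hm : ∀ i, ((s i).val % 4 == 0) = (i.val % 4 == 0) := fun i => by
      rw [Bool.eq_iff_iff, beq_iff_eq, beq_iff_eq, hmod]
    simp only [TripleSystem.star, hdiv, bne, hbeq, hm]
  have hdeg : ∀ i, starDeg (s i) = starDeg i := fun i => by simp only [starDeg, hmod]
  have hcov : ∀ i j, TripleSystem.cov (s i) (s j) = TripleSystem.cov i j := fun i j => by
    simp only [cov, hstar]
  refine ⟨⟨fun a b c => hL.swap _ _ _, fun a b c => hL.rot _ _ _,
    fun a b c h hab => hL.ne _ _ _ h (congrArg s hab), fun a b c d h h' => hs (hL.uniq _ _ _ _ h h'),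
    ?_⟩, fun a b c h => ?_, fun a b hab h => ?_, fun l r h h' => ?_⟩
  · intro a b c d e f g h i j k l hnd h1 h2 h3
    exact hL.compl (s a) (s b) (s c) (s d) (s e) (s f) (s g) (s h) (s i) (s j) (s k) (s l)
      (by simpa using hnd.map hs) h1 h2 h3
  · rw [← hstar]
    exact hL.star _ _ _ h
  · obtain ⟨c, hc⟩ := hL.cover (s a) (s b) (hs.ne hab) (by rw [hstar, h])
    obtain ⟨c, rfl⟩ := Finite.injective_iff_surjective.1 hs c
    exact ⟨c, hc⟩
  · have := hL.parity (s l.1, s l.2.1, s l.2.2) (s r.1, s r.2.1, s r.2.2) h h'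
    simpa only [oddPair, hbeq, hdeg, hcov] using this

/-- The star pattern and the triple of centres leave, as the only alternative, another leaf of the
block of 4, and the search refutes it. So the centre 0 matches the leaves around 4 with those around
8. -/
lemma StarRel.zero_five (hL : StarRel L) (i : Fin 3) :
    ∃ j : Fin 3, L 0 (![5, 6, 7] i) (![9, 10, 11] j) := by
  obtain ⟨z, hz⟩ := hL.cover 0 (![5, 6, 7] i) (by revert i; decide) (by revert i; decide)
  have h1 := hL.refute_sound [(1, 4), (0, if i = 0 then (if z = 6 then 7 else 6) else
    if i = 1 then (if z = 5 then 7 else 5) else (if z = 5 then 6 else 5))]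
    [(0, ![5, 6, 7] i, z), (0, 4, 8)] (by simpa using ⟨hz, hL.centres⟩)
  have h2 := hL.starBad_eq_false (K := [(0, 4, 8)]) (by simpa using hL.centres) hz
  have key : ∀ (i : Fin 3) (z : Fin 12), starBad [(0, 4, 8)] 0 (![5, 6, 7] i) z = false →
      refute [(1, 4), (0, if i = 0 then (if z = 6 then 7 else 6) else
        if i = 1 then (if z = 5 then 7 else 5) else (if z = 5 then 6 else 5))]
        [(0, ![5, 6, 7] i, z), (0, 4, 8)] = false → ∃ j : Fin 3, z = ![9, 10, 11] j := by
    decide +kernel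
  obtain ⟨j, rfl⟩ := key i z h2 h1
  exact ⟨j, hz⟩

/-- Adding 4 permutes the blocks cyclically, which carries statements about the centre 0 over to the
other centres. -/
lemma StarRel.rotate (hL : StarRel L) : StarRel fun a b c => L (a + 4) (b + 4) (c + 4) := by
  refine ⟨⟨fun a b c => hL.swap _ _ _, fun a b c => hL.rot _ _ _,
    fun a b c h hab => hL.ne _ _ _ h (by rw [hab]), fun a b c d h h' =>
      add_right_cancel (hL.uniq _ _ _ _ h h'), ?_⟩, fun a b c h => ?_, fun a b hab h => ?_,
    fun l r h h' => ?_⟩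
  · intro a b c d e f g h i j k l hnd h1 h2 h3
    exact hL.compl (a + 4) (b + 4) (c + 4) (d + 4) (e + 4) (f + 4) (g + 4) (h + 4) (i + 4) (j + 4)
      (k + 4) (l + 4) (by simpa using hnd.map (add_left_injective (4 : Fin 12))) h1 h2 h3
  · have key : ∀ a b : Fin 12, TripleSystem.star (a + 4) (b + 4) = TripleSystem.star a b := by
      decide +kernel
    exact (key a b).symm.trans (hL.star _ _ _ h)
  · have key : ∀ a b : Fin 12, TripleSystem.star (a + 4) (b + 4) = TripleSystem.star a b := by
      decide +kernel
    obtain ⟨c, hc⟩ := hL.cover (a + 4) (b + 4) (by simpa using hab) ((key a b).trans h)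
    exact ⟨c - 4, by simpa using hc⟩
  · have h1 : ∀ a b : Fin 12, cov (a + 4) (b + 4) = cov a b := by decide +kernel
    have h2 : ∀ a : Fin 12, starDeg (a + 4) = starDeg a := by decide +kernel
    have h3 : ∀ a b : Fin 12, (a + 4 == b + 4) = (a == b) := by decide +kernel
    have := hL.parity (l.1 + 4, l.2.1 + 4, l.2.2 + 4) (r.1 + 4, r.2.1 + 4, r.2.2 + 4) h h'
    simpa only [oddPair, h1, h2, h3] using this

lemma StarRel.eight_one (hL : StarRel L) (i : Fin 3) :
    ∃ j : Fin 3, L 8 (![1, 2, 3] i) (![5, 6, 7] j) := by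
  obtain ⟨j, hj⟩ := hL.rotate.rotate.zero_five i
  refine ⟨j, ?_⟩
  fin_cases i <;> fin_cases j <;> exact hj

lemma TripleRel.injective_of_third (hL : TripleRel L) {c : Fin 12} {u v : Fin 3 → Fin 12}
    {f : Fin 3 → Fin 3} (hu : Function.Injective u) (h : ∀ i, L c (u i) (v (f i))) :
    Function.Injective f := by
  intro a b hab
  have h1 := hL.swap _ _ _ (hL.rot _ _ _ (hL.rot _ _ _ (h a)))
  have h2 := hL.swap _ _ _ (hL.rot _ _ _ (hL.rot _ _ _ (h b)))
  rw [hab] at h1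
  exact hu (hL.uniq _ _ _ _ h1 h2)

/-- Rotation gives the matching in the opposite direction; injective on three leaves, it is onto and
can be read backwards. -/
lemma StarRel.four_one (hL : StarRel L) (i : Fin 3) :
    ∃ j : Fin 3, L 4 (![1, 2, 3] i) (![9, 10, 11] j) := by
  have key : ∀ j : Fin 3, ∃ i : Fin 3, L 4 (![9, 10, 11] j) (![1, 2, 3] i) := by
    intro j
    obtain ⟨i, hi⟩ := hL.rotate.zero_five j
    refine ⟨i, ?_⟩
    fin_cases i <;> fin_cases j <;> exact hi
  choose f hf using key
  obtain ⟨j, rfl⟩ := Finite.injective_iff_surjective.1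
    (hL.toTripleRel.injective_of_third (by decide) hf) i
  exact ⟨j, hL.rot _ _ _ (hL.swap _ _ _ (hf j))⟩

/-- The triples of the group `(ℤ/2)² × ℤ/3`. -/
def model : List (Fin 12 × Fin 12 × Fin 12) :=
  [(0, 4, 8), (1, 2, 3), (5, 6, 7), (9, 10, 11), (0, 5, 9), (0, 6, 10), (0, 7, 11), (4, 1, 9),
    (4, 2, 10), (4, 3, 11), (8, 1, 5), (8, 2, 6), (8, 3, 7), (1, 6, 11), (1, 7, 10), (2, 5, 11),
    (2, 7, 9), (3, 5, 10), (3, 6, 9)]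

/-- When the matchings through 8 and 4 are standard, closure forces the one through 0; the remaining
triples then follow one at a time, since a suitable pair has a single admissible third point. -/
lemma StarRel.model_of_matching (hL : StarRel L)
    (h8 : ∀ i : Fin 3, L 8 (![1, 2, 3] i) (![5, 6, 7] i))
    (h4 : ∀ i : Fin 3, L 4 (![1, 2, 3] i) (![9, 10, 11] i)) :
    ∀ l ∈ model, L l.1 l.2.1 l.2.2 := by
  let K₀ : List (Fin 12 × Fin 12 × Fin 12) :=
    [(0, 4, 8), (4, 1, 9), (4, 2, 10), (4, 3, 11), (8, 1, 5), (8, 2, 6), (8, 3, 7)]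
  have hK₀ : ∀ l ∈ K₀, L l.1 l.2.1 l.2.2 := by
    simpa [K₀] using ⟨hL.centres, h4 0, h4 1, h4 2, h8 0, h8 1, h8 2⟩
  have h0 : ∀ i : Fin 3, L 0 (![5, 6, 7] i) (![9, 10, 11] i) := by
    intro i
    obtain ⟨j, hj⟩ := hL.zero_five i
    have h := hL.excluded_eq_false hK₀ hj
    have key : ∀ i j : Fin 3, excluded K₀ 0 (![5, 6, 7] i) (![9, 10, 11] j) = false → i = j := by
      decide +kernel
    rwa [← key i j h] at hj
  let K₁ := K₀ ++ [(0, 5, 9), (0, 6, 10), (0, 7, 11)]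
  have hK₁ : ∀ l ∈ K₁, L l.1 l.2.1 l.2.2 := by
    intro l hl
    rcases List.mem_append.1 hl with hl | hl
    · exact hK₀ l hl
    · have : ∀ l ∈ ([(0, 5, 9), (0, 6, 10), (0, 7, 11)] : List (Fin 12 × Fin 12 × Fin 12)),
          L l.1 l.2.1 l.2.2 := by simpa using ⟨h0 0, h0 1, h0 2⟩
      exact this l hl
  have forced : ∀ (K : List (Fin 12 × Fin 12 × Fin 12)), (∀ l ∈ K, L l.1 l.2.1 l.2.2) →
      ∀ a b c, a ≠ b → TripleSystem.star a b = false →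
        (∀ z, starBad K a b z = false → z = c) → L a b c := by
    intro K hK a b c hab hs h
    obtain ⟨z, hz⟩ := hL.cover a b hab hs
    exact h z (hL.starBad_eq_false hK hz) ▸ hz
  have h123 := forced K₁ hK₁ 1 2 3 (by decide) (by decide) (by decide +kernel)
  have h567 := forced K₁ hK₁ 5 6 7 (by decide) (by decide) (by decide +kernel)
  have h91011 := forced K₁ hK₁ 9 10 11 (by decide) (by decide) (by decide +kernel)
  let K₂ := K₁ ++ [(1, 2, 3), (5, 6, 7), (9, 10, 11)]
  have hK₂ : ∀ l ∈ K₂, L l.1 l.2.1 l.2.2 := by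
    intro l hl
    rcases List.mem_append.1 hl with hl | hl
    · exact hK₁ l hl
    · have : ∀ l ∈ ([(1, 2, 3), (5, 6, 7), (9, 10, 11)] : List (Fin 12 × Fin 12 × Fin 12)),
          L l.1 l.2.1 l.2.2 := by simpa using ⟨h123, h567, h91011⟩
      exact this l hl
  have h1 := forced K₂ hK₂ 1 6 11 (by decide) (by decide) (by decide +kernel)
  have h2 := forced K₂ hK₂ 1 7 10 (by decide) (by decide) (by decide +kernel)
  have h3 := forced K₂ hK₂ 2 5 11 (by decide) (by decide) (by decide +kernel)
  have h4' := forced K₂ hK₂ 2 7 9 (by decide) (by decide) (by decide +kernel)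
  have h5 := forced K₂ hK₂ 3 5 10 (by decide) (by decide) (by decide +kernel)
  have h6 := forced K₂ hK₂ 3 6 9 (by decide) (by decide) (by decide +kernel)
  simpa [model] using ⟨hL.centres, h123, h567, h91011, h0 0, h0 1, h0 2, h4 0, h4 1, h4 2, h8 0,
    h8 1, h8 2, h1, h2, h3, h4', h5, h6⟩

/-- Relabelling the leaves around 4 and around 8 along the matchings `α` and `β`, with the first
block fixed, makes both matchings standard. -/
theorem StarRel.exists_model (hL : StarRel L) : ∃ s : Fin 12 → Fin 12, Function.Injective s ∧
    ∀ l ∈ model, L (s l.1) (s l.2.1) (s l.2.2) := by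
  choose α hα using hL.eight_one
  choose β hβ using hL.four_one
  have hαi := hL.toTripleRel.injective_of_third (by decide) hα
  have hβi := hL.toTripleRel.injective_of_third (by decide) hβ
  let s : Fin 12 → Fin 12 := ![0, 1, 2, 3, 4, ![5, 6, 7] (α 0), ![5, 6, 7] (α 1), ![5, 6, 7] (α 2),
    8, ![9, 10, 11] (β 0), ![9, 10, 11] (β 1), ![9, 10, 11] (β 2)]
  have hdiv : ∀ i, (s i).val / 4 = i.val / 4 := by
    have h5 : ∀ j : Fin 3, (![(5 : Fin 12), 6, 7] j).val / 4 = 1 := by decide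
    have h9 : ∀ j : Fin 3, (![(9 : Fin 12), 10, 11] j).val / 4 = 2 := by decide
    intro i
    fin_cases i <;> first | rfl | exact h5 _ | exact h9 _
  have hmod : ∀ i, ((s i).val % 4 = 0) = (i.val % 4 = 0) := by
    have h5 : ∀ j : Fin 3, ((![(5 : Fin 12), 6, 7] j).val % 4 = 0) = False := by decide
    have h9 : ∀ j : Fin 3, ((![(9 : Fin 12), 10, 11] j).val % 4 = 0) = False := by decide
    intro i
    fin_cases i <;> first | rfl | exact (h5 _).trans (by simp) | exact (h9 _).trans (by simp)
  have hs : Function.Injective s := by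
    have key : ∀ (α β : Fin 3 → Fin 3), Function.Injective α → Function.Injective β →
        Function.Injective (![0, 1, 2, 3, 4, ![5, 6, 7] (α 0), ![5, 6, 7] (α 1), ![5, 6, 7] (α 2),
          8, ![9, 10, 11] (β 0), ![9, 10, 11] (β 1), ![9, 10, 11] (β 2)] : Fin 12 → Fin 12) := by
      decide +kernel
    exact key α β hαi hβi
  refine ⟨s, hs, (hL.comp hs hdiv hmod).model_of_matching ?_ ?_⟩
  · intro i
    have := hα i
    fin_cases i <;> exact this
  · intro i
    have := hβ i
    fin_cases i <;> exact this

end TripleSystem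

namespace TripleSystem

/-! ### Transport to labels, and the case of an isolated free pair. -/

open Finset

variable {V : Type*} [DecidableEq V]

/-- The relation of forming a triple, transported to twelve labels. -/
def rel (T : Finset (Finset V)) (e : Fin 12 → V) (i j k : Fin 12) : Prop :=
  ({e i, e j, e k} : Finset V) ∈ T

lemma pairwise_ne_of_card {a b c : V} (h : ({a, b, c} : Finset V).card = 3) :
    a ≠ b ∧ a ≠ c ∧ b ≠ c := by
  refine ⟨?_, ?_, ?_⟩ <;> rintro rfl
  · rw [insert_eq_of_mem (mem_insert_self _ _)] at h
    have := card_le_two (a := a) (b := c)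
    omega
  · rw [insert_comm, pair_eq_singleton] at h
    have := card_le_two (a := b) (b := a)
    omega
  · rw [pair_eq_singleton] at h
    have := card_le_two (a := a) (b := b)
    omega

lemma exists_sorted_labels {T : Finset (Finset V)} (hT : IsPartial T) {e : Fin 12 → V}
    (he : Function.Surjective e) {t : Finset V} (ht : t ∈ T) :
    ∃ i j k : Fin 12, i < j ∧ j < k ∧ t = {e i, e j, e k} := by
  obtain ⟨x, y, z, hxy, hxz, hyz, rfl⟩ := card_eq_three.1 (hT.card_eq t ht)
  obtain ⟨i, rfl⟩ := he x
  obtain ⟨j, rfl⟩ := he y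
  obtain ⟨k, rfl⟩ := he z
  have hij : i ≠ j := fun h => hxy (congrArg e h)
  have hik : i ≠ k := fun h => hxz (congrArg e h)
  have hjk : j ≠ k := fun h => hyz (congrArg e h)
  rcases hij.lt_or_gt with h1 | h1 <;> rcases hjk.lt_or_gt with h2 | h2 <;>
    rcases hik.lt_or_gt with h3 | h3
  · exact ⟨i, j, k, h1, h2, rfl⟩
  · exact absurd (h1.trans h2) h3.asymm
  · exact ⟨i, k, j, h3, h2, by ext; simp; tauto⟩
  · exact ⟨k, i, j, h3, h1, by ext; simp; tauto⟩
  · exact ⟨j, i, k, h1, h3, by ext; simp; tauto⟩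
  · exact ⟨j, k, i, h2, h3, by ext; simp; tauto⟩
  · exact absurd (h2.trans h1) h3.asymm
  · exact ⟨k, j, i, h2, h1, by ext; simp; tauto⟩

variable [Fintype V]

lemma mem_of_nodup {X : Type*} [Fintype X] [DecidableEq X] {l : List X} (hl : l.Nodup)
    (h : l.length = Fintype.card X) (x : X) : x ∈ l := by
  have h1 := eq_univ_of_card _ ((List.toFinset_card_of_nodup hl).trans h)
  rw [← List.mem_toFinset, h1]
  exact mem_univ x

lemma tripleRel_rel {T : Finset (Finset V)} (hT : IsPartial T)
    (hc : ∀ a ∈ T, ∀ b ∈ T, ∀ c ∈ T, Disjoint a b → Disjoint c a → Disjoint c b →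
      (a ∪ b ∪ c)ᶜ ∈ T) {e : Fin 12 → V} (he : Function.Bijective e) :
    TripleRel (rel T e) := by
  refine ⟨fun a b c h => ?_, fun a b c h => ?_, fun a b c h => ?_, fun a b c d h h' => ?_, ?_⟩
  · rw [rel, insert_comm]
    exact h
  · rw [rel, show ({e b, e c, e a} : Finset V) = {e a, e b, e c} by ext; simp; tauto]
    exact h
  · exact fun hab => (pairwise_ne_of_card (hT.card_eq _ h)).1 (congrArg e hab)
  · have h1 := pairwise_ne_of_card (hT.card_eq _ h)
    have h2 := pairwise_ne_of_card (hT.card_eq _ h')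
    have h3 := hT.eq_of_mem _ h _ h' (e a) (e b) h1.1 (by simp) (by simp) (by simp) (by simp)
    have h4 : e c ∈ ({e a, e b, e d} : Finset V) := h3 ▸ (by simp)
    simp only [mem_insert, mem_singleton] at h4
    rcases h4 with h4 | h4 | h4
    · exact absurd h4.symm h1.2.1
    · exact absurd h4.symm h1.2.2
    · exact he.1 h4
  · intro a b c d f g h i j k l m hnd h1 h2 h3
    have hmem : ∀ u : Fin 12, u ∈ ([a, b, c, d, f, g, h, i, j, k, l, m] : List (Fin 12)) :=
      mem_of_nodup hnd (by simp)
    have hset : ∀ x y z : Fin 12, ({e x, e y, e z} : Finset V) = ([x, y, z].map e).toFinset :=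
      fun x y z => by simp
    have hdisj : ∀ p q : List (Fin 12), p.Disjoint q →
        Disjoint (p.map e).toFinset (q.map e).toFinset := by
      intro p q hpq
      rw [disjoint_left]
      intro v hv hv'
      rw [List.mem_toFinset, List.mem_map] at hv hv'
      obtain ⟨u, hu, rfl⟩ := hv
      obtain ⟨u', hu', huu⟩ := hv'
      exact hpq hu (he.1 huu ▸ hu')
    have hn1 : ([a, b, c] ++ ([d, f, g] ++ ([h, i, j] ++ [k, l, m]))).Nodup := hnd
    rw [List.nodup_append'] at hn1
    have hn2 := hn1.2.1
    rw [List.nodup_append'] at hn2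
    have hn3 : ([a, b, c, d, f, g, h, i, j] ++ [k, l, m]).Nodup := hnd
    rw [List.nodup_append'] at hn3
    have key := hc _ h1 _ h2 _ h3 ?_ ?_ ?_
    · rw [rel]
      convert key using 1
      ext v
      obtain ⟨u, rfl⟩ := he.2 v
      have h4 := hmem u
      have h5 : u ∈ [k, l, m] → u ∉ [a, b, c, d, f, g, h, i, j] := fun h h' => hn3.2.2 h' h
      simp only [mem_compl, mem_union, mem_insert, mem_singleton, he.1.eq_iff, List.mem_cons,
        List.not_mem_nil, or_false] at h4 h5 ⊢
      constructor
      · intro h6 h7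
        exact h5 h6 (by simpa only [or_assoc] using h7)
      · intro h6
        by_contra h7
        simp only [or_assoc] at h6
        simp only [not_or] at h6 h7
        simp only [h6, h7, or_false] at h4
    · rw [hset, hset]
      exact hdisj _ _ fun u h4 h5 => hn1.2.2 h4 (List.mem_append_left _ h5)
    · rw [hset, hset]
      exact hdisj _ _ fun u h4 h5 =>
        hn1.2.2 h5 (List.mem_append_right _ (List.mem_append_left _ h4))
    · rw [hset, hset]
      exact hdisj _ _ fun u h4 h5 => hn2.2.2 h5 (List.mem_append_left _ h4)

/-- Bounding the number of triples by a hitting set of pairs for those triples that are not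
excluded by a list of known triples. -/
lemma card_le_of_excluded {T : Finset (Finset V)} (hT : IsPartial T) {e : Fin 12 → V}
    (he : Function.Bijective e) (hL : TripleRel (rel T e)) (K : List (Fin 12 × Fin 12 × Fin 12))
    (hK : ∀ l ∈ K, rel T e l.1 l.2.1 l.2.2) (ps : List (Fin 12 × Fin 12))
    (hps : ∀ p ∈ ps, p.1 ≠ p.2)
    (h : ∀ a b c : Fin 12, a < b → b < c → (ps.any fun p => (p.1 == a || p.1 == b || p.1 == c) &&
      (p.2 == a || p.2 == b || p.2 == c)) = true ∨ excluded K a b c = true) :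
    T.card ≤ ps.length := by
  rw [← List.length_map (f := fun p : Fin 12 × Fin 12 => (e p.1, e p.2))]
  refine card_le_of_hitting hT _ fun t ht => ?_
  obtain ⟨i, j, k, hij, hjk, rfl⟩ := exists_sorted_labels hT he.2 ht
  rcases h i j k hij hjk with h | h
  · rw [List.any_eq_true] at h
    obtain ⟨p, hp, h⟩ := h
    refine ⟨_, List.mem_map_of_mem hp, he.1.ne (hps p hp), ?_⟩
    simp only [Bool.and_eq_true, Bool.or_eq_true, beq_iff_eq, or_assoc] at h
    simpa only [mem_insert, mem_singleton, he.1.eq_iff] using h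
  · rw [hL.excluded_eq_false hK ht] at h
    exact absurd h (by decide)

/-- Here 10 and 11 are the ends of an isolated free pair, and the triples through them match the
other labels along a cycle of length ten. The first ten pairs of the hitting list meet the triples
through 10 or 11, the last eight meet every other triple that is not excluded. -/
lemma card_le_of_ten_cycle {T : Finset (Finset V)} (hT : IsPartial T) {e : Fin 12 → V}
    (he : Function.Bijective e) (hL : TripleRel (rel T e))
    (hK : ∀ l ∈ ([(10, 0, 1), (10, 2, 3), (10, 4, 5), (10, 6, 7), (10, 8, 9), (11, 1, 2),
      (11, 3, 4), (11, 5, 6), (11, 7, 8), (11, 9, 0)] : List (Fin 12 × Fin 12 × Fin 12)),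
        rel T e l.1 l.2.1 l.2.2) : T.card ≤ 18 :=
  card_le_of_excluded hT he hL _ hK [(10, 0), (10, 2), (10, 4), (10, 6), (10, 8), (11, 1), (11, 3),
    (11, 5), (11, 7), (11, 9), (0, 2), (4, 6), (4, 8), (6, 8), (1, 3), (5, 7), (5, 9), (7, 9)]
    (by decide +kernel) (by decide +kernel)

/-- The same hitting argument when the two matchings form cycles of lengths four and six. -/
lemma card_le_of_four_six_cycle {T : Finset (Finset V)} (hT : IsPartial T) {e : Fin 12 → V}
    (he : Function.Bijective e) (hL : TripleRel (rel T e))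
    (hK : ∀ l ∈ ([(10, 0, 1), (10, 2, 3), (10, 4, 5), (10, 6, 7), (10, 8, 9), (11, 1, 2),
      (11, 3, 0), (11, 5, 6), (11, 7, 8), (11, 9, 4)] : List (Fin 12 × Fin 12 × Fin 12)),
        rel T e l.1 l.2.1 l.2.2) : T.card ≤ 18 :=
  card_le_of_excluded hT he hL _ hK [(10, 0), (10, 2), (10, 4), (10, 6), (10, 8), (11, 1), (11, 3),
    (11, 5), (11, 7), (11, 9), (0, 2), (1, 3), (4, 6), (6, 8), (4, 8), (5, 7), (7, 9), (5, 9)]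
    (by decide +kernel) (by decide +kernel)

/-- Two fixed point free involutions without a common orbit on ten points generate a cycle of
length ten, or cycles of length four and six. -/
lemma exists_cycle {X : Type*} [Fintype X] [DecidableEq X] (hX : Fintype.card X = 10) (f g : X → X)
    (hf : ∀ x, f (f x) = x) (hg : ∀ x, g (g x) = x) (hf' : ∀ x, f x ≠ x) (hg' : ∀ x, g x ≠ x)
    (hfg : ∀ x, f x ≠ g x) :
    ∃ a b c d p q r s u v : X, [a, b, c, d, p, q, r, s, u, v].Nodup ∧ f a = b ∧ f c = d ∧ f p = q ∧
      f r = s ∧ f u = v ∧ g b = c ∧ g q = r ∧ g s = u ∧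
        ((g d = p ∧ g v = a) ∨ (g d = a ∧ g v = p)) := by
  have hex : ∀ l : List X, l.length < 10 → ∃ x, x ∉ l := by
    intro l hl
    by_contra! h
    have h1 : l.toFinset = univ := eq_univ_iff_forall.2 fun x => List.mem_toFinset.2 (h x)
    have h2 := l.toFinset_card_le
    rw [h1, card_univ, hX] at h2
    omega
  have hall : ∀ l : List X, l.Nodup → l.length = 10 → ∀ x, x ∈ l := fun l hl h =>
    mem_of_nodup hl (h.trans hX.symm)
  -- The cycles alternate between `f` and `g` and are longer than two, so ten points form one cycle
  -- or split as 4 + 6.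
  by_cases h4 : ∃ a, g (f (g (f a))) = a
  · obtain ⟨a, ha⟩ := h4
    obtain ⟨b, hb⟩ : ∃ b, f a = b := ⟨_, rfl⟩
    obtain ⟨c, hc⟩ : ∃ c, g b = c := ⟨_, rfl⟩
    obtain ⟨d, hd⟩ : ∃ d, f c = d := ⟨_, rfl⟩
    rw [hb, hc, hd] at ha
    have n4 : [a, b, c, d].Nodup := by
      clear hex hall
      simp only [List.nodup_cons, List.mem_cons, List.not_mem_nil, not_or, not_false_eq_true, and_true,
        or_false, List.nodup_nil]
      and_intros <;> grind
    obtain ⟨p, hp⟩ := hex [a, b, c, d] (by simp)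
    obtain ⟨q, hq⟩ : ∃ q, f p = q := ⟨_, rfl⟩
    obtain ⟨r, hr⟩ : ∃ r, g q = r := ⟨_, rfl⟩
    obtain ⟨s, hs⟩ : ∃ s, f r = s := ⟨_, rfl⟩
    obtain ⟨u, hu⟩ : ∃ u, g s = u := ⟨_, rfl⟩
    obtain ⟨v, hv⟩ : ∃ v, f u = v := ⟨_, rfl⟩
    have n8 : [a, b, c, d, p, q, r, s].Nodup := by
      clear hex hall
      simp only [List.nodup_cons, List.mem_cons, List.not_mem_nil, not_or, not_false_eq_true, and_true,
        or_false, List.nodup_nil] at n4 hp ⊢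
      and_intros <;> grind
    -- Two cycles of length four would leave two points, on which `f` and `g` would agree.
    have hup : u ≠ p := by
      intro hup
      obtain ⟨w, hw⟩ := hex _ (show [a, b, c, d, p, q, r, s].length < 10 by simp)
      have n10 : [a, b, c, d, p, q, r, s, w, f w].Nodup := by
        clear hex hall
        simp only [List.nodup_cons, List.mem_cons, List.not_mem_nil, not_or, not_false_eq_true, and_true,
        or_false, List.nodup_nil] at n8 hw ⊢
        and_intros <;> grind
      have h5 := hall _ n10 rfl (g w)
      clear hex hall
      simp only [List.mem_cons, List.not_mem_nil, not_or, or_false] at h5 hw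
      casesm* _ ∨ _ <;> grind
    have n10 : [a, b, c, d, p, q, r, s, u, v].Nodup := by
      clear hex hall
      simp only [List.nodup_cons, List.mem_cons, List.not_mem_nil, not_or, not_false_eq_true, and_true,
        or_false, List.nodup_nil] at n8 ⊢
      and_intros <;> grind
    have h5 := hall _ n10 rfl (g v)
    refine ⟨a, b, c, d, p, q, r, s, u, v, n10, hb, hd, hq, hs, hv, hc, hr, hu, Or.inr ⟨ha, ?_⟩⟩
    clear hex hall
    simp only [List.nodup_cons, List.mem_cons, List.not_mem_nil, not_or, not_false_eq_true, and_true,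
        or_false, List.nodup_nil] at h5 n10
    casesm* _ ∨ _ <;> grind
  · push Not at h4
    obtain ⟨a, -⟩ := hex [] (by simp)
    obtain ⟨b, hb⟩ : ∃ b, f a = b := ⟨_, rfl⟩
    obtain ⟨c, hc⟩ : ∃ c, g b = c := ⟨_, rfl⟩
    obtain ⟨d, hd⟩ : ∃ d, f c = d := ⟨_, rfl⟩
    obtain ⟨p, hp⟩ : ∃ p, g d = p := ⟨_, rfl⟩
    obtain ⟨q, hq⟩ : ∃ q, f p = q := ⟨_, rfl⟩
    obtain ⟨r, hr⟩ : ∃ r, g q = r := ⟨_, rfl⟩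
    obtain ⟨s, hs⟩ : ∃ s, f r = s := ⟨_, rfl⟩
    obtain ⟨u, hu⟩ : ∃ u, g s = u := ⟨_, rfl⟩
    obtain ⟨v, hv⟩ : ∃ v, f u = v := ⟨_, rfl⟩
    have hpa : p ≠ a := by
      have := h4 a
      grind
    have n6 : [a, b, c, d, p, q].Nodup := by
      clear hex hall
      simp only [List.nodup_cons, List.mem_cons, List.not_mem_nil, not_or, not_false_eq_true, and_true,
        or_false, List.nodup_nil]
      and_intros <;> grind
    -- A cycle of length six would leave four points, which would have to form a cycle of length
    -- four.
    have hra : r ≠ a := by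
      intro hra
      obtain ⟨w, hw⟩ := hex _ (show [a, b, c, d, p, q].length < 10 by simp)
      have n10 : [a, b, c, d, p, q, w, f w, g (f w), f (g (f w))].Nodup := by
        clear hex hall
        simp only [List.nodup_cons, List.mem_cons, List.not_mem_nil, not_or, not_false_eq_true, and_true,
        or_false, List.nodup_nil] at n6 hw ⊢
        and_intros <;> grind
      have h5 := hall _ n10 rfl (g (f (g (f w))))
      have h6 := h4 w
      clear hex hall
      simp only [List.mem_cons, List.not_mem_nil, not_or, or_false] at h5 hw
      casesm* _ ∨ _ <;> grind
    have n8 : [a, b, c, d, p, q, r, s].Nodup := by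
      clear hex hall
      simp only [List.nodup_cons, List.mem_cons, List.not_mem_nil, not_or, not_false_eq_true, and_true,
        or_false, List.nodup_nil] at n6 ⊢
      and_intros <;> grind
    -- A cycle of length eight would leave two points, on which `f` and `g` would agree.
    have hua : u ≠ a := by
      intro hua
      obtain ⟨w, hw⟩ := hex _ (show [a, b, c, d, p, q, r, s].length < 10 by simp)
      have n10 : [a, b, c, d, p, q, r, s, w, f w].Nodup := by
        clear hex hall
        simp only [List.nodup_cons, List.mem_cons, List.not_mem_nil, not_or, not_false_eq_true, and_true,
        or_false, List.nodup_nil] at n8 hw ⊢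
        and_intros <;> grind
      have h5 := hall _ n10 rfl (g w)
      clear hex hall
      simp only [List.mem_cons, List.not_mem_nil, not_or, or_false] at h5 hw
      casesm* _ ∨ _ <;> grind
    have n10 : [a, b, c, d, p, q, r, s, u, v].Nodup := by
      clear hex hall
      simp only [List.nodup_cons, List.mem_cons, List.not_mem_nil, not_or, not_false_eq_true, and_true,
        or_false, List.nodup_nil] at n8 ⊢
      and_intros <;> grind
    have h5 := hall _ n10 rfl (g v)
    refine ⟨a, b, c, d, p, q, r, s, u, v, n10, hb, hd, hq, hs, hv, hc, hr, hu, Or.inl ⟨hp, ?_⟩⟩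
    clear hex hall
    simp only [List.nodup_cons, List.mem_cons, List.not_mem_nil, not_or, not_false_eq_true, and_true,
        or_false, List.nodup_nil] at h5 n10
    casesm* _ ∨ _ <;> grind

end TripleSystem

namespace TripleSystem

/-! ### Systems of at least nineteen triples. -/

open Finset

variable {V : Type*} [DecidableEq V] [Fintype V]

lemma exists_third {T : Finset (Finset V)} (hT : IsPartial T) {v w : V} (hw : w ≠ v)
    (h : w ∉ free T v) : ∃ u, ({v, w, u} : Finset V) ∈ T := by
  rw [mem_free] at h
  push Not at h
  obtain ⟨t, ht, hv, hwt⟩ := h hw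
  have h1 : (t.erase v).card = 2 := by rw [card_erase_of_mem hv, hT.card_eq t ht]
  have h2 : ((t.erase v).erase w).card = 1 := by
    rw [card_erase_of_mem (mem_erase.2 ⟨hw, hwt⟩), h1]
  obtain ⟨u, hu⟩ := card_eq_one.1 h2
  refine ⟨u, ?_⟩
  rwa [← hu, insert_erase (mem_erase.2 ⟨hw, hwt⟩), insert_erase hv]

/-- The triples through `P` and those through `Q` each match up the ten other points, and the two
matchings share no pair. Their union has one of two cycle types, and for each of them 18 pairs hit
all possible triples. -/
lemma card_le_of_isolated {T : Finset (Finset V)} (hT : IsPartial T) (hV : Fintype.card V = 12)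
    (hc : ∀ a ∈ T, ∀ b ∈ T, ∀ c ∈ T, Disjoint a b → Disjoint c a → Disjoint c b →
      (a ∪ b ∪ c)ᶜ ∈ T) {P Q : V} (hP : free T P = {Q}) (hQ : free T Q = {P}) : T.card ≤ 18 := by
  have hPQ : P ≠ Q := (mem_free.1 (show P ∈ free T Q by simp [hQ])).1
  let X := {x : V // x ≠ P ∧ x ≠ Q}
  have hX : Fintype.card X = 10 := by
    rw [Fintype.card_subtype, show (univ.filter fun x => x ≠ P ∧ x ≠ Q) = (univ.erase P).erase Q by
      ext; simp [and_comm], card_erase_of_mem (by simp [hPQ.symm]), card_erase_of_mem (mem_univ _),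
      card_univ, hV]
  have third : ∀ P Q : V, free T P = {Q} → ∀ x : V, x ≠ P ∧ x ≠ Q →
      ∃ y : V, (y ≠ P ∧ y ≠ Q) ∧ y ≠ x ∧ ({P, x, y} : Finset V) ∈ T := by
    intro P Q hP x hx
    obtain ⟨y, hy⟩ := exists_third hT hx.1 (by simp [hP, hx.2])
    have h1 := pairwise_ne_of_card (hT.card_eq _ hy)
    refine ⟨y, ⟨h1.2.1.symm, ?_⟩, h1.2.2.symm, hy⟩
    rintro rfl
    exact (mem_free.1 (show y ∈ free T P by simp [hP])).2 _ hy (by simp) (by simp)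
  have hf : ∀ x : X, ∃ y : X, y ≠ x ∧ ({P, x.1, y.1} : Finset V) ∈ T := fun x => by
    obtain ⟨y, h1, h2, h3⟩ := third P Q hP x.1 x.2
    exact ⟨⟨y, h1⟩, fun h => h2 (congrArg Subtype.val h), h3⟩
  have hg : ∀ x : X, ∃ y : X, y ≠ x ∧ ({Q, x.1, y.1} : Finset V) ∈ T := fun x => by
    obtain ⟨y, h1, h2, h3⟩ := third Q P hQ x.1 x.2.symm
    exact ⟨⟨y, h1.symm⟩, fun h => h2 (congrArg Subtype.val h), h3⟩
  choose f hf' hf using hf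
  choose g hg' hg using hg
  have invol : ∀ (R : V) (f : X → X), (∀ x : X, ({R, x.1, (f x).1} : Finset V) ∈ T) →
      ∀ x, f (f x) = x := by
    intro R f hf x
    have h1 := hf x
    have h2 := hf (f x)
    have h3 := pairwise_ne_of_card (hT.card_eq _ h1)
    have h4 := pairwise_ne_of_card (hT.card_eq _ h2)
    have h5 := hT.eq_of_mem _ h1 _ h2 R (f x) h3.2.1 (by simp) (by simp) (by simp) (by simp)
    have h6 : (f (f x)).1 ∈ ({R, x.1, (f x).1} : Finset V) := h5 ▸ (by simp)
    simp only [mem_insert, mem_singleton] at h6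
    rcases h6 with h6 | h6 | h6
    · exact absurd h6.symm h4.2.1
    · exact Subtype.ext h6
    · exact absurd h6.symm h4.2.2
  have hfg : ∀ x, f x ≠ g x := by
    intro x h
    have h1 := hf x
    have h2 := hg x
    rw [← h] at h2
    have h3 := pairwise_ne_of_card (hT.card_eq _ h1)
    have h5 := hT.eq_of_mem _ h1 _ h2 x (f x) h3.2.2 (by simp) (by simp) (by simp) (by simp)
    have h6 : Q ∈ ({P, x.1, (f x).1} : Finset V) := h5 ▸ (by simp)
    simp only [mem_insert, mem_singleton] at h6
    rcases h6 with h6 | h6 | h6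
    · exact hPQ h6.symm
    · exact x.2.2 h6.symm
    · exact (f x).2.2 h6.symm
  obtain ⟨a, b, c, d, p, q, r, s, u, v, hnd, h1, h2, h3, h4, h5, h6, h7, h8, h9⟩ :=
    exists_cycle hX f g (invol P f hf) (invol Q g hg) hf' hg' hfg
  let e : Fin 12 → V := ![a.1, b.1, c.1, d.1, p.1, q.1, r.1, s.1, u.1, v.1, P, Q]
  have he : Function.Bijective e := by
    refine (Fintype.bijective_iff_injective_and_card e).2 ⟨?_, by simp [hV]⟩
    rw [← List.nodup_ofFn]
    have h10 : ([a, b, c, d, p, q, r, s, u, v].map Subtype.val ++ [P, Q]).Nodup := by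
      rw [List.nodup_append']
      refine ⟨hnd.map Subtype.val_injective, by simpa using hPQ, ?_⟩
      intro w hw hw'
      obtain ⟨x, -, rfl⟩ := List.mem_map.1 hw
      simp only [List.mem_cons, List.not_mem_nil, or_false] at hw'
      rcases hw' with h | h
      · exact x.2.1 h
      · exact x.2.2 h
    simpa [e, List.ofFn_succ] using h10
  have hL := tripleRel_rel hT hc he
  have kf : ∀ x y, f x = y → ({P, x.1, y.1} : Finset V) ∈ T := fun x y h => h ▸ hf x
  have kg : ∀ x y, g x = y → ({Q, x.1, y.1} : Finset V) ∈ T := fun x y h => h ▸ hg x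
  rcases h9 with ⟨h9, h10⟩ | ⟨h9, h10⟩
  · refine card_le_of_ten_cycle hT he hL ?_
    simp only [List.forall_mem_cons]
    exact ⟨kf _ _ h1, kf _ _ h2, kf _ _ h3, kf _ _ h4, kf _ _ h5, kg _ _ h6, kg _ _ h9, kg _ _ h7,
      kg _ _ h8, kg _ _ h10, by simp⟩
  · refine card_le_of_four_six_cycle hT he hL ?_
    simp only [List.forall_mem_cons]
    exact ⟨kf _ _ h1, kf _ _ h2, kf _ _ h3, kf _ _ h4, kf _ _ h5, kg _ _ h6, kg _ _ h9, kg _ _ h7,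
      kg _ _ h8, kg _ _ h10, by simp⟩

/-- If there are at least nineteen triples, the free pairs form three stars with three leaves. -/
lemma exists_stars {T : Finset (Finset V)} (hT : IsPartial T) (hV : Fintype.card V = 12)
    (hc : ∀ a ∈ T, ∀ b ∈ T, ∀ c ∈ T, Disjoint a b → Disjoint c a → Disjoint c b →
      (a ∪ b ∪ c)ᶜ ∈ T) (h19 : 19 ≤ T.card) :
    T.card = 19 ∧ ∃ H : Finset V, H.card = 3 ∧ (∀ h ∈ H, (free T h).card = 3 ∧
      ∀ v ∈ free T h, free T v = {h}) := by
  have hsum : ∑ v, (free T v).card + 6 * T.card = 132 := by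
    have h1 : ∑ v, ((free T v).card + 2 * deg T v + 1) = 12 * 12 := by
      rw [sum_congr rfl fun v _ => card_free hT v, sum_const, card_univ, hV]
      rfl
    rw [sum_add_distrib, sum_add_distrib, ← mul_sum, sum_deg hT] at h1
    simp only [sum_const, card_univ, hV, smul_eq_mul] at h1
    omega
  have hodd : ∀ v, (free T v).card % 2 = 1 := fun v => by
    have := card_free hT v
    rw [hV] at this
    omega
  -- Free degrees are odd, so points outside `H` are leaves and points of `H` have at least three
  -- free partners.
  set H := univ.filter fun v => (free T v).card ≠ 1 with hH
  have hleaf : ∀ v ∉ H, (free T v).card = 1 := fun v hv => by simpa [hH] using hv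
  have hHge : ∀ v ∈ H, 3 ≤ (free T v).card := fun v hv => by
    have h1 : (free T v).card ≠ 1 := by simpa [hH] using hv
    have := hodd v
    omega
  -- Two leaves free from each other would form an isolated pair, which allows only 18 triples.
  have hadj : ∀ v ∉ H, ∀ w, w ∈ free T v → w ∈ H := by
    intro v hv w hw
    by_contra hwH
    have h1 : free T v = {w} := by
      obtain ⟨x, hx⟩ := card_eq_one.1 (hleaf v hv)
      rw [hx, mem_singleton] at hw
      rw [hx, hw]
    have h2 : free T w = {v} := by
      obtain ⟨x, hx⟩ := card_eq_one.1 (hleaf w hwH)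
      have := mem_free_comm.1 hw
      rw [hx, mem_singleton] at this
      rw [hx, this]
    have := card_le_of_isolated hT hV hc h1 h2
    omega
  have hsplit : ∑ v, (free T v).card = ∑ v ∈ H, (free T v).card + (12 - H.card) := by
    rw [← sum_add_sum_compl H]
    congr 1
    rw [sum_congr rfl fun v hv => hleaf v (mem_compl.1 hv), sum_const, smul_eq_mul, mul_one,
      card_compl, hV]
  have hH12 : H.card ≤ 12 := hV ▸ card_le_univ H
  have hdouble : ∑ h ∈ H, (free T h ∩ Hᶜ).card = 12 - H.card := by
    have h1 : ∀ h ∈ H, (free T h ∩ Hᶜ).card = ∑ v ∈ Hᶜ, if h ∈ free T v then 1 else 0 := by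
      intro h _
      rw [← card_filter]
      congr 1
      ext v
      rw [mem_inter, mem_filter, mem_free_comm, and_comm]
    rw [sum_congr rfl h1, sum_comm, sum_congr rfl (g := fun _ => 1), sum_const, smul_eq_mul, mul_one,
      card_compl, hV]
    intro v hv
    rw [← card_filter, filter_mem_eq_inter, inter_eq_right.2 fun w hw => hadj v (mem_compl.1 hv) w hw,
      hleaf v (mem_compl.1 hv)]
  have hle : ∑ h ∈ H, (free T h ∩ Hᶜ).card ≤ ∑ h ∈ H, (free T h).card :=
    sum_le_sum fun h _ => card_le_card inter_subset_left
  have h3H : 3 * H.card ≤ ∑ h ∈ H, (free T h).card := by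
    rw [mul_comm, ← smul_eq_mul, ← sum_const]
    exact sum_le_sum hHge
  -- With h = |H| and S the sum of the free degrees over `H`, the inequalities S + 12 - h ≤ 18, S ≥
  -- 3h and S ≥ 12 - h force h = 3 and S = 9.
  have hcard : H.card = 3 := by omega
  have hT19 : T.card = 19 := by omega
  have h9 : ∑ h ∈ H, (free T h).card = 9 := by omega
  have heq3 : ∀ h ∈ H, (free T h).card = 3 := by
    have := (sum_eq_sum_iff_of_le (s := H) (f := fun _ => 3) hHge).1 (by simp [hcard, h9])
    exact fun h hh => (this h hh).symm
  have hsub : ∀ h ∈ H, (free T h ∩ Hᶜ).card = (free T h).card :=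
    (sum_eq_sum_iff_of_le fun h _ => card_le_card inter_subset_left).1 (by omega)
  refine ⟨hT19, H, hcard, fun h hh => ⟨heq3 h hh, fun v hv => ?_⟩⟩
  have h1 : v ∉ H := by
    have := eq_of_subset_of_card_le inter_subset_left (hsub h hh).ge
    rw [← this, mem_inter, mem_compl] at hv
    exact hv.2
  obtain ⟨x, hx⟩ := card_eq_one.1 (hleaf v h1)
  have h2 := mem_free_comm.1 hv
  rw [hx, mem_singleton] at h2
  rw [hx, h2]

/-- A partial triple system on twelve points with at least nineteen triples, in which the
complement of three disjoint triples is a triple, is that of the group `(ℤ/2)² × ℤ/3`. -/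
theorem exists_labelling {T : Finset (Finset V)} (hT : IsPartial T) (hV : Fintype.card V = 12)
    (hc : ∀ a ∈ T, ∀ b ∈ T, ∀ c ∈ T, Disjoint a b → Disjoint c a → Disjoint c b →
      (a ∪ b ∪ c)ᶜ ∈ T) (h19 : 19 ≤ T.card) :
    T.card = 19 ∧ ∃ e : Fin 12 → V, Function.Injective e ∧ ∀ l ∈ model, rel T e l.1 l.2.1 l.2.2 := by
  obtain ⟨hT19, H, hH, hstar⟩ := exists_stars hT hV hc h19
  refine ⟨hT19, ?_⟩
  obtain ⟨x, y, z, hxy, hxz, hyz, rfl⟩ := card_eq_three.1 hH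
  obtain ⟨a, b, c, hab, hac, hbc, hx⟩ := card_eq_three.1 (hstar x (by simp)).1
  obtain ⟨d, f, g, hdf, hdg, hfg, hy⟩ := card_eq_three.1 (hstar y (by simp)).1
  obtain ⟨p, q, r, hpq, hpr, hqr, hz⟩ := card_eq_three.1 (hstar z (by simp)).1
  have ha : free T a = {x} := (hstar x (by simp)).2 a (by simp [hx])
  have hb : free T b = {x} := (hstar x (by simp)).2 b (by simp [hx])
  have hc' : free T c = {x} := (hstar x (by simp)).2 c (by simp [hx])
  have hd : free T d = {y} := (hstar y (by simp)).2 d (by simp [hy])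
  have hf : free T f = {y} := (hstar y (by simp)).2 f (by simp [hy])
  have hg : free T g = {y} := (hstar y (by simp)).2 g (by simp [hy])
  have hp : free T p = {z} := (hstar z (by simp)).2 p (by simp [hz])
  have hq : free T q = {z} := (hstar z (by simp)).2 q (by simp [hz])
  have hr : free T r = {z} := (hstar z (by simp)).2 r (by simp [hz])
  have h1 : ∀ u v w : V, free T u = {w} → (free T v).card = 3 → u ≠ v := by
    rintro u v w hu hv rfl
    simp [hu] at hv
  have h2 : ∀ u v w w' : V, w ≠ w' → free T u = {w} → free T v = {w'} → u ≠ v := by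
    rintro u v w w' hw hu hv rfl
    exact hw (singleton_injective (hu.symm.trans hv))
  have hx3 := (hstar x (by simp)).1
  have hy3 := (hstar y (by simp)).1
  have hz3 := (hstar z (by simp)).1
  let e : Fin 12 → V := ![x, a, b, c, y, d, f, g, z, p, q, r]
  have he : Function.Bijective e := by
    refine (Fintype.bijective_iff_injective_and_card e).2 ⟨?_, by simp [hV]⟩
    rw [← List.nodup_ofFn]
    have : [x, a, b, c, y, d, f, g, z, p, q, r].Nodup := by
      simp only [List.nodup_cons, List.mem_cons, List.not_mem_nil, not_or, not_false_eq_true,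
        and_true, or_false, List.nodup_nil]
      and_intros
      all_goals first | assumption | exact h1 _ _ _ (by assumption) (by assumption) |
        exact (h1 _ _ _ (by assumption) (by assumption)).symm |
        exact h2 _ _ _ _ hxy (by assumption) (by assumption) |
        exact h2 _ _ _ _ hxz (by assumption) (by assumption) |
        exact h2 _ _ _ _ hyz (by assumption) (by assumption)
    simpa [e, List.ofFn_succ] using this
  have hfree : ∀ i j, e j ∈ free T (e i) ↔ star i j = true := by
    have k0 : ∀ j, e j ∈ free T (e 0) ↔ star 0 j = true := fun j => by
      change e j ∈ free T x ↔ _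
      rw [hx, mem_insert, mem_insert, mem_singleton]
      change e j = e 1 ∨ e j = e 2 ∨ e j = e 3 ↔ _
      rw [he.1.eq_iff, he.1.eq_iff, he.1.eq_iff]
      revert j; decide
    have k4 : ∀ j, e j ∈ free T (e 4) ↔ star 4 j = true := fun j => by
      change e j ∈ free T y ↔ _
      rw [hy, mem_insert, mem_insert, mem_singleton]
      change e j = e 5 ∨ e j = e 6 ∨ e j = e 7 ↔ _
      rw [he.1.eq_iff, he.1.eq_iff, he.1.eq_iff]
      revert j; decide
    have k8 : ∀ j, e j ∈ free T (e 8) ↔ star 8 j = true := fun j => by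
      change e j ∈ free T z ↔ _
      rw [hz, mem_insert, mem_insert, mem_singleton]
      change e j = e 9 ∨ e j = e 10 ∨ e j = e 11 ↔ _
      rw [he.1.eq_iff, he.1.eq_iff, he.1.eq_iff]
      revert j; decide
    have kl : ∀ i c : Fin 12, free T (e i) = {e c} → (∀ j, j = c ↔ star i j = true) →
        ∀ j, e j ∈ free T (e i) ↔ star i j = true := fun i c h h' j => by
      rw [h, mem_singleton, he.1.eq_iff, h']
    intro i
    fin_cases i
    · exact k0
    · exact kl 1 0 ha (by decide)
    · exact kl 2 0 hb (by decide)
    · exact kl 3 0 hc' (by decide)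
    · exact k4
    · exact kl 5 4 hd (by decide)
    · exact kl 6 4 hf (by decide)
    · exact kl 7 4 hg (by decide)
    · exact k8
    · exact kl 9 8 hp (by decide)
    · exact kl 10 8 hq (by decide)
    · exact kl 11 8 hr (by decide)
  have hdeg : ∀ i, deg T (e i) = starDeg i := by
    intro i
    have h3 : (free T (e i)).card = if i.val % 4 = 0 then 3 else 1 := by
      fin_cases i
      exacts [hx3, by simp [e, ha], by simp [e, hb], by simp [e, hc'], hy3, by simp [e, hd],
        by simp [e, hf], by simp [e, hg], hz3, by simp [e, hp], by simp [e, hq], by simp [e, hr]]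
    have h4 := card_free hT (e i)
    rw [hV, h3] at h4
    rw [starDeg]
    split_ifs at h4 ⊢ <;> omega
  have hL : StarRel (rel T e) := by
    refine ⟨tripleRel_rel hT hc he, fun a b c h => ?_, fun a b hab h => ?_, fun l m hl hm => ?_⟩
    · by_contra hs
      rw [Bool.not_eq_false, ← hfree, mem_free] at hs
      exact hs.2 _ h (by simp) (by simp)
    · obtain ⟨u, hu⟩ := exists_third hT (he.1.ne hab.symm) (fun h' => by
        rw [hfree, h] at h'; exact Bool.false_ne_true h')
      obtain ⟨c, rfl⟩ := he.2 u
      exact ⟨c, hu⟩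
    · by_contra hodd
      rw [Bool.not_eq_false, oddPair, Bool.and_eq_true] at hodd
      obtain ⟨hd1, hd2⟩ := hodd
      have hdis : Disjoint ({e l.1, e l.2.1, e l.2.2} : Finset V) {e m.1, e m.2.1, e m.2.2} := by
        simp only [Bool.not_eq_true', Bool.or_eq_false_iff, beq_eq_false_iff_ne, ne_eq] at hd1
        simp [disjoint_left, he.1.eq_iff, hd1]
      have h5 := even_disjoint_triples hT hc hl hm hdis
      have h6 := card_disjoint_triples hT hl hm hdis
      have hl3 := pairwise_ne_of_card (hT.card_eq _ hl)
      have hm3 := pairwise_ne_of_card (hT.card_eq _ hm)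
      have s3 : ∀ (F : V → ℤ) (i j k : V), i ≠ j ∧ i ≠ k ∧ j ≠ k →
          ∑ v ∈ ({i, j, k} : Finset V), F v = F i + F j + F k := by
        intro F i j k h
        rw [sum_insert (by simp [h.1, h.2.1]), sum_pair h.2.2, add_assoc]
      simp only [s3 _ _ _ _ hl3, s3 _ _ _ _ hm3, hdeg, hfree, hT19] at h6
      have hcov : ∀ i j : Fin 12, (if star i j = true then (0 : ℤ) else 1) = (cov i j : ℕ) :=
        fun i j => by rw [cov]; split_ifs <;> rfl
      simp only [hcov] at h6
      obtain ⟨n, hn⟩ := h5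
      rw [hn] at h6
      rw [beq_iff_eq] at hd2
      push_cast at h6
      omega
  obtain ⟨s, hs, hmodel⟩ := hL.exists_model
  exact ⟨e ∘ s, he.1.comp hs, hmodel⟩

end TripleSystem

open MvPolynomial

namespace QuarticMonoid

/-! ### Factors of homogeneous polynomials. -/

section Homogeneous

variable {σ k : Type*} [Field k]

/-- The substitution `x ↦ x T`, which records the grading by degree. -/
noncomputable def gradeHom (σ k : Type*) [Field k] :
    MvPolynomial σ k →ₐ[k] Polynomial (MvPolynomial σ k) :=
  aeval fun i => Polynomial.C (X i) * Polynomial.X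

lemma gradeHom_monomial (d : σ →₀ ℕ) (r : k) :
    gradeHom σ k (monomial d r) = Polynomial.C (monomial d r) * Polynomial.X ^ d.degree := by
  rw [gradeHom, aeval_monomial, monomial_eq, Finsupp.prod, Finsupp.prod, map_mul, map_prod]
  simp only [mul_pow, Finset.prod_mul_distrib, Finset.prod_pow_eq_pow_sum, map_pow,
    Polynomial.algebraMap_apply, algebraMap_eq, Finsupp.degree]
  rw [mul_assoc]
  rfl

lemma coeff_gradeHom (p : MvPolynomial σ k) (n : ℕ) :
    (gradeHom σ k p).coeff n = homogeneousComponent n p := by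
  induction p using MvPolynomial.induction_on' with
  | monomial d r =>
    rw [gradeHom_monomial, Polynomial.coeff_C_mul, Polynomial.coeff_X_pow]
    rw [homogeneousComponent_of_mem (isHomogeneous_monomial r rfl)]
    simp only [mul_ite, mul_one, mul_zero]
  | add p q hp hq => rw [map_add, Polynomial.coeff_add, hp, hq, map_add]

lemma gradeHom_injective : Function.Injective (gradeHom σ k) := by
  have : Function.LeftInverse (Polynomial.eval 1) (gradeHom σ k) := by
    intro p
    induction p using MvPolynomial.induction_on' with
    | monomial d r => simp [gradeHom_monomial]
    | add p q hp hq => rw [map_add, Polynomial.eval_add, hp, hq]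
  exact this.injective

lemma gradeHom_of_isHomogeneous {p : MvPolynomial σ k} {n : ℕ} (hp : p.IsHomogeneous n) :
    gradeHom σ k p = Polynomial.C p * Polynomial.X ^ n := by
  ext1 m
  rw [coeff_gradeHom, homogeneousComponent_of_mem hp, Polynomial.coeff_C_mul,
    Polynomial.coeff_X_pow]
  simp only [mul_ite, mul_one, mul_zero]

/-- A factor of a nonzero homogeneous polynomial is homogeneous. -/
lemma isHomogeneous_of_mul {p q : MvPolynomial σ k} {n : ℕ} (h : (p * q).IsHomogeneous n)
    (h0 : p * q ≠ 0) : ∃ m, p.IsHomogeneous m := by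
  have hg := gradeHom_of_isHomogeneous h
  rw [map_mul] at hg
  have hp : gradeHom σ k p ≠ 0 := fun h' =>
    left_ne_zero_of_mul h0 (gradeHom_injective (h'.trans (map_zero _).symm))
  have hq : gradeHom σ k q ≠ 0 := fun h' =>
    right_ne_zero_of_mul h0 (gradeHom_injective (h'.trans (map_zero _).symm))
  -- Degree and trailing degree in the grading variable are additive and agree for the product, so
  -- they agree for each factor, which therefore has a single homogeneous component.
  have h1 := congrArg Polynomial.natDegree hg
  have h2 := congrArg Polynomial.natTrailingDegree hg
  rw [Polynomial.natDegree_mul hp hq, Polynomial.natDegree_C_mul_X_pow _ _ h0] at h1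
  rw [Polynomial.natTrailingDegree_mul hp hq, Polynomial.C_mul_X_pow_eq_monomial,
    Polynomial.natTrailingDegree_monomial h0] at h2
  have h3 := Polynomial.natTrailingDegree_le_natDegree (gradeHom σ k p)
  have h4 := Polynomial.natTrailingDegree_le_natDegree (gradeHom σ k q)
  refine ⟨(gradeHom σ k p).natDegree, ?_⟩
  have h5 : homogeneousComponent (gradeHom σ k p).natDegree p = p := by
    conv_rhs => rw [← sum_homogeneousComponent p]
    by_cases h6 : (gradeHom σ k p).natDegree ∈ Finset.range (p.totalDegree + 1)
    · rw [Finset.sum_eq_single_of_mem _ h6]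
      intro i _ hi
      rw [← coeff_gradeHom]
      rcases hi.lt_or_gt with hi | hi
      · exact Polynomial.coeff_eq_zero_of_lt_natTrailingDegree (by omega)
      · exact Polynomial.coeff_eq_zero_of_natDegree_lt hi
    · exfalso
      rw [Finset.mem_range, not_lt] at h6
      have h7 : (gradeHom σ k p).coeff (gradeHom σ k p).natDegree ≠ 0 := by
        rwa [Polynomial.coeff_natDegree, ne_eq, Polynomial.leadingCoeff_eq_zero]
      rw [coeff_gradeHom, homogeneousComponent_eq_zero _ p h6] at h7
      exact h7 rfl
  have h6 := homogeneousComponent_isHomogeneous (gradeHom σ k p).natDegree p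
  rwa [h5] at h6

lemma isHomogeneous_right_of_mul {p q : MvPolynomial σ k} {m n : ℕ}
    (h : (p * q).IsHomogeneous (m + n)) (hp : p.IsHomogeneous m) (h0 : p * q ≠ 0) :
    q.IsHomogeneous n := by
  obtain ⟨l, hl⟩ := isHomogeneous_of_mul (by rwa [mul_comm] at h) (by rwa [mul_comm] at h0)
  have := (hp.mul hl).inj_right h h0
  rwa [show l = n by omega] at hl

end Homogeneous

/-! ### Restriction to a line, and divisibility by linear forms. -/

section Line

variable {σ k : Type*} [Field k]

/-- The restriction of a polynomial to the parametrised line `v + T w`. -/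
noncomputable def linePoly (f : MvPolynomial σ k) (v w : σ → k) : Polynomial k :=
  aeval (fun i => Polynomial.C (v i) + Polynomial.C (w i) * Polynomial.X) f

lemma eval_linePoly (f : MvPolynomial σ k) (v w : σ → k) (t : k) :
    (linePoly f v w).eval t = eval (v + t • w) f := by
  induction f using MvPolynomial.induction_on with
  | C a => simp [linePoly]
  | add p q hp hq => 
    simp only [linePoly, map_add, Polynomial.eval_add] at hp hq ⊢
    rw [hp, hq]
  | mul_X p j hp =>
    simp only [linePoly] at hp
    simp only [linePoly, map_mul, Polynomial.eval_mul, hp, aeval_X, eval_X]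
    simp only [Polynomial.eval_add, Polynomial.eval_mul, Polynomial.eval_C, Polynomial.eval_X,
      Pi.add_apply, Pi.smul_apply, smul_eq_mul, mul_comm t]

lemma coeff_zero_linePoly (f : MvPolynomial σ k) (v w : σ → k) :
    (linePoly f v w).coeff 0 = eval v f := by
  rw [Polynomial.coeff_zero_eq_eval_zero, eval_linePoly, zero_smul, add_zero]

lemma derivative_linePoly [Fintype σ] (f : MvPolynomial σ k) (v w : σ → k) :
    Polynomial.derivative (linePoly f v w) =
      ∑ i, Polynomial.C (w i) * linePoly (pderiv i f) v w := by
  classical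
  induction f using MvPolynomial.induction_on with
  | C a => simp [linePoly]
  | add p q hp hq =>
    simp only [linePoly, map_add, mul_add, Finset.sum_add_distrib] at hp hq ⊢
    rw [hp, hq]
  | mul_X p j hp =>
    simp only [linePoly] at hp
    simp only [linePoly, map_mul, Polynomial.derivative_mul, hp, aeval_X, Derivation.leibniz,
      smul_eq_mul, map_add, mul_add, Finset.sum_add_distrib, pderiv_X, Pi.single_apply]
    simp only [Polynomial.derivative_C, Polynomial.derivative_X, zero_mul, add_zero,
      zero_add, mul_one, apply_ite (aeval _), map_zero, map_one, mul_zero, mul_ite,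
      Finset.sum_ite_eq, Finset.mem_univ, if_true, Finset.sum_mul]
    rw [add_comm, mul_comm, add_assoc, add_left_comm, ← add_assoc, add_assoc,
      ← Finset.sum_add_distrib, mul_comm]
    exact congrArg _ (Finset.sum_congr rfl fun i _ => by ring)

lemma coeff_one_linePoly [Fintype σ] (f : MvPolynomial σ k) (v w : σ → k) :
    (linePoly f v w).coeff 1 = ∑ i, w i * eval v (pderiv i f) := by
  have h := congrArg (fun p => Polynomial.coeff p 0) (derivative_linePoly f v w)
  simp only [Polynomial.coeff_derivative, Polynomial.finsetSum_coeff, Polynomial.coeff_C_mul,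
    coeff_zero_linePoly] at h
  simpa using h

lemma eval_smul_of_isHomogeneous {f : MvPolynomial σ k} {d : ℕ} (hf : f.IsHomogeneous d) (s : k)
    (v : σ → k) : eval (s • v) f = s ^ d * eval v f := by
  rw [eval_eq, eval_eq, Finset.mul_sum]
  refine Finset.sum_congr rfl fun e he => ?_
  simp only [Pi.smul_apply, smul_eq_mul, mul_pow, Finset.prod_mul_distrib,
    Finset.prod_pow_eq_pow_sum]
  rw [hf.degree_eq_sum_deg_support he]
  ring

lemma natDegree_linePoly_le {f : MvPolynomial σ k} {d : ℕ} (hf : f.IsHomogeneous d)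
    (v w : σ → k) : (linePoly f v w).natDegree ≤ d := by
  refine (aeval_natDegree_le f hf.totalDegree_le _ (n := 1) fun i => ?_).trans (by simp)
  compute_degree

/-- A form on the span of `v` and `w` is the homogenisation of its `linePoly`. Scaling shows this
for s ≠ 0; both sides are polynomials in s over an infinite field, so it also holds at s = 0. -/
lemma eval_add_smul_of_isHomogeneous [Infinite k] {f : MvPolynomial σ k} {d : ℕ}
    (hf : f.IsHomogeneous d) (v w : σ → k) (s t : k) :
    eval (s • v + t • w) f =
      ∑ i ∈ Finset.range (d + 1), (linePoly f v w).coeff i * s ^ (d - i) * t ^ i := by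
  have h1 : linePoly f (t • w) v = ∑ i ∈ Finset.range (d + 1),
      Polynomial.C ((linePoly f v w).coeff i * t ^ i) * Polynomial.X ^ (d - i) := by
    refine Polynomial.eq_of_infinite_eval_eq _ _ (Set.Infinite.mono (s := {0}ᶜ) ?_
      (Set.finite_singleton 0).infinite_compl)
    intro s hs
    have hs : s ≠ 0 := hs
    change Polynomial.eval _ _ = Polynomial.eval _ _
    rw [eval_linePoly, Polynomial.eval_finsetSum,
      show t • w + s • v = s • (v + (s⁻¹ * t) • w) by
        rw [smul_add, smul_smul, mul_inv_cancel_left₀ hs, add_comm],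
      eval_smul_of_isHomogeneous hf, ← eval_linePoly, Polynomial.eval_eq_sum_range' (n := d + 1)
        (Nat.lt_succ_of_le (natDegree_linePoly_le hf v w)), Finset.mul_sum]
    refine Finset.sum_congr rfl fun i hi => ?_
    have hi : i ≤ d := by simpa [Nat.lt_succ_iff] using hi
    simp only [Polynomial.eval_mul, Polynomial.eval_C, Polynomial.eval_pow, Polynomial.eval_X,
      mul_pow, inv_pow]
    rw [← Nat.sub_add_cancel hi, pow_add, Nat.add_sub_cancel]
    field_simp
  have h2 := congrArg (Polynomial.eval s) h1
  rw [eval_linePoly, add_comm, Polynomial.eval_finsetSum] at h2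
  rw [h2]
  refine Finset.sum_congr rfl fun i _ => ?_
  simp only [Polynomial.eval_mul, Polynomial.eval_C, Polynomial.eval_pow, Polynomial.eval_X]
  ring

end Line

section LinearForm

variable {σ k : Type*} [Field k] [Fintype σ]

/-- The linear form with coefficients `c`. -/
noncomputable def linForm (c : σ → k) : MvPolynomial σ k := ∑ i, C (c i) * X i

lemma eval_linForm (c v : σ → k) : eval v (linForm c) = c ⬝ᵥ v := by
  simp [linForm, dotProduct]

lemma isHomogeneous_linForm (c : σ → k) : (linForm c).IsHomogeneous 1 := by
  refine IsHomogeneous.sum _ _ _ fun i _ => ?_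
  simpa using (isHomogeneous_C σ (c i)).mul (isHomogeneous_X k i)

/-- A polynomial vanishing on a hyperplane is divisible by its equation. -/
lemma linForm_dvd [Infinite k] {c : σ → k} (hc : c ≠ 0) {G : MvPolynomial σ k}
    (hG : ∀ v, c ⬝ᵥ v = 0 → eval v G = 0) : linForm c ∣ G := by
  classical
  obtain ⟨j, hj⟩ := Function.ne_iff.1 hc
  have hj : c j ≠ 0 := hj
  -- The projection onto the hyperplane along the `j`-th axis: it kills `G`, yet it is the identity
  -- modulo `linForm c`.
  let g : σ → MvPolynomial σ k := fun i =>
    X i - if i = j then C (c j)⁻¹ * linForm c else 0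
  have h1 : bind₁ g G = 0 := by
    apply MvPolynomial.funext
    intro v
    have h2 : eval v (bind₁ g G) = eval (fun i => eval v (g i)) G := by
      exact eval₂Hom_bind₁ _ _ _ _
    rw [h2, map_zero]
    apply hG
    have h3 : ∀ i, eval v (g i) = v i - if i = j then (c j)⁻¹ * (c ⬝ᵥ v) else 0 := by
      intro i
      by_cases h : i = j <;> simp [g, h, eval_linForm]
    simp only [h3, dotProduct, mul_sub, Finset.sum_sub_distrib, mul_ite, mul_zero,
      Finset.sum_ite_eq', Finset.mem_univ, if_true]
    rw [mul_inv_cancel_left₀ hj, sub_self]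
  have h2 : (Ideal.Quotient.mkₐ k (Ideal.span {linForm c})).comp (bind₁ g) =
      Ideal.Quotient.mkₐ k (Ideal.span {linForm c}) := by
    ext i
    rw [AlgHom.comp_apply, bind₁_X_right]
    simp only [g, map_sub, Ideal.Quotient.mkₐ_eq_mk, sub_eq_self]
    split_ifs
    · rw [Ideal.Quotient.eq_zero_iff_mem]
      exact Ideal.mul_mem_left _ _ (Ideal.mem_span_singleton_self _)
    · exact map_zero _
  have h3 := DFunLike.congr_fun h2 G
  rw [AlgHom.comp_apply, h1, map_zero, Ideal.Quotient.mkₐ_eq_mk, eq_comm,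
    Ideal.Quotient.eq_zero_iff_mem, Ideal.mem_span_singleton] at h3
  exact h3

lemma exists_eq_linForm_mul [Infinite k] {c : σ → k} (hc : c ≠ 0) {G : MvPolynomial σ k} {d : ℕ}
    (hd : G.IsHomogeneous (d + 1)) (hG : ∀ v, c ⬝ᵥ v = 0 → eval v G = 0) :
    ∃ H : MvPolynomial σ k, H.IsHomogeneous d ∧ G = linForm c * H := by
  obtain ⟨H, rfl⟩ := linForm_dvd hc hG
  by_cases h0 : linForm c * H = 0
  · exact ⟨0, isHomogeneous_zero _ _ _, by rw [h0, mul_zero]⟩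
  · exact ⟨H, isHomogeneous_right_of_mul (by rwa [add_comm] at hd) (isHomogeneous_linForm c) h0,
      rfl⟩

end LinearForm

end QuarticMonoid

open MvPolynomial

namespace QuarticMonoid

/-! ### Points and lines of the plane. -/

section PlaneLine

variable {k : Type*} [Field k]

lemma finrank_ker_dotProduct {n : ℕ} {c : Fin (n + 1) → k} (hc : c ≠ 0) :
    Module.finrank k (LinearMap.ker (dotProductBilin k k c)) = n := by
  have h1 := LinearMap.finrank_range_add_finrank_ker (dotProductBilin k k c)
  have h2 : LinearMap.range (dotProductBilin k k c) = ⊤ := by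
    refine LinearMap.range_eq_top.2 (LinearMap.surjective fun h => hc ?_)
    funext i
    have := LinearMap.congr_fun h (Pi.single i 1)
    simpa using this
  rw [h2, finrank_top, Module.finrank_self, Module.finrank_fin_fun] at h1
  omega

lemma exists_combination {c v w x : Fin 3 → k} (hc : c ≠ 0) (hvw : LinearIndependent k ![v, w])
    (hv : c ⬝ᵥ v = 0) (hw : c ⬝ᵥ w = 0) (hx : c ⬝ᵥ x = 0) : ∃ s t : k, x = s • v + t • w := by
  have h1 : Submodule.span k {v, w} ≤ LinearMap.ker (dotProductBilin k k c) := by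
    rw [Submodule.span_le]
    rintro u (rfl | rfl) <;> simpa
  have h2 := finrank_span_eq_card hvw
  rw [Matrix.range_cons, Matrix.range_cons, Matrix.range_empty, Set.union_empty,
    Set.singleton_union] at h2
  have h3 := Submodule.eq_of_le_of_finrank_le h1 (by
    rw [h2, finrank_ker_dotProduct hc, Fintype.card_fin])
  have h4 : x ∈ Submodule.span k {v, w} := by
    rw [h3]
    simpa
  obtain ⟨s, t, h⟩ := Submodule.mem_span_pair.1 h4
  exact ⟨s, t, h.symm⟩

/-- A form of degree `d` with more than `d` zeros on a line of the plane vanishes there. -/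
lemma eval_eq_zero_of_card_lt [Infinite k] {ι : Type*} {G : MvPolynomial (Fin 3) k} {d : ℕ}
    (hG : G.IsHomogeneous (d + 1)) {c : Fin 3 → k} (hc : c ≠ 0) {p : ι → Fin 3 → k}
    {S : Finset ι} (hp : ∀ i ∈ S, ∀ j ∈ S, i ≠ j → LinearIndependent k ![p i, p j]) (hS : d + 1 < S.card)
    (hcp : ∀ i ∈ S, c ⬝ᵥ p i = 0) (hGp : ∀ i ∈ S, eval (p i) G = 0) (v : Fin 3 → k)
    (hv : c ⬝ᵥ v = 0) : eval v G = 0 := by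
  classical
  obtain ⟨i, hi, j, hj, hij⟩ := Finset.one_lt_card.1 (show 1 < S.card by omega)
  -- In the parametrisation `p j + r • p i` the point `p i` is at infinity: its being a zero kills
  -- the leading coefficient, and the other points give distinct roots, one too many for the
  -- remaining degree.
  have h1 : ∀ l ∈ S, ∃ r : k, l ≠ i → ∃ t : k, t ≠ 0 ∧ p l = t • (p j + r • p i) := by
    intro l hl
    obtain ⟨s, t, h⟩ := exists_combination hc (hp j hj i hi hij.symm) (hcp j hj) (hcp i hi) (hcp l hl)
    refine ⟨s⁻¹ * t, fun hli => ⟨s, ?_, ?_⟩⟩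
    · rintro rfl
      have := LinearIndependent.pair_iff.1 (hp l hl i hi hli) 1 (-t) (by rw [h]; module)
      exact one_ne_zero this.1
    · have hs : s ≠ 0 := by
        rintro rfl
        have := LinearIndependent.pair_iff.1 (hp l hl i hi hli) 1 (-t) (by rw [h]; module)
        exact one_ne_zero this.1
      rw [smul_add, smul_smul, mul_inv_cancel_left₀ hs, h]
  choose! r hr using h1
  have hexp := eval_add_smul_of_isHomogeneous hG (p j) (p i)
  have h2 : (linePoly G (p j) (p i)).coeff (d + 1) = 0 := by
    have := hexp 0 1
    rw [zero_smul, one_smul, zero_add, hGp i hi, Finset.sum_range_succ,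
      Finset.sum_eq_zero] at this
    · simpa using this.symm
    · intro m hm
      have hm : m < d + 1 := Finset.mem_range.1 hm
      rw [zero_pow (by omega)]
      ring
  have h3 : linePoly G (p j) (p i) = 0 := by
    refine Polynomial.eq_zero_of_natDegree_lt_card_of_eval_eq_zero' _
      ((S.erase i).image r) ?_ ?_
    · intro x hx
      obtain ⟨l, hl, rfl⟩ := Finset.mem_image.1 hx
      obtain ⟨hli, hl⟩ := Finset.mem_erase.1 hl
      obtain ⟨t, ht, h⟩ := hr l hl hli
      have := hGp l hl
      rw [h, eval_smul_of_isHomogeneous hG] at this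
      rw [eval_linePoly]
      exact (mul_eq_zero.1 this).resolve_left (pow_ne_zero _ ht)
    · rw [Finset.card_image_of_injOn, Finset.card_erase_of_mem hi]
      · have h4 := natDegree_linePoly_le hG (p j) (p i)
        rcases h4.lt_or_eq with h4 | h4
        · omega
        · rw [← h4, Polynomial.coeff_natDegree, Polynomial.leadingCoeff_eq_zero] at h2
          rw [h2, Polynomial.natDegree_zero]
          omega
      · intro l hl m hm hlm
        by_contra hne
        obtain ⟨hli, hl⟩ := Finset.mem_erase.1 hl
        obtain ⟨hmi, hm⟩ := Finset.mem_erase.1 hm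
        obtain ⟨t, ht, h⟩ := hr l hl hli
        obtain ⟨u, hu, h'⟩ := hr m hm hmi
        have := LinearIndependent.pair_iff.1 (hp l hl m hm hne) u (-t) (by
          rw [h, h', hlm]; module)
        exact hu this.1
  obtain ⟨s, t, rfl⟩ := exists_combination hc (hp j hj i hi hij.symm) (hcp j hj) (hcp i hi) hv
  rw [hexp, h3]
  simp

/-- A line of the plane through two given points. -/
lemma exists_dotProduct_eq_zero (v w : Fin 3 → k) :
    ∃ c : Fin 3 → k, c ≠ 0 ∧ c ⬝ᵥ v = 0 ∧ c ⬝ᵥ w = 0 := by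
  obtain ⟨c, hc, h⟩ := Matrix.exists_mulVec_eq_zero_iff.2
    (show Matrix.det !![v 0, v 1, v 2; w 0, w 1, w 2; 0, 0, 0] = 0 by
      simp [Matrix.det_fin_three])
  refine ⟨c, hc, ?_, ?_⟩
  · have := congrFun h 0
    simpa [Matrix.mulVec, dotProduct, Fin.sum_univ_three, mul_comm] using this
  · have := congrFun h 1
    simpa [Matrix.mulVec, dotProduct, Fin.sum_univ_three, mul_comm] using this

/-- Two points of a line determine it. -/
lemma exists_smul_of_dotProduct_eq_zero {c c' v w : Fin 3 → k} (hc : c ≠ 0)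
    (hvw : LinearIndependent k ![v, w]) (hv : c ⬝ᵥ v = 0) (hw : c ⬝ᵥ w = 0)
    (hv' : c' ⬝ᵥ v = 0) (hw' : c' ⬝ᵥ w = 0) : ∃ r : k, c' = r • c := by
  obtain ⟨i, hi⟩ := Function.ne_iff.1 hc
  have hi : c i ≠ 0 := hi
  refine ⟨c' i / c i, ?_⟩
  have h : ∀ y, c ⬝ᵥ y = 0 → c' ⬝ᵥ y = 0 := by
    intro y hy
    obtain ⟨s, t, rfl⟩ := exists_combination hc hvw hv hw hy
    simp [hv', hw']
  funext j
  have := h (c i • Pi.single j 1 - c j • Pi.single i 1) (by simp [mul_comm])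
  simp at this
  simp only [Pi.smul_apply, smul_eq_mul]
  field_simp
  linear_combination this

end PlaneLine

end QuarticMonoid

open MvPolynomial

namespace QuarticMonoid

/-! ### Forms compared with a cubic along a trisecant. -/

section Restriction

variable {k : Type*} [Field k]

lemma exists_eq_linForm {σ : Type*} [Fintype σ] {H : MvPolynomial σ k} (hH : H.IsHomogeneous 1) :
    ∃ m : σ → k, H = linForm m := by
  have h1 := hH.sum_X_mul_pderiv
  rw [one_smul] at h1
  have h2 : ∀ i, ∃ r : k, pderiv i H = C r := fun i =>
    ⟨_, (totalDegree_eq_zero_iff_eq_C.1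
      (Nat.le_zero.1 (hH.pderiv (i := i)).totalDegree_le))⟩
  choose m hm using h2
  refine ⟨m, ?_⟩
  rw [← h1, linForm]
  exact Finset.sum_congr rfl fun i _ => by rw [hm, mul_comm]

lemma exists_dual {n : ℕ} {v w : Fin n → k} (hvw : LinearIndependent k ![v, w]) :
    ∃ d : Fin n → k, d ⬝ᵥ v = 0 ∧ d ⬝ᵥ w = 1 := by
  by_contra! h
  have h0 : ∀ d : Fin n → k, d ⬝ᵥ v = 0 → d ⬝ᵥ w = 0 := by
    intro d hd
    by_contra hne
    exact h ((d ⬝ᵥ w)⁻¹ • d) (by simp [hd]) (by simp [hne])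
  have hv : v ≠ 0 := hvw.ne_zero 0
  obtain ⟨i, hi⟩ := Function.ne_iff.1 hv
  have hi : v i ≠ 0 := hi
  have h1 : (w i) • v + (-(v i)) • w = 0 := by
    funext j
    have := h0 (v i • Pi.single j 1 - v j • Pi.single i 1) (by simp [mul_comm])
    simp at this
    simp only [Pi.add_apply, Pi.smul_apply, smul_eq_mul, Pi.zero_apply]
    linear_combination -this
  exact hi (neg_eq_zero.1 (LinearIndependent.pair_iff.1 hvw _ _ h1).2)

variable {ι : Type*} {p : ι → Fin 3 → k}

lemma exists_eq_linForm_mul_of_card_lt [Infinite k] {G : MvPolynomial (Fin 3) k} {d : ℕ}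
    (hG : G.IsHomogeneous (d + 1)) {c : Fin 3 → k} (hc : c ≠ 0)
    {S : Finset ι} (hp : ∀ i ∈ S, ∀ j ∈ S, i ≠ j → LinearIndependent k ![p i, p j])
    (hS : d + 1 < S.card)
    (hcp : ∀ i ∈ S, c ⬝ᵥ p i = 0) (hGp : ∀ i ∈ S, eval (p i) G = 0) :
    ∃ H : MvPolynomial (Fin 3) k, H.IsHomogeneous d ∧ G = linForm c * H :=
  exists_eq_linForm_mul hc hG (eval_eq_zero_of_card_lt hG hc hp hS hcp hGp)

lemma linearIndependent_of_eval {f : MvPolynomial (Fin 3) k} {d : ℕ} (hf : f.IsHomogeneous d)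
    {v w : Fin 3 → k} (hv0 : v ≠ 0) (hv : eval v f = 0) (hw : eval w f ≠ 0) :
    LinearIndependent k ![v, w] := by
  rw [LinearIndependent.pair_iff]
  intro s t h
  have ht : t = 0 := by
    by_contra ht
    have h1 : w = (-(t⁻¹ * s)) • v := by
      rw [neg_smul, eq_neg_iff_add_eq_zero, ← smul_right_injective _ ht |>.eq_iff, smul_add,
        smul_smul, mul_inv_cancel_left₀ ht, smul_zero, add_comm, h]
    rw [h1, eval_smul_of_isHomogeneous hf, hv, mul_zero] at hw
    exact hw rfl
  subst ht
  rw [zero_smul, add_zero] at h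
  exact ⟨(smul_eq_zero.1 h).resolve_right hv0, rfl⟩

/-- Off the points of `S`, a line meeting the cubic `f` in `S` contains no zero of `f`. -/
lemma dotProduct_ne_zero_of_notMem [Infinite k] {f : MvPolynomial (Fin 3) k}
    (hf : f.IsHomogeneous 3) (hp : ∀ i j, i ≠ j → LinearIndependent k ![p i, p j])
    (hfp : ∀ i, eval (p i) f = 0) {c R : Fin 3 → k} (hc : c ≠ 0) (hR : c ⬝ᵥ R = 0)
    (hfR : eval R f ≠ 0) {S : Finset ι} (hS : S.card = 3) (hcp : ∀ i ∈ S, c ⬝ᵥ p i = 0) {i : ι}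
    (hi : i ∉ S) : c ⬝ᵥ p i ≠ 0 := by
  classical
  intro h
  refine hfR (eval_eq_zero_of_card_lt (p := p) (S := insert i S) hf hc
    (fun i _ j _ => hp i j) ?_ ?_ (fun i _ => hfp i) R hR)
  · rw [Finset.card_insert_of_notMem hi, hS]
    norm_num
  · intro j hj
    rcases Finset.mem_insert.1 hj with rfl | hj
    exacts [h, hcp j hj]

/-- Two cubics through the same three points of a line agree there up to a factor. -/
lemma exists_eq_C_mul_add [Infinite k] {f G : MvPolynomial (Fin 3) k} (hf : f.IsHomogeneous 3)
    (hG : G.IsHomogeneous 3) (hp : ∀ i j, i ≠ j → LinearIndependent k ![p i, p j])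
    {c R : Fin 3 → k} (hc : c ≠ 0) (hR : c ⬝ᵥ R = 0)
    (hfR : eval R f ≠ 0) {S : Finset ι} (hS : S.card = 3) (hcp : ∀ i ∈ S, c ⬝ᵥ p i = 0)
    (hfp : ∀ i ∈ S, eval (p i) f = 0) (hGp : ∀ i ∈ S, eval (p i) G = 0) :
    ∃ (r : k) (H : MvPolynomial (Fin 3) k), H.IsHomogeneous 2 ∧ G = C r * f + linForm c * H := by
  classical
  have hp0 : ∀ i ∈ S, p i ≠ 0 := by
    intro i hi
    obtain ⟨j, hj, hij⟩ := Finset.exists_mem_ne (show 1 < S.card by omega) i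
    exact (hp i j hij.symm).ne_zero 0
  have hpR : ∀ i ∈ S, LinearIndependent k ![p i, R] := fun i hi =>
    linearIndependent_of_eval hf (hp0 i hi) (hfp i hi) hfR
  -- Equal values at `R` provide a fourth zero of `G - C r * f` on the line.
  obtain ⟨r, hr⟩ : ∃ r, r * eval R f = eval R G := ⟨eval R G / eval R f, by simp [hfR]⟩
  have key : ∃ H : MvPolynomial (Fin 3) k, H.IsHomogeneous 2 ∧ G - C r * f = linForm c * H := by
    refine exists_eq_linForm_mul_of_card_lt (S := insert R (S.image p)) (p := id)
      (hG.sub (by simpa using (isHomogeneous_C _ r).mul hf)) hc ?_ ?_ ?_ ?_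
    · intro v hv w hw hvw
      simp only [Finset.mem_insert, Finset.mem_image] at hv hw
      rcases hv with rfl | ⟨i, hi, rfl⟩ <;> rcases hw with rfl | ⟨j, hj, rfl⟩
      · exact absurd rfl hvw
      · exact LinearIndependent.pair_symm_iff.1 (hpR j hj)
      · exact hpR i hi
      · exact hp i j fun h => hvw (congrArg p h)
    · rw [Finset.card_insert_of_notMem, Finset.card_image_of_injective, hS]
      · norm_num
      · exact fun i j hij => by_contra fun h => by
          have := LinearIndependent.pair_iff.1 (hp i j h) 1 (-1) (by rw [hij]; module)
          exact one_ne_zero this.1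
      · rw [Finset.mem_image]
        rintro ⟨i, hi, rfl⟩
        exact hfR (hfp i hi)
    · simpa [hR] using hcp
    · simp only [Finset.forall_mem_insert, Finset.forall_mem_image, id, map_sub, map_mul, eval_C,
        hr, sub_self, true_and]
      intro i hi
      rw [hfp i hi, hGp i hi, mul_zero, sub_zero]
  obtain ⟨H, hH, h⟩ := key
  exact ⟨r, H, hH, by rw [← h]; ring⟩

/-- A quartic through the three points in which a line meets a cubic `f` is on this line a multiple
of `f` by a linear form. -/
lemma exists_eq_linForm_mul_add [Infinite k] {f G : MvPolynomial (Fin 3) k}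
    (hf : f.IsHomogeneous 3)
    (hG : G.IsHomogeneous 4) (hp : ∀ i j, i ≠ j → LinearIndependent k ![p i, p j])
    {c R : Fin 3 → k} (hc : c ≠ 0) (hR : c ⬝ᵥ R = 0)
    (hfR : eval R f ≠ 0) {S : Finset ι} (hS : S.card = 3) (hcp : ∀ i ∈ S, c ⬝ᵥ p i = 0)
    (hfp : ∀ i ∈ S, eval (p i) f = 0) (hGp : ∀ i ∈ S, eval (p i) G = 0) :
    ∃ (l : Fin 3 → k) (H : MvPolynomial (Fin 3) k), H.IsHomogeneous 3 ∧
      G = linForm l * f + linForm c * H := by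
  classical
  have hp0 : ∀ i ∈ S, p i ≠ 0 := by
    intro i hi
    obtain ⟨j, hj, hij⟩ := Finset.exists_mem_ne (show 1 < S.card by omega) i
    exact (hp i j hij.symm).ne_zero 0
  obtain ⟨i₀, hi₀⟩ := Finset.card_pos.1 (show 0 < S.card by omega)
  obtain ⟨u, hu0, hu⟩ : ∃ u : k, u ≠ 0 ∧ eval (R + u • p i₀) f ≠ 0 := by
    by_contra! h
    have : linePoly f R (p i₀) = 0 :=
      Polynomial.eq_zero_of_infinite_isRoot _ (Set.Infinite.mono (s := {0}ᶜ)
        (fun u hu => by rw [Set.mem_ofPred_eq, Polynomial.IsRoot, eval_linePoly]; exact h u hu)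
        (Set.finite_singleton 0).infinite_compl)
    apply hfR
    rw [← coeff_zero_linePoly f R (p i₀), this, Polynomial.coeff_zero]
  obtain ⟨R', hcR', hfR', hRR⟩ : ∃ R', c ⬝ᵥ R' = 0 ∧ eval R' f ≠ 0 ∧
      LinearIndependent k ![R, R'] := by
    refine ⟨R + u • p i₀, by simp [hR, hcp i₀ hi₀], hu, ?_⟩
    have := linearIndependent_of_eval hf (hp0 i₀ hi₀) (hfp i₀ hi₀) hfR
    rw [LinearIndependent.pair_iff] at this ⊢
    intro s t h
    have h1 := this (t * u) (s + t) (by rw [← h]; module)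
    have h2 : t = 0 := (mul_eq_zero.1 h1.1).resolve_right hu0
    exact ⟨by simpa [h2] using h1.2, h2⟩
  -- The linear form interpolates the quotient at two points of the line off `f`, so the quartic `G
  -- - linForm l * f` has five zeros on the line.
  obtain ⟨l, hl, hl'⟩ : ∃ l : Fin 3 → k, (l ⬝ᵥ R) * eval R f = eval R G ∧
      (l ⬝ᵥ R') * eval R' f = eval R' G := by
    obtain ⟨d, hd, hd'⟩ := exists_dual hRR
    obtain ⟨e, he, he'⟩ := exists_dual (v := R') (w := R) (LinearIndependent.pair_symm_iff.1 hRR)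
    exact ⟨(eval R G / eval R f) • e + (eval R' G / eval R' f) • d,
      by simp [he', hd, hfR], by simp [he, hd', hfR']⟩
  have hpR : ∀ i ∈ S, ∀ Q, eval Q f ≠ 0 → LinearIndependent k ![p i, Q] := fun i hi Q hQ =>
    linearIndependent_of_eval hf (hp0 i hi) (hfp i hi) hQ
  have hlf : (G - linForm l * f).IsHomogeneous 4 :=
    hG.sub (by simpa using (isHomogeneous_linForm l).mul hf)
  have key : ∃ H : MvPolynomial (Fin 3) k, H.IsHomogeneous 3 ∧
      G - linForm l * f = linForm c * H := by
    refine exists_eq_linForm_mul_of_card_lt (S := insert R (insert R' (S.image p))) (p := id)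
      (d := 3) hlf hc ?_ ?_ ?_ ?_
    · intro v hv w hw hvw
      simp only [Finset.mem_insert, Finset.mem_image] at hv hw
      rcases hv with rfl | rfl | ⟨i, hi, rfl⟩ <;> rcases hw with rfl | rfl | ⟨j, hj, rfl⟩
      · exact absurd rfl hvw
      · exact hRR
      · exact LinearIndependent.pair_symm_iff.1 (hpR j hj _ hfR)
      · exact LinearIndependent.pair_symm_iff.1 hRR
      · exact absurd rfl hvw
      · exact LinearIndependent.pair_symm_iff.1 (hpR j hj _ hfR')
      · exact hpR i hi _ hfR
      · exact hpR i hi _ hfR'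
      · exact hp i j fun h => hvw (congrArg p h)
    · rw [Finset.card_insert_of_notMem, Finset.card_insert_of_notMem,
        Finset.card_image_of_injective, hS]
      · norm_num
      · exact fun i j hij => by_contra fun h => by
          have := LinearIndependent.pair_iff.1 (hp i j h) 1 (-1) (by rw [hij]; module)
          exact one_ne_zero this.1
      · rw [Finset.mem_image]
        rintro ⟨i, hi, rfl⟩
        exact hfR' (hfp i hi)
      · rw [Finset.mem_insert, Finset.mem_image]
        rintro (rfl | ⟨i, hi, rfl⟩)
        · have := LinearIndependent.pair_iff.1 hRR 1 (-1) (by module)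
          exact one_ne_zero this.1
        · exact hfR (hfp i hi)
    · simpa [hR, hcR'] using hcp
    · simp only [Finset.forall_mem_insert, Finset.forall_mem_image, id, map_sub, map_mul,
        eval_linForm, hl, hl', sub_self, true_and]
      intro i hi
      rw [hfp i hi, hGp i hi, mul_zero, sub_zero]
  obtain ⟨H, hH, h⟩ := key
  exact ⟨l, H, hH, by rw [← h]; ring⟩

end Restriction

/-! ### Curves through the nine points of three trisecants. -/

section CayleyBacharach

variable {k : Type*} [Field k] {ι : Type*} {p : ι → Fin 3 → k}

/-- A line meeting the cubic `f` exactly in the three points of `S`. -/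
structure IsTrisecant (f : MvPolynomial (Fin 3) k) (p : ι → Fin 3 → k) (c : Fin 3 → k)
    (S : Finset ι) : Prop where
  card_eq : S.card = 3
  ne_zero : c ≠ 0
  dotProduct_eq_zero : ∀ i ∈ S, c ⬝ᵥ p i = 0
  exists_eval_ne_zero : ∃ R, c ⬝ᵥ R = 0 ∧ eval R f ≠ 0

variable [Infinite k]

/-- A quartic through the nine points in which three lines meet a cubic. -/
lemma exists_eq_add_of_isTrisecant {f G : MvPolynomial (Fin 3) k} (hf : f.IsHomogeneous 3)
    (hG : G.IsHomogeneous 4) (hp : ∀ i j, i ≠ j → LinearIndependent k ![p i, p j])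
    (hfp : ∀ i, eval (p i) f = 0)
    {a b c : Fin 3 → k} {A B D : Finset ι} (hA : IsTrisecant f p a A) (hB : IsTrisecant f p b B)
    (hD : IsTrisecant f p c D) (hAB : Disjoint A B) (hAD : Disjoint A D) (hBD : Disjoint B D)
    (hGA : ∀ i ∈ A, eval (p i) G = 0) (hGB : ∀ i ∈ B, eval (p i) G = 0)
    (hGD : ∀ i ∈ D, eval (p i) G = 0) :
    ∃ l m : Fin 3 → k,
      G = linForm l * f + linForm a * linForm b * linForm c * linForm m := by
  obtain ⟨R, hR, hfR⟩ := hA.exists_eval_ne_zero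
  obtain ⟨R', hR', hfR'⟩ := hB.exists_eval_ne_zero
  obtain ⟨l, H, hH, h⟩ := exists_eq_linForm_mul_add hf hG hp hA.ne_zero hR hfR hA.card_eq
    hA.dotProduct_eq_zero (fun i _ => hfp i) hGA
  -- Off `A` the equation of the line does not vanish, so the zeros of `G` pass on to the cofactor,
  -- and the next line can be split off.
  have h1 : ∀ i, i ∉ A → eval (p i) G = 0 → eval (p i) H = 0 := by
    intro i hi h0
    rw [h, map_add, map_mul, hfp, mul_zero, zero_add, map_mul, eval_linForm] at h0
    exact (mul_eq_zero.1 h0).resolve_left (dotProduct_ne_zero_of_notMem hf hp hfp hA.ne_zero hR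
      hfR hA.card_eq hA.dotProduct_eq_zero hi)
  obtain ⟨r, H', hH', h'⟩ := exists_eq_C_mul_add hf hH hp hB.ne_zero hR' hfR' hB.card_eq
    hB.dotProduct_eq_zero (fun i _ => hfp i)
    fun i hi => h1 i (Finset.disjoint_right.1 hAB hi) (hGB i hi)
  have h2 : ∀ i, i ∉ B → eval (p i) H = 0 → eval (p i) H' = 0 := by
    intro i hi h0
    rw [h', map_add, map_mul, hfp, mul_zero, zero_add, map_mul, eval_linForm] at h0
    exact (mul_eq_zero.1 h0).resolve_left (dotProduct_ne_zero_of_notMem hf hp hfp hB.ne_zero hR'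
      hfR' hB.card_eq hB.dotProduct_eq_zero hi)
  obtain ⟨H'', hH'', h''⟩ := exists_eq_linForm_mul_of_card_lt hH' hD.ne_zero
    (fun i _ j _ => hp i j) (by rw [hD.card_eq]; norm_num) hD.dotProduct_eq_zero
    fun i hi => h2 i (Finset.disjoint_right.1 hBD hi)
      (h1 i (Finset.disjoint_right.1 hAD hi) (hGD i hi))
  obtain ⟨m, rfl⟩ := exists_eq_linForm hH''
  -- The result of the peeling is G = l f + a (r f + b c m), and r a is absorbed into the linear
  -- form.
  refine ⟨l + r • a, m, ?_⟩
  have h3 : linForm (l + r • a) = linForm l + C r * linForm a := by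
    apply MvPolynomial.funext
    intro v
    simp [eval_linForm]
  rw [h, h', h'', h3]
  ring

/-- A cubic through the nine points in which three lines meet another cubic. -/
lemma exists_eq_C_mul_add_of_isTrisecant {f G : MvPolynomial (Fin 3) k} (hf : f.IsHomogeneous 3)
    (hG : G.IsHomogeneous 3) (hp : ∀ i j, i ≠ j → LinearIndependent k ![p i, p j])
    (hfp : ∀ i, eval (p i) f = 0)
    {a b c : Fin 3 → k} {A B D : Finset ι} (hA : IsTrisecant f p a A) (hB : IsTrisecant f p b B)
    (hD : IsTrisecant f p c D) (hAB : Disjoint A B) (hAD : Disjoint A D) (hBD : Disjoint B D)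
    (hGA : ∀ i ∈ A, eval (p i) G = 0) (hGB : ∀ i ∈ B, eval (p i) G = 0)
    (hGD : ∀ i ∈ D, eval (p i) G = 0) :
    ∃ r s : k, G = C r * f + C s * linForm a * linForm b * linForm c := by
  obtain ⟨R, hR, hfR⟩ := hA.exists_eval_ne_zero
  obtain ⟨R', hR', hfR'⟩ := hB.exists_eval_ne_zero
  obtain ⟨r, H, hH, h⟩ := exists_eq_C_mul_add hf hG hp hA.ne_zero hR hfR hA.card_eq
    hA.dotProduct_eq_zero (fun i _ => hfp i) hGA
  have h1 : ∀ i, i ∉ A → eval (p i) G = 0 → eval (p i) H = 0 := by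
    intro i hi h0
    rw [h, map_add, map_mul, hfp, mul_zero, zero_add, map_mul, eval_linForm] at h0
    exact (mul_eq_zero.1 h0).resolve_left (dotProduct_ne_zero_of_notMem hf hp hfp hA.ne_zero hR
      hfR hA.card_eq hA.dotProduct_eq_zero hi)
  obtain ⟨H', hH', h'⟩ := exists_eq_linForm_mul_of_card_lt hH hB.ne_zero
    (fun i _ j _ => hp i j) (by rw [hB.card_eq]; norm_num) hB.dotProduct_eq_zero
    fun i hi => h1 i (Finset.disjoint_right.1 hAB hi) (hGB i hi)
  have h2 : ∀ i, i ∉ B → eval (p i) H = 0 → eval (p i) H' = 0 := by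
    intro i hi h0
    rw [h', map_mul, eval_linForm] at h0
    exact (mul_eq_zero.1 h0).resolve_left (dotProduct_ne_zero_of_notMem hf hp hfp hB.ne_zero hR'
      hfR' hB.card_eq hB.dotProduct_eq_zero hi)
  obtain ⟨H'', hH'', h''⟩ := exists_eq_linForm_mul_of_card_lt hH' hD.ne_zero
    (fun i _ j _ => hp i j) (by rw [hD.card_eq]; norm_num) hD.dotProduct_eq_zero
    fun i hi => h2 i (Finset.disjoint_right.1 hBD hi)
      (h1 i (Finset.disjoint_right.1 hAD hi) (hGD i hi))
  refine ⟨r, coeff 0 H'', ?_⟩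
  rw [h, h', h'', totalDegree_eq_zero_iff_eq_C.1 (Nat.le_zero.1 hH''.totalDegree_le), coeff_C]
  simp only [if_true]
  ring

end CayleyBacharach

end QuarticMonoid

open MvPolynomial

namespace QuarticMonoid

/-! ### At most twelve common zeros. -/

section Bezout

variable {k : Type*} [Field k]

lemma finrank_homogeneousSubmodule (d : ℕ) :
    Module.finrank k (homogeneousSubmodule (Fin 3) k d) = (d + 2).choose 2 := by
  classical
  have e : homogeneousSubmodule (Fin 3) k d ≃ₗ[k]
      ({e : Fin 3 →₀ ℕ | e.degree = d} →₀ k) :=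
    (LinearEquiv.ofEq _ _ (homogeneousSubmodule_eq_finsupp_supported (Fin 3) k d)).trans
      (AddMonoidAlgebra.supportedEquivFinsupp _)
  have h : {e : Fin 3 →₀ ℕ | e.degree = d} =
      ((Finset.univ : Finset (Fin 3)).finsuppAntidiag d : Set (Fin 3 →₀ ℕ)) := by
    ext e
    simp [Finset.mem_finsuppAntidiag, Finsupp.degree_eq_sum]
  rw [h] at e
  rw [e.finrank_eq, Module.finrank_finsupp_self]
  simp only [Finset.coe_sort_coe, Fintype.card_coe]
  rw [Finset.card_finsuppAntidiag_nat_eq_choose, Finset.card_univ, Fintype.card_fin,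
    show 3 + d - 1 = d + 2 by omega, Nat.choose_symm_add]

instance (d : ℕ) : FiniteDimensional k (homogeneousSubmodule (Fin 3) k d) :=
  Module.Finite.iff_fg.2 (homogeneousSubmodule_fg _ _ d)

/-- Each other point contributes one linear form through it, normalised to take the value 1 at `v`;
their product has degree one less than the number of points. -/
lemma exists_form_separating {S : Finset (Fin 3 → k)}
    (hS : ∀ v ∈ S, ∀ w ∈ S, v ≠ w → LinearIndependent k ![v, w]) {v : Fin 3 → k} (hv : v ∈ S) :
    ∃ G : MvPolynomial (Fin 3) k, G.IsHomogeneous (S.card - 1) ∧ eval v G = 1 ∧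
      ∀ w ∈ S, w ≠ v → eval w G = 0 := by
  classical
  have h : ∀ w ∈ S, w ≠ v → ∃ d : Fin 3 → k, d ⬝ᵥ w = 0 ∧ d ⬝ᵥ v = 1 := fun w hw hne =>
    exists_dual (hS w hw v hv hne)
  choose! d hd hd' using h
  refine ⟨∏ w ∈ S.erase v, linForm (d w), ?_, ?_, ?_⟩
  · have := IsHomogeneous.prod (S.erase v) (fun w => linForm (d w)) (fun _ => 1)
      fun w _ => isHomogeneous_linForm (d w)
    rwa [Finset.sum_const, smul_eq_mul, mul_one, Finset.card_erase_of_mem hv] at this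
  · rw [map_prod]
    refine Finset.prod_eq_one fun w hw => ?_
    rw [eval_linForm, hd' w (Finset.mem_of_mem_erase hw) (Finset.ne_of_mem_erase hw)]
  · intro w hw hne
    rw [map_prod]
    refine Finset.prod_eq_zero (Finset.mem_erase.2 ⟨hne, hw⟩) ?_
    rw [eval_linForm, hd w hw hne]

/-- A cubic and a quartic without common factor have at most twelve common points. -/
theorem card_le_of_isRelPrime {f g : MvPolynomial (Fin 3) k} (hf : f.IsHomogeneous 3)
    (hg : g.IsHomogeneous 4) (hf0 : f ≠ 0) (hfg : IsRelPrime f g) {S : Finset (Fin 3 → k)}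
    (hS : ∀ v ∈ S, ∀ w ∈ S, v ≠ w → LinearIndependent k ![v, w])
    (hSf : ∀ v ∈ S, eval v f = 0) (hSg : ∀ v ∈ S, eval v g = 0) : S.card ≤ 12 := by
  classical
  by_contra! h13
  obtain ⟨S', hS'S, hS'⟩ := Finset.exists_subset_card_eq (show 13 ≤ S.card from h13)
  replace hS : ∀ v ∈ S', ∀ w ∈ S', v ≠ w → LinearIndependent k ![v, w] :=
    fun v hv w hw => hS v (hS'S hv) w (hS'S hw)
  let H := fun d => homogeneousSubmodule (Fin 3) k d
  let E : H 12 →ₗ[k] (S' → k) :=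
    LinearMap.pi fun v => (aeval (R := k) (v : Fin 3 → k)).toLinearMap ∘ₗ (H 12).subtype
  have hE : ∀ (G : H 12) (v : S'), E G v = eval (v : Fin 3 → k) (G : MvPolynomial (Fin 3) k) :=
    fun G v => by simp [E, aeval_eq_eval]
  have hEsurj : Function.Surjective E := by
    intro y
    have h1 : ∀ v : S', ∃ G : H 12, ∀ w : S', E G w = if w = v then 1 else 0 := by
      intro v
      obtain ⟨G, hG, hGv, hGw⟩ := exists_form_separating hS v.2
      rw [hS'] at hG
      refine ⟨⟨G, hG⟩, fun w => ?_⟩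
      rw [hE]
      split_ifs with hwv
      · rw [hwv]
        exact hGv
      · exact hGw w w.2 fun h => hwv (Subtype.ext h)
    choose G hG using h1
    refine ⟨∑ v, y v • G v, ?_⟩
    funext w
    simp [map_sum, hG]
  have hEker : Module.finrank k (LinearMap.ker E) = 78 := by
    have h1 := LinearMap.finrank_range_add_finrank_ker E
    rw [LinearMap.range_eq_top.2 hEsurj, finrank_top, Module.finrank_fintype_fun_eq_card,
      Fintype.card_coe, hS', finrank_homogeneousSubmodule] at h1
    have : (12 + 2).choose 2 = 91 := rfl
    omega
  -- Coprimality makes the relations f a + g b = 0 exactly the pairs (-g c, f c) with c of degree 5.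
  -- So the forms f a + g b of degree 12 span at least 55 + 45 - 21 = 79 dimensions, while vanishing
  -- at thirteen separated points leaves only 91 - 13 = 78.
  let φ : (H 9 × H 8) →ₗ[k] H 12 := LinearMap.codRestrict (H 12)
    (((LinearMap.mulLeft k f) ∘ₗ (H 9).subtype).coprod ((LinearMap.mulLeft k g) ∘ₗ (H 8).subtype))
    fun x => Submodule.add_mem _ (hf.mul x.1.2) (hg.mul x.2.2)
  have hφ : ∀ x, (φ x : MvPolynomial (Fin 3) k) = f * x.1 + g * x.2 := fun _ => rfl
  have hrange : LinearMap.range φ ≤ LinearMap.ker E := by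
    rintro _ ⟨x, rfl⟩
    rw [LinearMap.mem_ker]
    funext v
    rw [hE, hφ, map_add, map_mul, map_mul, hSf v (hS'S v.2), hSg v (hS'S v.2)]
    simp
  let ψ : H 5 →ₗ[k] (H 9 × H 8) := LinearMap.prod
    (LinearMap.codRestrict (H 9) (-(LinearMap.mulLeft k g) ∘ₗ (H 5).subtype)
      fun x => Submodule.neg_mem _ (hg.mul x.2))
    (LinearMap.codRestrict (H 8) ((LinearMap.mulLeft k f) ∘ₗ (H 5).subtype) fun x => hf.mul x.2)
  have hker : LinearMap.ker φ ≤ LinearMap.range ψ := by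
    rintro ⟨⟨a, ha⟩, ⟨b, hb⟩⟩ hab
    have h1 : f * a + g * b = 0 := congrArg Subtype.val hab
    obtain ⟨c, rfl⟩ : f ∣ b := hfg.dvd_of_dvd_mul_left ⟨-a, by linear_combination h1⟩
    have hc : c.IsHomogeneous 5 := by
      by_cases h0 : f * c = 0
      · rw [(mul_eq_zero.1 h0).resolve_left hf0]
        exact isHomogeneous_zero _ _ _
      · exact isHomogeneous_right_of_mul hb hf h0
    refine ⟨⟨c, hc⟩, ?_⟩
    have h2 : a = -(g * c) := mul_left_cancel₀ hf0 (by linear_combination h1)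
    subst h2
    rfl
  have h1 := LinearMap.finrank_range_add_finrank_ker φ
  have h2 := Submodule.finrank_mono hrange
  have h3 := Submodule.finrank_mono hker
  have h4 := LinearMap.finrank_range_le ψ
  rw [Module.finrank_prod, finrank_homogeneousSubmodule, finrank_homogeneousSubmodule] at h1
  rw [finrank_homogeneousSubmodule] at h4
  have : (9 + 2).choose 2 = 55 := rfl
  have : (8 + 2).choose 2 = 45 := rfl
  have : (5 + 2).choose 2 = 21 := rfl
  omega

end Bezout

/-! ### Smoothness makes the cubic and the quartic coprime. -/

section Coprime

variable {k : Type*} [Field k] [IsAlgClosed k]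

/-- A form of positive degree has a zero on every line of the plane. -/
lemma exists_eval_eq_zero_on_line {f : MvPolynomial (Fin 3) k} {d : ℕ}
    (hf : f.IsHomogeneous (d + 1)) {v w : Fin 3 → k} (hvw : LinearIndependent k ![v, w]) :
    ∃ s t : k, s • v + t • w ≠ 0 ∧ eval (s • v + t • w) f = 0 := by
  by_cases hw : eval w f = 0
  · exact ⟨0, 1, by simpa using hvw.ne_zero 1, by simpa using hw⟩
  have h1 : (linePoly f v w).coeff (d + 1) ≠ 0 := by
    have := eval_add_smul_of_isHomogeneous hf v w 0 1
    rw [zero_smul, one_smul, zero_add, Finset.sum_range_succ, Finset.sum_eq_zero] at this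
    · simpa [this] using hw
    · intro m hm
      have hm : m < d + 1 := Finset.mem_range.1 hm
      rw [zero_pow (by omega)]
      ring
  obtain ⟨t, ht⟩ := IsAlgClosed.exists_root (linePoly f v w) (by
    intro h
    rw [Polynomial.coeff_eq_zero_of_natDegree_lt] at h1
    · exact h1 rfl
    · rw [Polynomial.natDegree_eq_of_degree_eq_some (n := 0) h]
      omega)
  rw [Polynomial.IsRoot, eval_linePoly] at ht
  refine ⟨1, t, fun h => ?_, by rwa [one_smul]⟩
  exact one_ne_zero (LinearIndependent.pair_iff.1 hvw 1 t h).1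

lemma exists_linearIndependent_pair {k : Type*} [Field k] {c : Fin 3 → k} (hc : c ≠ 0) :
    ∃ v w : Fin 3 → k, LinearIndependent k ![v, w] ∧ c ⬝ᵥ v = 0 ∧ c ⬝ᵥ w = 0 := by
  let b := Module.finBasisOfFinrankEq _ _ (finrank_ker_dotProduct hc)
  refine ⟨b 0, b 1, ?_, LinearMap.mem_ker.1 (b 0).2, LinearMap.mem_ker.1 (b 1).2⟩
  have h := b.linearIndependent.map' (Submodule.subtype _) (Submodule.ker_subtype _)
  rwa [show (Submodule.subtype _ ∘ b : Fin 2 → Fin 3 → k) = ![(b 0).1, (b 1).1] by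
    funext i; fin_cases i <;> rfl] at h

/-- Hilbert's Nullstellensatz for the prime ideal generated by `h`. -/
lemma dvd_of_forall_eval_eq_zero {σ : Type*} [Finite σ] {h A : MvPolynomial σ k}
    (hh : Prime h) (hA : ∀ v, eval v h = 0 → eval v A = 0) : h ∣ A := by
  have hP : (Ideal.span {h}).IsPrime := (Ideal.span_singleton_prime hh.ne_zero).2 hh
  have h1 := IsPrime.vanishingIdeal_zeroLocus (k := k) (K := k) (Ideal.span {h})
  rw [← Ideal.mem_span_singleton, ← h1, mem_vanishingIdeal_iff]
  intro v hv
  rw [aeval_eq_eval]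
  refine hA v ?_
  have := hv h (Ideal.mem_span_singleton_self h)
  rwa [aeval_eq_eval] at this

/-- The quartic monoid `t f + g = 0` has no singularity other than its triple point. -/
def SmoothOff (f g : MvPolynomial (Fin 3) k) : Prop :=
  ∀ v ≠ 0, eval v f = 0 → eval v g = 0 →
    ∀ t : k, ∃ i, t * eval v (pderiv i f) + eval v (pderiv i g) ≠ 0

/-- Suppose f = h A and g = h B with h prime. Along h = 0 the gradient of t f + g is (t A + B) ∇h,
so smoothness for every t means A = 0 and B ≠ 0 there. Then A, being nonzero, is not constant, and h
divides it; as deg f = 3 this makes h linear. But the cubic B has a zero on the line h = 0. -/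
lemma isRelPrime_of_smoothOff {f g : MvPolynomial (Fin 3) k} (hf : f.IsHomogeneous 3)
    (hg : g.IsHomogeneous 4) (hf0 : f ≠ 0) (hs : SmoothOff f g) : IsRelPrime f g := by
  rw [UniqueFactorizationMonoid.isRelPrime_iff_no_prime_factors hf0]
  rintro h ⟨A, rfl⟩ ⟨B, rfl⟩ hh
  have hA0 : A ≠ 0 := right_ne_zero_of_mul hf0
  obtain ⟨d, hd⟩ := isHomogeneous_of_mul hf hf0
  have hsm : ∀ v ≠ 0, eval v h = 0 → eval v A = 0 ∧ eval v B ≠ 0 := by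
    intro v hv hv0
    have h1 := hs v hv (by simp [hv0]) (by simp [hv0])
    by_contra hcon
    have h2 : ∃ t : k, t * eval v A + eval v B = 0 := by
      by_cases h3 : eval v A = 0
      · exact ⟨0, by rw [zero_mul, zero_add]; by_contra h4; exact hcon ⟨h3, h4⟩⟩
      · exact ⟨-(eval v B / eval v A), by field_simp; ring⟩
    obtain ⟨t, ht⟩ := h2
    obtain ⟨i, hi⟩ := h1 t
    apply hi
    simp only [Derivation.leibniz, smul_eq_mul, map_add, map_mul, hv0, zero_mul, zero_add]
    linear_combination (eval v (pderiv i h)) * ht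
  have hd0 : d ≠ 0 := by
    rintro rfl
    have h1 := totalDegree_eq_zero_iff_eq_C.1 (Nat.le_zero.1 hd.totalDegree_le)
    refine hh.not_isUnit ?_
    rw [h1]
    refine (IsUnit.mk0 _ fun h2 => hh.ne_zero ?_).map C
    rw [h1, h2, map_zero]
  obtain ⟨e, he⟩ := isHomogeneous_of_mul (mul_comm h A ▸ hf) (mul_comm h A ▸ hf0)
  have hde : d + e = 3 := (hd.mul he).inj_right hf hf0
  have he0 : e ≠ 0 := by
    rintro rfl
    obtain ⟨v, w, hvw, -, -⟩ := exists_linearIndependent_pair (k := k) (c := 1) one_ne_zero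
    obtain ⟨d, rfl⟩ := Nat.exists_eq_succ_of_ne_zero hd0
    obtain ⟨s, t, h1, h2⟩ := exists_eval_eq_zero_on_line hd hvw
    have h3 := (hsm _ h1 h2).1
    have h4 := totalDegree_eq_zero_iff_eq_C.1 (Nat.le_zero.1 he.totalDegree_le)
    rw [h4, eval_C] at h3
    rw [h3, map_zero] at h4
    exact hA0 h4
  have hA : h ∣ A := by
    refine dvd_of_forall_eval_eq_zero hh fun v hv => ?_
    by_cases hv0 : v = 0
    · subst hv0
      have := eval_smul_of_isHomogeneous he 0 0
      rwa [zero_smul, zero_pow he0, zero_mul] at this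
    · exact (hsm v hv0 hv).1
  obtain ⟨A', rfl⟩ := hA
  obtain ⟨e', he'⟩ := isHomogeneous_of_mul (mul_comm h A' ▸ he) (mul_comm h A' ▸ hA0)
  have hde' : d + e' = e := (hd.mul he').inj_right he hA0
  obtain rfl : d = 1 := by omega
  obtain ⟨c, rfl⟩ := exists_eq_linForm hd
  have hc : c ≠ 0 := by
    rintro rfl
    exact hh.ne_zero (by simp [linForm])
  obtain ⟨v, w, hvw, hv, hw⟩ := exists_linearIndependent_pair hc
  have hB0 : B ≠ 0 := by
    rintro rfl
    refine (hsm v (hvw.ne_zero 0) ?_).2 (map_zero _)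
    rw [eval_linForm, hv]
  have hB : B.IsHomogeneous (2 + 1) :=
    isHomogeneous_right_of_mul (m := 1) hg hd (mul_ne_zero hh.ne_zero hB0)
  obtain ⟨s, t, h1, h2⟩ := exists_eval_eq_zero_on_line hB hvw
  refine (hsm _ h1 ?_).2 h2
  rw [eval_linForm, dotProduct_add, dotProduct_smul, dotProduct_smul, hv, hw]
  simp

end Coprime

end QuarticMonoid

open MvPolynomial

namespace QuarticMonoid

/-! ### The triple system of trisecants. -/

section Trisecants

variable {k : Type*} [Field k] {ι : Type*} {p : ι → Fin 3 → k}

lemma exists_smul_of_not_linearIndependent {n : ℕ} {v w : Fin n → k} (hv : v ≠ 0)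
    (h : ¬ LinearIndependent k ![v, w]) : ∃ r : k, w = r • v := by
  rw [LinearIndependent.pair_iff' hv] at h
  push Not at h
  obtain ⟨r, hr⟩ := h
  exact ⟨r, hr.symm⟩

open scoped Classical in
/-- The triples of points cut out on the cubic `f` by a line. -/
noncomputable def trisecants [Fintype ι] (f : MvPolynomial (Fin 3) k) (p : ι → Fin 3 → k) :
    Finset (Finset ι) :=
  Finset.univ.filter fun t => ∃ c, IsTrisecant f p c t

lemma mem_trisecants [Fintype ι] {f : MvPolynomial (Fin 3) k} {t : Finset ι} :
    t ∈ trisecants f p ↔ ∃ c, IsTrisecant f p c t := by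
  simp [trisecants]

variable [Infinite k] {f g : MvPolynomial (Fin 3) k} (hf : f.IsHomogeneous 3)
  (hp : ∀ i j, i ≠ j → LinearIndependent k ![p i, p j]) (hfp : ∀ i, eval (p i) f = 0)

include hf hp hfp

lemma IsTrisecant.mem_of_dotProduct {c : Fin 3 → k} {S : Finset ι} (hS : IsTrisecant f p c S)
    {i : ι} (hi : c ⬝ᵥ p i = 0) : i ∈ S := by
  obtain ⟨R, hR, hfR⟩ := hS.exists_eval_ne_zero
  by_contra h
  exact dotProduct_ne_zero_of_notMem hf hp hfp hS.ne_zero hR hfR hS.card_eq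
    hS.dotProduct_eq_zero h hi

lemma IsTrisecant.eq {c c' : Fin 3 → k} {S S' : Finset ι} (hS : IsTrisecant f p c S)
    (hS' : IsTrisecant f p c' S') {i j : ι} (hij : i ≠ j) (hi : c' ⬝ᵥ p i = 0)
    (hj : c' ⬝ᵥ p j = 0) (hiS : i ∈ S) (hjS : j ∈ S) : S = S' := by
  obtain ⟨r, rfl⟩ := exists_smul_of_dotProduct_eq_zero hS.ne_zero (hp i j hij)
    (hS.dotProduct_eq_zero i hiS) (hS.dotProduct_eq_zero j hjS) hi hj
  refine Finset.eq_of_subset_of_card_le (fun l hl => hS'.mem_of_dotProduct hf hp hfp ?_)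
    (by rw [hS.card_eq, hS'.card_eq])
  rw [smul_dotProduct, hS.dotProduct_eq_zero l hl, smul_zero]

lemma isPartial_trisecants [Fintype ι] [DecidableEq ι] :
    TripleSystem.IsPartial (trisecants f p) where
  card_eq t ht := by
    obtain ⟨c, hc⟩ := mem_trisecants.1 ht
    exact hc.card_eq
  eq_of_mem s hs t ht a b hab ha hb ha' hb' := by
    obtain ⟨c, hc⟩ := mem_trisecants.1 hs
    obtain ⟨c', hc'⟩ := mem_trisecants.1 ht
    exact hc.eq hf hp hfp hc' hab (hc'.dotProduct_eq_zero a ha') (hc'.dotProduct_eq_zero b hb')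
      ha hb

variable (hg : g.IsHomogeneous 4) (hgp : ∀ i, eval (p i) g = 0)

include hg hgp

/-- A line inside the cubic carries at most four of the points, since the quartic does not vanish on
it. A trisecant meets this line in a zero of `f`, which must be one of its three points, and in only
one since the two lines differ. So the transversal bound applies, with value at most 4 · 4 = 16. -/
lemma card_trisecants_le_of_line [Fintype ι] (hι : Fintype.card ι = 12) {c : Fin 3 → k}
    (hc : c ≠ 0) (hfc : ∀ v, c ⬝ᵥ v = 0 → eval v f = 0) {R : Fin 3 → k} (hR : c ⬝ᵥ R = 0)
    (hgR : eval R g ≠ 0) : (trisecants f p).card ≤ 18 := by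
  classical
  set J : Finset ι := Finset.univ.filter fun i => c ⬝ᵥ p i = 0 with hJ
  have hJ4 : J.card ≤ 4 := by
    by_contra! h
    exact hgR (eval_eq_zero_of_card_lt (d := 3) hg hc (fun i _ j _ => hp i j) h
      (fun i hi => (Finset.mem_filter.1 hi).2) (fun i _ => hgp i) R hR)
  have h := TripleSystem.two_mul_card_le_of_transversal (isPartial_trisecants hf hp hfp) J ?_
  · rw [hι] at h
    interval_cases J.card <;> omega
  intro t ht
  obtain ⟨d, hd⟩ := mem_trisecants.1 ht
  obtain ⟨Q, hQ, hdQ, hcQ⟩ := exists_dotProduct_eq_zero d c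
  rw [dotProduct_comm] at hdQ hcQ
  obtain ⟨R', hR', hfR'⟩ := hd.exists_eval_ne_zero
  have h1 : ∃ i ∈ t, ¬ LinearIndependent k ![Q, p i] := by
    by_contra! h1
    have hQt : Q ∉ t.image p := by
      rw [Finset.mem_image]
      rintro ⟨i, hi, rfl⟩
      have := LinearIndependent.pair_iff.1 (h1 i hi) 1 (-1) (by module)
      exact one_ne_zero this.1
    refine hfR' (eval_eq_zero_of_card_lt (d := 2) (S := insert Q (t.image p)) (p := id) hf hd.ne_zero
      ?_ ?_ ?_ ?_ R' hR')
    · intro v hv w hw hvw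
      simp only [Finset.mem_insert, Finset.mem_image] at hv hw
      rcases hv with rfl | ⟨i, hi, rfl⟩ <;> rcases hw with rfl | ⟨j, hj, rfl⟩
      · exact absurd rfl hvw
      · exact h1 j hj
      · exact LinearIndependent.pair_symm_iff.1 (h1 i hi)
      · exact hp i j fun h => hvw (congrArg p h)
    · rw [Finset.card_insert_of_notMem hQt, Finset.card_image_of_injective, hd.card_eq]
      · norm_num
      · exact fun i j hij => by_contra fun h => by
          have := LinearIndependent.pair_iff.1 (hp i j h) 1 (-1) (by rw [hij]; module)
          exact one_ne_zero this.1
    · simpa [hdQ] using hd.dotProduct_eq_zero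
    · simpa [hfc Q hcQ] using fun i _ => hfp i
  obtain ⟨i, hit, hi⟩ := h1
  obtain ⟨r, hr⟩ := exists_smul_of_not_linearIndependent hQ hi
  have hiJ : i ∈ J := by simp [hJ, hr, hcQ]
  rw [Finset.card_eq_one]
  refine ⟨i, Finset.eq_singleton_iff_unique_mem.2 ⟨Finset.mem_inter.2 ⟨hit, hiJ⟩, fun j hj => ?_⟩⟩
  obtain ⟨hjt, hjJ⟩ := Finset.mem_inter.1 hj
  by_contra hji
  obtain ⟨r, rfl⟩ := exists_smul_of_dotProduct_eq_zero hc (hp j i hji) (Finset.mem_filter.1 hjJ).2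
    (Finset.mem_filter.1 hiJ).2 (hd.dotProduct_eq_zero j hjt) (hd.dotProduct_eq_zero i hit)
  have hr0 : r ≠ 0 := by
    rintro rfl
    exact hd.ne_zero (zero_smul _ _)
  rw [smul_dotProduct, smul_eq_zero_iff_right hr0] at hR'
  exact hfR' (hfc _ hR')

/-- The three trisecants a, b, c give g = l f + a b c m. At the remaining points f vanishes and a,
b, c do not, so m vanishes there; m is not zero because g is not a linear multiple of f. -/
lemma compl_mem_trisecants [Fintype ι] [DecidableEq ι] (hι : Fintype.card ι = 12)
    (hline : ∀ c : Fin 3 → k, c ≠ 0 → ∃ R, c ⬝ᵥ R = 0 ∧ eval R f ≠ 0)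
    (hgf : ∀ l, g ≠ linForm l * f) {s t u : Finset ι} (hs : s ∈ trisecants f p)
    (ht : t ∈ trisecants f p) (hu : u ∈ trisecants f p) (hst : Disjoint s t) (hus : Disjoint u s)
    (hut : Disjoint u t) : (s ∪ t ∪ u)ᶜ ∈ trisecants f p := by
  obtain ⟨a, ha⟩ := mem_trisecants.1 hs
  obtain ⟨b, hb⟩ := mem_trisecants.1 ht
  obtain ⟨c, hc⟩ := mem_trisecants.1 hu
  obtain ⟨l, m, hgm⟩ := exists_eq_add_of_isTrisecant hf hg hp hfp ha hb hc hst hus.symm hut.symm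
    (fun i _ => hgp i) (fun i _ => hgp i) fun i _ => hgp i
  have hm : m ≠ 0 := by
    rintro rfl
    exact hgf l (by simp [hgm, linForm])
  refine mem_trisecants.2 ⟨m, ?_, hm, ?_, hline m hm⟩
  · rw [Finset.card_compl, Finset.card_union_of_disjoint, Finset.card_union_of_disjoint hst, hι,
      ha.card_eq, hb.card_eq, hc.card_eq]
    rw [Finset.disjoint_union_left]
    exact ⟨hus.symm, hut.symm⟩
  · intro i hi
    simp only [Finset.mem_compl, Finset.mem_union, not_or] at hi
    have h := hgp i
    rw [hgm] at h
    simp only [map_add, map_mul, hfp, mul_zero, zero_add, eval_linForm] at h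
    have h1 := mt (ha.mem_of_dotProduct hf hp hfp) hi.1.1
    have h2 := mt (hb.mem_of_dotProduct hf hp hfp) hi.1.2
    have h3 := mt (hc.mem_of_dotProduct hf hp hfp) hi.2
    simpa [h1, h2, h3] using h

/-- Twelve points of intersection of a cubic and a quartic have at most 19 trisecants, and if there
are 19 then their incidences are those of a fixed model. -/
theorem card_trisecants_le [Fintype ι] [DecidableEq ι] (hι : Fintype.card ι = 12)
    (hfg : ∀ c : Fin 3 → k, c ≠ 0 → ∃ R, c ⬝ᵥ R = 0 ∧ (eval R f ≠ 0 ∨ eval R g ≠ 0))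
    (hgf : ∀ l, g ≠ linForm l * f) :
    (trisecants f p).card ≤ 19 ∧ ((trisecants f p).card = 19 →
      (∀ c : Fin 3 → k, c ≠ 0 → ∃ R, c ⬝ᵥ R = 0 ∧ eval R f ≠ 0) ∧
      ∃ e : Fin 12 → ι, Function.Injective e ∧
        ∀ l ∈ TripleSystem.model, TripleSystem.rel (trisecants f p) e l.1 l.2.1 l.2.2) := by
  by_cases hline : ∀ c : Fin 3 → k, c ≠ 0 → ∃ R, c ⬝ᵥ R = 0 ∧ eval R f ≠ 0
  · have hT := isPartial_trisecants hf hp hfp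
    have h := fun h19 => TripleSystem.exists_labelling hT hι
      (fun s hs t ht u hu => compl_mem_trisecants hf hp hfp hg hgp hι hline hgf hs ht hu) h19
    constructor
    · by_contra! h19
      have := (h h19.le).1
      omega
    · exact fun h19 => ⟨hline, (h h19.ge).2⟩
  · push Not at hline
    obtain ⟨c, hc, hfc⟩ := hline
    obtain ⟨R, hR, h⟩ := hfg c hc
    have := card_trisecants_le_of_line hf hp hfp hg hgp hι hc hfc hR
      (h.resolve_left fun h => h (hfc R hR))
    omega

end Trisecants

end QuarticMonoid

open MvPolynomial

namespace QuarticMonoid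

/-! ### Monoid equations and their common plane zeros. -/

section ZeroSet

variable {k : Type*} [Field k]

/-- The quartic form `t f + g`. -/
noncomputable def monoidForm (f g : MvPolynomial (Fin 3) k) : Poly4 k :=
  X 3 * rename Fin.castSucc f + rename Fin.castSucc g

lemma eval_monoidForm (f g : MvPolynomial (Fin 3) k) (x : Fin 4 → k) :
    eval x (monoidForm f g) = x 3 * eval (x ∘ Fin.castSucc) f + eval (x ∘ Fin.castSucc) g := by
  simp [monoidForm, eval_rename]

/-- A set of representatives of the common zeros of `f` and `g` in the projective plane. -/
structure IsZeroSet (f g : MvPolynomial (Fin 3) k) (Z : Finset (Fin 3 → k)) : Prop where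
  linearIndependent : ∀ v ∈ Z, ∀ w ∈ Z, v ≠ w → LinearIndependent k ![v, w]
  ne_zero : ∀ v ∈ Z, v ≠ 0
  eval_left : ∀ v ∈ Z, eval v f = 0
  eval_right : ∀ v ∈ Z, eval v g = 0
  exists_smul : ∀ v ≠ 0, eval v f = 0 → eval v g = 0 → ∃ z ∈ Z, ∃ r : k, v = r • z

/-- Pairwise independent common zeros are bounded in number by the Bézout estimate, so a largest set
exists, and maximality makes it represent all zeros. -/
lemma exists_isZeroSet {f g : MvPolynomial (Fin 3) k} (hf : f.IsHomogeneous 3)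
    (hg : g.IsHomogeneous 4) (hf0 : f ≠ 0) (hfg : IsRelPrime f g) :
    ∃ Z, IsZeroSet f g Z ∧ Z.card ≤ 12 := by
  classical
  let P : Finset (Fin 3 → k) → Prop := fun Z =>
    (∀ v ∈ Z, ∀ w ∈ Z, v ≠ w → LinearIndependent k ![v, w]) ∧
      ∀ v ∈ Z, v ≠ 0 ∧ eval v f = 0 ∧ eval v g = 0
  have hP : ∀ Z, P Z → Z.card ≤ 12 := fun Z hZ => card_le_of_isRelPrime hf hg hf0 hfg hZ.1
    (fun v hv => (hZ.2 v hv).2.1) fun v hv => (hZ.2 v hv).2.2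
  have hne : {n | ∃ Z, P Z ∧ Z.card = n}.Nonempty := ⟨0, ∅, by simp [P], rfl⟩
  have hbdd : BddAbove {n | ∃ Z, P Z ∧ Z.card = n} :=
    ⟨12, by rintro _ ⟨Z, hZ, rfl⟩; exact hP Z hZ⟩
  obtain ⟨Z, hZ, hcard⟩ := Nat.sSup_mem hne hbdd
  refine ⟨Z, ⟨hZ.1, fun v hv => (hZ.2 v hv).1, fun v hv => (hZ.2 v hv).2.1,
    fun v hv => (hZ.2 v hv).2.2, fun v hv hvf hvg => ?_⟩, hP Z hZ⟩
  by_contra! h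
  have h1 : ∀ z ∈ Z, LinearIndependent k ![z, v] := fun z hz => by
    by_contra h2
    obtain ⟨r, hr⟩ := exists_smul_of_not_linearIndependent (hZ.2 z hz).1 h2
    exact h z hz r hr
  have hvZ : v ∉ Z := fun hvZ => h v hvZ 1 (one_smul _ _).symm
  have h2 : P (insert v Z) := by
    refine ⟨fun x hx y hy hxy => ?_, fun x hx => ?_⟩
    · rcases Finset.mem_insert.1 hx with rfl | hx' <;>
        rcases Finset.mem_insert.1 hy with rfl | hy'
      · exact absurd rfl hxy
      · exact LinearIndependent.pair_symm_iff.1 (h1 y hy')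
      · exact h1 x hx'
      · exact hZ.1 x hx' y hy' hxy
    · rcases Finset.mem_insert.1 hx with rfl | hx
      exacts [⟨hv, hvf, hvg⟩, hZ.2 x hx]
  have h3 := le_csSup hbdd ⟨insert v Z, h2, rfl⟩
  rw [← hcard, Finset.card_insert_of_notMem hvZ] at h3
  omega

end ZeroSet

/-! ### Lines through the triple point, and graphs over plane lines. -/

section Lines

variable {k : Type*} [Field k] {f g : MvPolynomial (Fin 3) k}

lemma linearIndependent_snoc {z : Fin 3 → k} (hz : z ≠ 0) : LinearIndependent k
    ![(Pi.single 3 1 : Fin 4 → k), Fin.snoc (α := fun _ => k) z 0] := by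
  rw [LinearIndependent.pair_iff]
  intro s t h
  have ht : t = 0 := by
    obtain ⟨i, hi⟩ := Function.ne_iff.1 hz
    have h1 := congrFun h i.castSucc
    have h2 : i.castSucc ≠ (3 : Fin 4) := (Fin.castSucc_lt_last i).ne
    simp [h2] at h1
    exact h1.resolve_right hi
  subst ht
  have h1 := congrFun h 3
  simp at h1
  exact ⟨h1, rfl⟩

lemma finrank_span_snoc {z : Fin 3 → k} (hz : z ≠ 0) : Module.finrank k
    (Submodule.span k {(Pi.single 3 1 : Fin 4 → k), Fin.snoc (α := fun _ => k) z 0}) = 2 := by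
  have h2 := finrank_span_eq_card (linearIndependent_snoc hz)
  rwa [Matrix.range_cons, Matrix.range_cons, Matrix.range_empty, Set.union_empty,
    Set.singleton_union, Fintype.card_fin] at h2

lemma eq_span_of_mem {L : Submodule k (Fin 4 → k)} (hL : Module.finrank k L = 2)
    (hO : Pi.single 3 1 ∈ L) {z : Fin 3 → k} (hz : z ≠ 0)
    (hzL : (Fin.snoc (α := fun _ => k) z 0 : Fin 4 → k) ∈ L) :
    L = Submodule.span k {Pi.single 3 1, Fin.snoc (α := fun _ => k) z 0} := by
  symm
  refine Submodule.eq_of_le_of_finrank_le ?_ (by rw [finrank_span_snoc hz, hL])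
  rw [Submodule.span_le]
  rintro u (rfl | rfl)
  exacts [hO, hzL]

lemma exists_mem_comp_ne_zero {L : Submodule k (Fin 4 → k)} (hL : Module.finrank k L = 2) :
    ∃ x ∈ L, x ∘ Fin.castSucc ≠ (0 : Fin 3 → k) := by
  by_contra! h
  have h1 : L ≤ Submodule.span k {Pi.single 3 1} := by
    intro x hx
    rw [Submodule.mem_span_singleton]
    refine ⟨x 3, ?_⟩
    funext i
    refine Fin.lastCases ?_ (fun i => ?_) i
    · simp [show Fin.last 3 = 3 from rfl]
    · have h2 : i.castSucc ≠ (3 : Fin 4) := (Fin.castSucc_lt_last i).ne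
      have h3 := congrFun (h x hx) i
      simp only [Function.comp_apply, Pi.zero_apply] at h3
      simp [h2, h3]
  have h2 := Submodule.finrank_mono h1
  have h3 := finrank_span_le_card (R := k) ({Pi.single 3 1} : Set (Fin 4 → k))
  simp at h3
  omega

/-- Moving along the line towards the triple point changes only the last coordinate, so t f + g
vanishes for all t at the projected point, whence f = g = 0 there. -/
lemma exists_mem_of_line {Z : Finset (Fin 3 → k)} (hZ : IsZeroSet f g Z)
    {L : Submodule k (Fin 4 → k)} (hL : L ∈ lines (monoidForm f g))
    (hO : Pi.single 3 1 ∈ L) :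
    ∃ z ∈ Z, (Fin.snoc (α := fun _ => k) z 0 : Fin 4 → k) ∈ L := by
  obtain ⟨hL2, hL0⟩ := hL
  obtain ⟨x, hx, hxO⟩ := exists_mem_comp_ne_zero hL2
  have h0 : ∀ s : k, (x 3 + s) * eval (x ∘ Fin.castSucc) f + eval (x ∘ Fin.castSucc) g = 0 := by
    intro s
    have h1 := hL0 (x + s • Pi.single 3 1) (L.add_mem hx (L.smul_mem s hO))
    rw [eval_monoidForm] at h1
    have h2 : (x + s • Pi.single 3 1) ∘ Fin.castSucc = x ∘ Fin.castSucc := by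
      funext i
      have h2 : i.castSucc ≠ (3 : Fin 4) := (Fin.castSucc_lt_last i).ne
      simp [h2]
    rw [h2] at h1
    simpa using h1
  have hg0 := h0 (-x 3)
  have hf0 := h0 (1 - x 3)
  simp only [add_neg_cancel, zero_mul, zero_add] at hg0
  rw [hg0] at hf0
  obtain ⟨z, hz, r, hr⟩ := hZ.exists_smul _ hxO (by simpa using hf0) hg0
  refine ⟨z, hz, ?_⟩
  have hr0 : r ≠ 0 := by
    rintro rfl
    exact hxO (by rw [hr, zero_smul])
  have h3 : (Fin.snoc (α := fun _ => k) z 0 : Fin 4 → k) =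
      r⁻¹ • (x + (-x 3) • Pi.single 3 1) := by
    funext i
    refine Fin.lastCases ?_ (fun i => ?_) i
    · rw [Fin.snoc_last]
      simp [show Fin.last 3 = 3 from rfl]
    · have h2 : i.castSucc ≠ (3 : Fin 4) := (Fin.castSucc_lt_last i).ne
      have h4 := congrFun hr i
      simp only [Function.comp_apply] at h4
      simp [h2, h4, hr0]
  rw [h3]
  exact L.smul_mem _ (L.add_mem hx (L.smul_mem _ hO))

/-- The line `L` not through the triple point is the graph of `l` over the line `c` of the plane. -/
structure IsGraph (L : Submodule k (Fin 4 → k)) (c l : Fin 3 → k) : Prop where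
  ne_zero : c ≠ 0
  mem_iff : ∀ x, x ∈ L ↔ c ⬝ᵥ (x ∘ Fin.castSucc) = 0 ∧ x 3 = l ⬝ᵥ (x ∘ Fin.castSucc)

/-- Projection from the triple point is injective on `L`: the image is a plane line, on which the
last coordinate is a linear function. Its extension `l` to the plane is unique only up to multiples
of `c`. -/
lemma exists_isGraph {L : Submodule k (Fin 4 → k)} (hL : Module.finrank k L = 2)
    (hO : Pi.single 3 1 ∉ L) : ∃ c l, IsGraph L c l := by
  let b := Module.finBasisOfFinrankEq k L hL
  set x : Fin 4 → k := ((b 0 : L) : Fin 4 → k) with hx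
  set y : Fin 4 → k := ((b 1 : L) : Fin 4 → k) with hy
  have hspan : ∀ u ∈ L, ∃ s t : k, u = s • x + t • y := by
    intro u hu
    have := b.sum_repr ⟨u, hu⟩
    rw [Fin.sum_univ_two] at this
    exact ⟨_, _, (congrArg Subtype.val this).symm⟩
  have hker : ∀ u ∈ L, u ∘ Fin.castSucc = (0 : Fin 3 → k) → u = 0 := by
    intro u hu h
    have h1 : u = u 3 • Pi.single 3 1 := by
      funext i
      refine Fin.lastCases ?_ (fun i => ?_) i
      · simp [show Fin.last 3 = 3 from rfl]
      · have h2 : i.castSucc ≠ (3 : Fin 4) := (Fin.castSucc_lt_last i).ne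
        have h3 := congrFun h i
        simp only [Function.comp_apply, Pi.zero_apply] at h3
        simp [h2, h3]
    by_contra hne
    have h3 : u 3 ≠ 0 := by
      intro h3
      rw [h3, zero_smul] at h1
      exact hne h1
    apply hO
    have := L.smul_mem (u 3)⁻¹ hu
    rwa [h1, smul_smul, Pi.smul_apply, Pi.single_eq_same, smul_eq_mul, mul_one,
      inv_mul_cancel₀ h3, one_smul] at this
  have hli : LinearIndependent k ![x ∘ Fin.castSucc, y ∘ Fin.castSucc] := by
    rw [LinearIndependent.pair_iff]
    intro s t h
    have h1 := hker (s • x + t • y) (L.add_mem (L.smul_mem _ (b 0).2) (L.smul_mem _ (b 1).2)) h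
    have h2 : s • b 0 + t • b 1 = 0 := Subtype.ext h1
    have h3 := Fintype.linearIndependent_iff.1 b.linearIndependent ![s, t] (by
      rw [Fin.sum_univ_two]; exact h2)
    exact ⟨h3 0, h3 1⟩
  obtain ⟨c, hc, hcx, hcy⟩ := exists_dotProduct_eq_zero (x ∘ Fin.castSucc) (y ∘ Fin.castSucc)
  obtain ⟨d, hd, hd'⟩ := exists_dual hli
  obtain ⟨e, he, he'⟩ := exists_dual (v := y ∘ Fin.castSucc) (w := x ∘ Fin.castSucc)
    (LinearIndependent.pair_symm_iff.1 hli)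
  set l := x 3 • e + y 3 • d with hl
  have hlx : l ⬝ᵥ (x ∘ Fin.castSucc) = x 3 := by simp [hl, he', hd]
  have hly : l ⬝ᵥ (y ∘ Fin.castSucc) = y 3 := by simp [hl, he, hd']
  refine ⟨c, l, hc, fun u => ⟨fun hu => ?_, fun hu => ?_⟩⟩
  · obtain ⟨s, t, rfl⟩ := hspan u hu
    have h1 : (s • x + t • y) ∘ Fin.castSucc = s • (x ∘ Fin.castSucc) + t • (y ∘ Fin.castSucc) := rfl
    rw [h1, dotProduct_add, dotProduct_smul, dotProduct_smul, dotProduct_add, dotProduct_smul,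
      dotProduct_smul, hcx, hcy, hlx, hly]
    simp
  · obtain ⟨s, t, hst⟩ := exists_combination hc hli hcx hcy hu.1
    have h1 : u = s • x + t • y := by
      funext i
      refine Fin.lastCases ?_ (fun i => congrFun hst i) i
      rw [show Fin.last 3 = 3 from rfl, hu.2, hst, dotProduct_add, dotProduct_smul,
        dotProduct_smul, hlx, hly]
      rfl
    rw [h1]
    exact L.add_mem (L.smul_mem _ (b 0).2) (L.smul_mem _ (b 1).2)

lemma IsGraph.eval_eq_zero {L : Submodule k (Fin 4 → k)} {c l : Fin 3 → k} (hG : IsGraph L c l)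
    (hL : L ∈ lines (monoidForm f g)) {v : Fin 3 → k} (hv : c ⬝ᵥ v = 0) :
    (l ⬝ᵥ v) * eval v f + eval v g = 0 := by
  have h0 : (Fin.snoc (α := fun _ => k) v (l ⬝ᵥ v) : Fin 4 → k) ∘ Fin.castSucc = v := by
    funext i
    simp
  have h3 : (Fin.snoc (α := fun _ => k) v (l ⬝ᵥ v) : Fin 4 → k) 3 = l ⬝ᵥ v :=
    Fin.snoc_last (α := fun _ => k) _ _
  have h1 := hL.2 (Fin.snoc (α := fun _ => k) v (l ⬝ᵥ v)) ((hG.mem_iff _).2 (by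
    rw [h0, h3]; exact ⟨hv, rfl⟩))
  rwa [eval_monoidForm, h0, h3] at h1

lemma exists_eval_add_smul_ne_zero [Infinite k] {R : Fin 3 → k} (hR : eval R f ≠ 0)
    (w : Fin 3 → k) : ∃ u : k, u ≠ 0 ∧ eval (R + u • w) f ≠ 0 := by
  by_contra! h
  have : linePoly f R w = 0 :=
    Polynomial.eq_zero_of_infinite_isRoot _ (Set.Infinite.mono (s := {0}ᶜ)
      (fun u hu => by rw [Set.mem_ofPred_eq, Polynomial.IsRoot, eval_linePoly]; exact h u hu)
      (Set.finite_singleton 0).infinite_compl)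
  apply hR
  rw [← coeff_zero_linePoly f R w, this, Polynomial.coeff_zero]

lemma exists_linearIndependent_of_dotProduct {c R : Fin 3 → k} (hc : c ≠ 0) :
    ∃ w, c ⬝ᵥ w = 0 ∧ (R ≠ 0 → LinearIndependent k ![R, w]) := by
  obtain ⟨v, w, hvw, hv, hw⟩ := exists_linearIndependent_pair hc
  by_cases h : LinearIndependent k ![R, w]
  · exact ⟨w, hw, fun _ => h⟩
  refine ⟨v, hv, fun hR => ?_⟩
  obtain ⟨r, rfl⟩ := exists_smul_of_not_linearIndependent hR h
  rw [LinearIndependent.pair_iff' hR]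
  rintro a rfl
  have h1 := LinearIndependent.pair_iff.1 hvw r (-a) (by module)
  exact hvw.ne_zero 1 (by simp [h1.1])

/-- Where f ≠ 0 on the plane line, l = -g/f. Two independent such points fix l on the whole line. -/
lemma IsGraph.eq [Infinite k] {L L' : Submodule k (Fin 4 → k)} {c l l' : Fin 3 → k}
    (hL : L ∈ lines (monoidForm f g)) (hL' : L' ∈ lines (monoidForm f g)) {r : k}
    (hG : IsGraph L c l) (hG' : IsGraph L' (r • c) l')
    (hfc : ∃ R, c ⬝ᵥ R = 0 ∧ eval R f ≠ 0) (hf : f.IsHomogeneous 3) : L = L' := by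
  have hr : r ≠ 0 := by
    rintro rfl
    exact hG'.ne_zero (zero_smul _ _)
  have h0 : ∀ v, c ⬝ᵥ v = 0 → eval v f ≠ 0 → (l - l') ⬝ᵥ v = 0 := by
    intro v hv hfv
    have h1 := hG.eval_eq_zero hL hv
    have h2 := hG'.eval_eq_zero hL' (v := v) (by rw [smul_dotProduct, hv, smul_zero])
    have h3 : ((l - l') ⬝ᵥ v) * eval v f = 0 := by
      rw [sub_dotProduct]
      linear_combination h1 - h2
    exact (mul_eq_zero.1 h3).resolve_right hfv
  obtain ⟨R, hR, hfR⟩ := hfc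
  have hR0 : R ≠ 0 := by
    rintro rfl
    have := eval_smul_of_isHomogeneous hf 0 0
    rw [zero_smul] at this
    exact hfR (by simpa using this)
  obtain ⟨w, hw, hRw⟩ := exists_linearIndependent_of_dotProduct (R := R) hG.ne_zero
  obtain ⟨u, hu, hfu⟩ := exists_eval_add_smul_ne_zero hfR w
  have h4 := h0 R hR hfR
  have h5 := h0 (R + u • w) (by simp [hR, hw]) hfu
  rw [dotProduct_add, h4, zero_add, dotProduct_smul, smul_eq_mul] at h5
  have h6 := (mul_eq_zero.1 h5).resolve_left hu
  have h7 : ∀ v, c ⬝ᵥ v = 0 → l ⬝ᵥ v = l' ⬝ᵥ v := by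
    intro v hv
    obtain ⟨s, t, rfl⟩ := exists_combination hG.ne_zero (hRw hR0) hR hw hv
    rw [← sub_eq_zero, ← sub_dotProduct, dotProduct_add, dotProduct_smul, dotProduct_smul, h4, h6]
    simp
  ext x
  rw [hG.mem_iff, hG'.mem_iff, smul_dotProduct, smul_eq_zero_iff_right hr]
  refine and_congr_right fun hx => ?_
  rw [h7 _ hx]

end Lines

end QuarticMonoid

open MvPolynomial

namespace QuarticMonoid

/-! ### Tangency and singular points of the cubic. -/

section Gradient

variable {k : Type*} [Field k] {f g : MvPolynomial (Fin 3) k}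

/-- The gradient of a polynomial at a point. -/
noncomputable def grad (f : MvPolynomial (Fin 3) k) (v : Fin 3 → k) : Fin 3 → k :=
  fun i => eval v (pderiv i f)

lemma grad_smul {d : ℕ} (hf : f.IsHomogeneous d) (r : k) (v : Fin 3 → k) :
    grad f (r • v) = r ^ (d - 1) • grad f v := by
  funext i
  exact eval_smul_of_isHomogeneous hf.pderiv r v

lemma grad_dotProduct_self {d : ℕ} (hf : f.IsHomogeneous d) (v : Fin 3 → k) :
    grad f v ⬝ᵥ v = d * eval v f := by
  have h := congrArg (eval v) hf.sum_X_mul_pderiv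
  rw [map_sum] at h
  simpa [dotProduct, grad, mul_comm] using h

/-- Differentiate l f + g = 0 along the plane line at `z`; the derivative of l disappears because
f(z) = 0. -/
lemma IsGraph.grad_dotProduct [Infinite k] {L : Submodule k (Fin 4 → k)} {c l : Fin 3 → k}
    (hG : IsGraph L c l) (hL : L ∈ lines (monoidForm f g)) {z u : Fin 3 → k} (hz : c ⬝ᵥ z = 0)
    (hu : c ⬝ᵥ u = 0) (hfz : eval z f = 0) :
    (l ⬝ᵥ z) * (grad f z ⬝ᵥ u) + grad g z ⬝ᵥ u = 0 := by
  have h0 : linePoly (linForm l * f + g) z u = 0 := by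
    refine Polynomial.funext fun t => ?_
    rw [eval_linePoly, map_add, map_mul, eval_linForm, Polynomial.eval_zero]
    exact hG.eval_eq_zero hL (by simp [hz, hu])
  have h1 := coeff_one_linePoly (linForm l * f + g) z u
  rw [h0, Polynomial.coeff_zero] at h1
  simp only [map_add, Derivation.leibniz, smul_eq_mul, map_mul, eval_linForm, hfz, zero_mul,
    add_zero] at h1
  rw [h1]
  simp only [dotProduct, grad, Finset.mul_sum, ← Finset.sum_add_distrib]
  exact Finset.sum_congr rfl fun i _ => by ring

/-- A vector orthogonal to the line `c` is a multiple of `c`. -/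
lemma exists_smul_of_forall_dotProduct {c d : Fin 3 → k} (hc : c ≠ 0)
    (h : ∀ u, c ⬝ᵥ u = 0 → d ⬝ᵥ u = 0) : ∃ r : k, d = r • c := by
  obtain ⟨v, w, hvw, hv, hw⟩ := exists_linearIndependent_pair hc
  exact exists_smul_of_dotProduct_eq_zero hc hvw hv hw (h v hv) (h w hw)

/-- At a singular point of f only ∇g survives in the derivative along `c`. As smoothness makes ∇g
nonzero there, the point determines the plane line, so at most one graph lies over it. -/
lemma IsGraph.exists_grad_eq [Infinite k] {L : Submodule k (Fin 4 → k)} {c l : Fin 3 → k}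
    (hG : IsGraph L c l) (hL : L ∈ lines (monoidForm f g)) {z : Fin 3 → k} (hz : c ⬝ᵥ z = 0)
    (hfz : eval z f = 0) (hgz : grad f z = 0) : ∃ r : k, grad g z = r • c := by
  refine exists_smul_of_forall_dotProduct hG.ne_zero fun u hu => ?_
  have := hG.grad_dotProduct hL hz hu hfz
  rwa [hgz, zero_dotProduct, mul_zero, zero_add] at this

/-- A line of the surface not through the triple point whose projection contains no singular point
of `f` projects to a trisecant. -/
lemma IsGraph.exists_isTrisecant [IsAlgClosed k] (hf : f.IsHomogeneous 3)
    (hs : SmoothOff f g) {L : Submodule k (Fin 4 → k)} {c l : Fin 3 → k}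
    (hG : IsGraph L c l) (hL : L ∈ lines (monoidForm f g)) {ι : Type*} {p : ι → Fin 3 → k}
    (hp : ∀ v ≠ 0, eval v f = 0 → eval v g = 0 → grad f v ≠ 0 → ∃ i, ∃ r : k, v = r • p i)
    (hfc : ∃ R, c ⬝ᵥ R = 0 ∧ eval R f ≠ 0)
    (hc : ∀ v ≠ 0, c ⬝ᵥ v = 0 → eval v f = 0 → grad f v ≠ 0) : ∃ S, IsTrisecant f p c S := by
  classical
  have hInf : Infinite k := IsAlgClosed.instInfinite
  have hfc' := hfc
  obtain ⟨R, hR, hfR⟩ := hfc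
  have hR0 : R ≠ 0 := by
    rintro rfl
    have := eval_smul_of_isHomogeneous hf 0 0
    rw [zero_smul] at this
    exact hfR (by simpa using this)
  -- With `R` as the point at infinity and f(R) ≠ 0, the restriction has degree exactly three and no
  -- zero at infinity.
  obtain ⟨w, hw, hRw⟩ := exists_linearIndependent_of_dotProduct (R := R) hG.ne_zero
  replace hRw := hRw hR0
  set P := linePoly f w R with hP
  have hP3 : P.coeff 3 = eval R f := by
    have := eval_add_smul_of_isHomogeneous hf w R 0 1
    simpa [Finset.sum_range_succ] using this.symm
  have hP0 : P ≠ 0 := by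
    intro h
    rw [h, Polynomial.coeff_zero] at hP3
    exact hfR hP3.symm
  have hdeg : P.natDegree = 3 :=
    le_antisymm (natDegree_linePoly_le hf w R) (Polynomial.le_natDegree_of_ne_zero (by rwa [hP3]))
  have hq0 : ∀ τ : k, w + τ • R ≠ 0 := by
    intro τ h
    exact one_ne_zero (LinearIndependent.pair_iff.1 hRw τ 1 (by rw [← h]; module)).2
  have hcq : ∀ τ : k, c ⬝ᵥ (w + τ • R) = 0 := fun τ => by simp [hw, hR]
  have hroot : ∀ τ ∈ P.roots, eval (w + τ • R) f = 0 := by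
    intro τ hτ
    rw [← eval_linePoly]
    exact (Polynomial.mem_roots hP0).1 hτ
  have hgq : ∀ τ ∈ P.roots, eval (w + τ • R) g = 0 := by
    intro τ hτ
    have := hG.eval_eq_zero hL (hcq τ)
    rwa [hroot τ hτ, mul_zero, zero_add] at this
  -- At a multiple root both gradients are multiples r c and r' c of the line, and with t = -r'/r
  -- the surface is singular above this point.
  have hsimple : ∀ τ ∈ P.roots, ¬ P.derivative.IsRoot τ := by
    intro τ hτ h
    rw [Polynomial.IsRoot, derivative_linePoly, Polynomial.eval_finsetSum] at h
    simp only [Polynomial.eval_mul, Polynomial.eval_C, eval_linePoly] at h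
    set q := w + τ • R with hq
    have h1 : grad f q ⬝ᵥ R = 0 := by
      rw [← h]
      exact Finset.sum_congr rfl fun i _ => mul_comm _ _
    have h2 : grad f q ⬝ᵥ q = 0 := by
      rw [grad_dotProduct_self hf, hroot τ hτ, mul_zero]
    have h3 : ∀ u, c ⬝ᵥ u = 0 → grad f q ⬝ᵥ u = 0 := by
      intro u hu
      obtain ⟨s, t, rfl⟩ := exists_combination hG.ne_zero hRw hR hw hu
      have : s • R + t • w = (s - t * τ) • R + t • q := by rw [hq]; module
      rw [this, dotProduct_add, dotProduct_smul, dotProduct_smul, h1, h2]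
      simp
    obtain ⟨r, hr⟩ := exists_smul_of_forall_dotProduct hG.ne_zero h3
    obtain ⟨r', hr'⟩ := exists_smul_of_forall_dotProduct (d := grad g q) hG.ne_zero fun u hu => by
      have := hG.grad_dotProduct hL (hcq τ) hu (hroot τ hτ)
      rwa [← hq, h3 u hu, mul_zero, zero_add] at this
    have hr0 : r ≠ 0 := by
      rintro rfl
      exact hc q (hq0 τ) (hcq τ) (hroot τ hτ) (by rw [hr, zero_smul])
    obtain ⟨i, hi⟩ := hs q (hq0 τ) (hroot τ hτ) (hgq τ hτ) (-(r' / r))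
    apply hi
    have h4 := congrFun hr i
    have h5 := congrFun hr' i
    simp only [grad, Pi.smul_apply, smul_eq_mul] at h4 h5
    rw [h4, h5]
    field_simp
    ring
  have hnodup : P.roots.Nodup := by
    rw [Multiset.nodup_iff_count_le_one]
    intro τ
    rw [Polynomial.count_roots]
    by_contra! h
    obtain ⟨h1, h2⟩ := (Polynomial.one_lt_rootMultiplicity_iff_isRoot hP0).1 h
    exact hsimple τ ((Polynomial.mem_roots hP0).2 h1) h2
  have hcard : P.roots.toFinset.card = 3 := by
    rw [Multiset.toFinset_card_of_nodup hnodup, ← hdeg]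
    exact (Polynomial.splits_iff_card_roots.1 (IsAlgClosed.splits P))
  have hex : ∀ τ ∈ P.roots.toFinset, ∃ i, ∃ r : k, w + τ • R = r • p i := by
    intro τ hτ
    rw [Multiset.mem_toFinset] at hτ
    exact hp _ (hq0 τ) (hroot τ hτ) (hgq τ hτ) (hc _ (hq0 τ) (hcq τ) (hroot τ hτ))
  obtain ⟨τ₀, hτ₀⟩ := Finset.card_pos.1 (show 0 < P.roots.toFinset.card by omega)
  have : Nonempty ι := (hex τ₀ hτ₀).nonempty
  choose! i r hir using hex
  have hr0 : ∀ τ ∈ P.roots.toFinset, r τ ≠ 0 := by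
    intro τ hτ h
    have := hir τ hτ
    rw [h, zero_smul] at this
    exact hq0 τ this
  refine ⟨P.roots.toFinset.image i, ?_, hG.ne_zero, ?_, hfc'⟩
  · rw [Finset.card_image_of_injOn, hcard]
    intro τ hτ σ hσ h
    have h1 := hir τ hτ
    have h2 := hir σ hσ
    rw [show i σ = i τ from h.symm] at h2
    have h3 := LinearIndependent.pair_iff.1 hRw (r σ * τ - r τ * σ) (r σ - r τ) (by
      have : r σ • (w + τ • R) = r τ • (w + σ • R) := by rw [h1, h2]; module
      rw [← sub_eq_zero.2 this]
      module)
    have h4 : r τ = r σ := (sub_eq_zero.1 h3.2).symm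
    have h5 := h3.1
    rw [h4, ← mul_sub] at h5
    exact sub_eq_zero.1 ((mul_eq_zero.1 h5).resolve_left (hr0 σ hσ))
  · intro j hj
    obtain ⟨τ, hτ, rfl⟩ := Finset.mem_image.1 hj
    have := hcq τ
    rw [hir τ hτ, dotProduct_smul, smul_eq_mul] at this
    exact (mul_eq_zero.1 this).resolve_left (hr0 τ hτ)

end Gradient

/-! ### The bound over an algebraically closed field. -/

section Count

lemma encard_le_card_of_subsingleton {α β : Type*} {R : α → β → Prop} {s : Finset α} {S : Set β}
    (h1 : ∀ b ∈ S, ∃ a ∈ s, R a b)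
    (h2 : ∀ a ∈ s, ∀ b ∈ S, ∀ b' ∈ S, R a b → R a b' → b = b') : S.encard ≤ s.card := by
  rcases S.eq_empty_or_nonempty with rfl | ⟨b₀, hb₀⟩
  · simp
  have : Nonempty α := (h1 b₀ hb₀).nonempty
  choose! F hF hR using h1
  rw [← Set.encard_coe_eq_coe_finsetCard]
  exact Set.encard_le_encard_of_injOn (fun b hb => hF b hb) fun b hb b' hb' h =>
    h2 (F b) (hF b hb) b hb b' hb' (hR b hb) (h ▸ hR b' hb')

variable {k : Type*} [Field k] [IsAlgClosed k] {f g : MvPolynomial (Fin 3) k}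

open scoped Classical in
-- There are three kinds of lines: those through the triple point, encoded by common zeros; graphs
-- over a plane line through a singular point of f, where ∇g recovers the plane line; all other
-- graphs, which lie over trisecants.
lemma encard_lines_le_add (hf : f.IsHomogeneous 3) (hs : SmoothOff f g)
    (hfg : IsRelPrime f g) {Z : Finset (Fin 3 → k)} (hZ : IsZeroSet f g Z) :
    (lines (monoidForm f g)).encard ≤ Z.card + (Z.filter fun z => grad f z = 0).card +
      (trisecants f (Subtype.val : {z // z ∈ Z.filter fun z => grad f z ≠ 0} → Fin 3 → k)).card := by
  have hInf : Infinite k := IsAlgClosed.instInfinite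
  have hline : ∀ L ∈ lines (monoidForm f g), ∀ c l, IsGraph L c l →
      ∃ R, c ⬝ᵥ R = 0 ∧ eval R f ≠ 0 := by
    intro L hL c l hG
    by_contra! h
    have h1 := hfg (linForm_dvd hG.ne_zero h) (linForm_dvd hG.ne_zero fun v hv => by
      have := hG.eval_eq_zero hL hv
      rwa [h v hv, mul_zero, zero_add] at this)
    have h2 := h1.map (eval (0 : Fin 3 → k))
    rw [eval_linForm, dotProduct_zero] at h2
    exact not_isUnit_zero h2
  set ι := {z // z ∈ Z.filter fun z => grad f z ≠ 0} with hι
  set p : ι → Fin 3 → k := Subtype.val with hp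
  set A := {L | L ∈ lines (monoidForm f g) ∧ Pi.single 3 1 ∈ L} with hA
  set B := {L | L ∈ lines (monoidForm f g) ∧ ∃ z ∈ Z.filter (fun z => grad f z = 0),
    ∃ c l, IsGraph L c l ∧ ∃ r : k, grad g z = r • c} with hB
  set D := {L | L ∈ lines (monoidForm f g) ∧ ∃ t ∈ trisecants f p,
    ∃ c l, IsGraph L c l ∧ ∀ i ∈ t, c ⬝ᵥ p i = 0} with hD
  have hsub : lines (monoidForm f g) ⊆ A ∪ B ∪ D := by
    intro L hL
    by_cases hO : Pi.single 3 1 ∈ L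
    · exact Or.inl (Or.inl ⟨hL, hO⟩)
    obtain ⟨c, l, hG⟩ := exists_isGraph hL.1 hO
    by_cases hsing : ∃ v ≠ 0, c ⬝ᵥ v = 0 ∧ eval v f = 0 ∧ grad f v = 0
    · obtain ⟨v, hv0, hv, hfv, hgv⟩ := hsing
      have hgv' := hG.eval_eq_zero hL hv
      rw [hfv, mul_zero, zero_add] at hgv'
      obtain ⟨z, hz, r, rfl⟩ := hZ.exists_smul v hv0 hfv hgv'
      have hr : r ≠ 0 := by
        rintro rfl
        exact hv0 (zero_smul _ _)
      rw [grad_smul hf, smul_eq_zero_iff_right (pow_ne_zero _ hr)] at hgv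
      rw [dotProduct_smul, smul_eq_zero_iff_right hr] at hv
      exact Or.inl (Or.inr ⟨hL, z, Finset.mem_filter.2 ⟨hz, hgv⟩, c, l, hG,
        hG.exists_grad_eq hL hv (hZ.eval_left z hz) hgv⟩)
    · push Not at hsing
      obtain ⟨S, hS⟩ := hG.exists_isTrisecant hf hs hL (p := p) (fun v hv hfv hgv hgrad => by
        obtain ⟨z, hz, r, rfl⟩ := hZ.exists_smul v hv hfv hgv
        refine ⟨⟨z, Finset.mem_filter.2 ⟨hz, fun h => hgrad ?_⟩⟩, r, rfl⟩
        rw [grad_smul hf, h, smul_zero]) (hline L hL c l hG) hsing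
      exact Or.inr ⟨hL, S, mem_trisecants.2 ⟨c, hS⟩, c, l, hG, hS.dotProduct_eq_zero⟩
  have hAcard : A.encard ≤ Z.card := by
    refine encard_le_card_of_subsingleton
      (R := fun z L => (Fin.snoc (α := fun _ => k) z 0 : Fin 4 → k) ∈ L) ?_ ?_
    · rintro L ⟨hL, hO⟩
      exact exists_mem_of_line hZ hL hO
    · rintro z hz L ⟨hL, hO⟩ L' ⟨hL', hO'⟩ hzL hzL'
      rw [eq_span_of_mem hL.1 hO (hZ.ne_zero z hz) hzL, eq_span_of_mem hL'.1 hO' (hZ.ne_zero z hz) hzL']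
  have hBcard : B.encard ≤ (Z.filter fun z => grad f z = 0).card := by
    refine encard_le_card_of_subsingleton (R := fun z L =>
      ∃ c l, IsGraph L c l ∧ ∃ r : k, grad g z = r • c) (fun L hL => hL.2) ?_
    rintro z hz L ⟨hL, -⟩ L' ⟨hL', -⟩ ⟨c, l, hG, r, hr⟩ ⟨c', l', hG', r', hr'⟩
    obtain ⟨hz, hz0⟩ := Finset.mem_filter.1 hz
    have hr0 : r' ≠ 0 := by
      rintro rfl
      obtain ⟨i, hi⟩ := hs z (hZ.ne_zero z hz) (hZ.eval_left z hz) (hZ.eval_right z hz) 0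
      apply hi
      have := congrFun hr' i
      simp only [grad, Pi.smul_apply, zero_smul] at this
      rw [this]
      simp
    have h1 : c' = (r'⁻¹ * r) • c := by
      rw [mul_smul, ← hr, hr', smul_smul, inv_mul_cancel₀ hr0, one_smul]
    subst h1
    exact hG.eq hL hL' hG' (hline L hL c l hG) hf
  have hDcard : D.encard ≤ (trisecants f p).card := by
    refine encard_le_card_of_subsingleton (R := fun t L =>
      ∃ c l, IsGraph L c l ∧ ∀ i ∈ t, c ⬝ᵥ p i = 0) (fun L hL => hL.2) ?_
    rintro t ht L ⟨hL, -⟩ L' ⟨hL', -⟩ ⟨c, l, hG, hc⟩ ⟨c', l', hG', hc'⟩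
    obtain ⟨d, hd⟩ := mem_trisecants.1 ht
    obtain ⟨i, hi, j, hj, hij⟩ := Finset.one_lt_card.1 (show 1 < t.card by
      rw [hd.card_eq]; norm_num)
    have hZij := hZ.linearIndependent (p i) (Finset.mem_of_mem_filter _ i.2) (p j)
      (Finset.mem_of_mem_filter _ j.2) fun h => hij (Subtype.ext h)
    obtain ⟨r, rfl⟩ := exists_smul_of_dotProduct_eq_zero hG.ne_zero hZij (hc i hi) (hc j hj)
      (hc' i hi) (hc' j hj)
    exact hG.eq hL hL' hG' (hline L hL c l hG) hf
  calc (lines (monoidForm f g)).encard ≤ (A ∪ B ∪ D).encard := Set.encard_le_encard hsub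
    _ ≤ A.encard + B.encard + D.encard :=
      (Set.encard_union_le _ _).trans (add_le_add_left (Set.encard_union_le _ _) _)
    _ ≤ _ := add_le_add (add_le_add hAcard hBcard) hDcard

/-- The lines on a quartic monoid over an algebraically closed field. -/
theorem encard_lines_le (hf : f.IsHomogeneous 3) (hg : g.IsHomogeneous 4) (hf0 : f ≠ 0)
    (hs : SmoothOff f g) :
    (lines (monoidForm f g)).encard ≤ 31 ∧ ((lines (monoidForm f g)).encard = 31 →
      ∃ e : Fin 12 → Fin 3 → k, (∀ i j, i ≠ j → LinearIndependent k ![e i, e j]) ∧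
        (∀ i, eval (e i) f = 0) ∧ (∀ i, eval (e i) g = 0) ∧
        (∀ c : Fin 3 → k, c ≠ 0 → ∃ R, c ⬝ᵥ R = 0 ∧ eval R f ≠ 0) ∧
        ∀ l ∈ TripleSystem.model, ∃ c : Fin 3 → k, c ≠ 0 ∧ c ⬝ᵥ e l.1 = 0 ∧ c ⬝ᵥ e l.2.1 = 0 ∧
          c ⬝ᵥ e l.2.2 = 0) := by
  classical
  have hInf : Infinite k := IsAlgClosed.instInfinite
  have hfg := isRelPrime_of_smoothOff hf hg hf0 hs
  obtain ⟨Z, hZ, hZ12⟩ := exists_isZeroSet hf hg hf0 hfg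
  have hle := encard_lines_le_add hf hs hfg hZ
  have hsplit := Finset.card_filter_add_card_filter_not (s := Z) (fun z => grad f z = 0)
  set ι := {z // z ∈ Z.filter fun z => grad f z ≠ 0} with hι
  set p : ι → Fin 3 → k := Subtype.val with hp
  have hcardι : Fintype.card ι = (Z.filter fun z => grad f z ≠ 0).card := Fintype.card_coe _
  have hpi : ∀ i j, i ≠ j → LinearIndependent k ![p i, p j] := fun i j hij =>
    hZ.linearIndependent _ (Finset.mem_of_mem_filter _ i.2) _ (Finset.mem_of_mem_filter _ j.2)
      fun h => hij (Subtype.ext h)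
  have hpf : ∀ i, eval (p i) f = 0 := fun i => hZ.eval_left _ (Finset.mem_of_mem_filter _ i.2)
  have hpg : ∀ i, eval (p i) g = 0 := fun i => hZ.eval_right _ (Finset.mem_of_mem_filter _ i.2)
  have hT := isPartial_trisecants hf hpi hpf
  have h3 := TripleSystem.three_mul_card_le hT
  have h11 := TripleSystem.card_le_of_card_eq_eleven hT
  have h12 : Fintype.card ι = 12 → _ := fun h => card_trisecants_le hf hpi hpf hg hpg h
    (fun c hc => by
      by_contra! h
      have h1 := hfg (linForm_dvd hc fun v hv => (h v hv).1) (linForm_dvd hc fun v hv => (h v hv).2)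
      have h2 := h1.map (eval (0 : Fin 3 → k))
      rw [eval_linForm, dotProduct_zero] at h2
      exact not_isUnit_zero h2)
    (fun l hl => by
      have h1 := hfg dvd_rfl (Dvd.intro_left _ hl.symm)
      have h2 := h1.map (eval (0 : Fin 3 → k))
      have h3 := eval_smul_of_isHomogeneous hf 0 0
      rw [zero_smul, zero_pow (by norm_num), zero_mul] at h3
      rw [h3] at h2
      exact not_isUnit_zero h2)
  generalize hm : (Z.filter fun z => ¬ grad f z = 0).card = m at hsplit hcardι
  generalize hσ : (Z.filter fun z => grad f z = 0).card = σ at hsplit hle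
  rw [hcardι] at h3 h11 h12
  -- With m smooth and σ singular zeros the bound is m + 2σ + T, where m + σ ≤ 12. For m = 12 it is
  -- 12 + 19, for m = 11 at most 11 + 2 + 17 = 30, and for smaller m the estimate 3T ≤ m⌊(m - 1)/2⌋
  -- stays below 31.
  have hnum : Z.card + σ + (trisecants f p).card ≤ 31 ∧
      (Z.card + σ + (trisecants f p).card = 31 → m = 12 ∧ (trisecants f p).card = 19) := by
    have h12' : m = 12 → (trisecants f p).card ≤ 19 := fun h => (h12 h).1
    clear h12 hle
    have hm12 : m ≤ 12 := by omega
    generalize (trisecants f p).card = T at *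
    interval_cases m <;> norm_num at h3 h11 h12' ⊢ <;> omega
  constructor
  · refine hle.trans ?_
    exact_mod_cast hnum.1
  · intro h31
    rw [h31] at hle
    obtain ⟨rfl, hT19⟩ := hnum.2 (le_antisymm hnum.1 (by exact_mod_cast hle))
    obtain ⟨hline, e, he, hmodel⟩ := (h12 rfl).2 hT19
    refine ⟨p ∘ e, fun i j hij => hpi _ _ (he.ne hij), fun i => hpf _, fun i => hpg _, hline,
      fun l hl => ?_⟩
    obtain ⟨c, hc⟩ := mem_trisecants.1 (hmodel l hl)
    exact ⟨c, hc.ne_zero, hc.dotProduct_eq_zero _ (by simp), hc.dotProduct_eq_zero _ (by simp),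
      hc.dotProduct_eq_zero _ (by simp)⟩

end Count

end QuarticMonoid

open MvPolynomial

namespace QuarticMonoid

/-! ### Linear substitutions, projective equivalence and removal of `b`. -/

section LinSubst

variable {K : Type*} [Field K] {σ τ : Type*} [Fintype τ]

/-- The polynomial obtained from `f` by a linear substitution. -/
noncomputable def linSubst (M : Matrix σ τ K) (f : MvPolynomial σ K) : MvPolynomial τ K :=
  bind₁ (fun i => ∑ j, C (M i j) * X j) f

lemma eval_linSubst (M : Matrix σ τ K) (f : MvPolynomial σ K) (v : τ → K) :
    eval v (linSubst M f) = eval (Matrix.mulVec M v) f := by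
  have h : eval v (linSubst M f) = eval (fun i => eval v (∑ j, C (M i j) * X j)) f :=
    eval₂Hom_bind₁ _ _ _ _
  rw [h]
  congr 2
  funext i
  simp [Matrix.mulVec, dotProduct]

lemma IsHomogeneous.linSubst (M : Matrix σ τ K) {f : MvPolynomial σ K} {d : ℕ}
    (hf : f.IsHomogeneous d) : (linSubst M f).IsHomogeneous d := by
  have := hf.aeval (fun i => ∑ j, C (M i j) * X j) (n := 1) fun i =>
    isHomogeneous_linForm (M i)
  rwa [one_mul] at this

lemma eval_changeCoord (M : Matrix (Fin 4) (Fin 4) K) (F : Poly4 K) (v : Fin 4 → K) :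
    eval v (changeCoord M F) = eval (Matrix.mulVec M v) F :=
  eval_linSubst M F v

end LinSubst

section ProjEquiv

variable {K : Type*} [Field K] [Infinite K]

lemma projEquiv_of_eval {F G : Poly4 K} (M : Matrix (Fin 4) (Fin 4) K) (hM : M.det ≠ 0) {c : K}
    (hc : c ≠ 0) (h : ∀ v, eval (Matrix.mulVec M v) F = c * eval v G) : ProjEquiv F G := by
  refine ⟨Matrix.GeneralLinearGroup.mkOfDetNeZero M hM, c, hc, ?_⟩
  apply MvPolynomial.funext
  intro v
  rw [eval_changeCoord, map_mul, eval_C]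
  exact h v

lemma ProjEquiv.trans {F G H : Poly4 K} (h1 : ProjEquiv F G) (h2 : ProjEquiv G H) :
    ProjEquiv F H := by
  obtain ⟨M, c, hc, h1⟩ := h1
  obtain ⟨N, d, hd, h2⟩ := h2
  refine ⟨M * N, c * d, mul_ne_zero hc hd, ?_⟩
  apply MvPolynomial.funext
  intro v
  have h1 := congrArg (eval (Matrix.mulVec N.1 v)) h1
  have h2 := congrArg (eval v) h2
  rw [eval_changeCoord, map_mul, eval_C] at h1 h2 ⊢
  rw [Units.val_mul, ← Matrix.mulVec_mulVec, h1, h2]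
  ring

end ProjEquiv

section Normalise

variable {K : Type*} [Field K]

lemma eval_F3 (a : K) (v : Fin 4 → K) : eval v (F3 a) =
    (a - 1) * v 0 ^ 3 + (2 * a ^ 2 + 6 * a - 1) * v 0 ^ 2 * v 1 - 3 * (a - 1) * v 0 ^ 2 * v 2
    + (a ^ 2 + 4 * a + 1) * v 0 * v 1 ^ 2 + 2 * (a - 1) * v 0 * v 2 ^ 2
    - 2 * a * (a + 4) * v 0 * v 1 * v 2 + (a + 1) * v 1 ^ 3
    - 3 * (a + 1) * v 1 ^ 2 * v 2 + 2 * (a + 1) * v 1 * v 2 ^ 2 := by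
  simp [F3]

lemma eval_F4 (a : K) (v : Fin 4 → K) : eval v (F4 a) =
    v 1 * (3 * a * v 0 - 2 * a * v 2 + v 0 - v 1)
    * (2 * a * v 0 + a * v 1 - 2 * a * v 2 + 3 * v 0 + v 1 - 2 * v 2)
    * (a * v 0 + 2 * v 0 + 2 * v 1 - 2 * v 2) := by
  simp [F4]

lemma eval_Qab (a b : K) (v : Fin 4 → K) :
    eval v (Qab a b) = v 3 * eval v (F3 a) + b * eval v (F4 a) := by
  simp [Qab]

lemma eval_Q (a : K) (v : Fin 4 → K) : eval v (Q a) =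
    2 * a * v 0 ^ 3 * v 1 + 4 * a * v 0 ^ 2 * v 1 ^ 2 + 2 * a * v 0 * v 1 ^ 3
    - (2 * a - 1) * (a - 2) * v 0 ^ 3 * v 2
    - (5 * a ^ 2 - 17 * a + 5) * v 0 ^ 2 * v 1 * v 2
    - 3 * (a ^ 2 - 4 * a + 1) * v 0 * v 1 ^ 2 * v 2 + a * v 1 ^ 3 * v 2
    - 3 * (2 * a - 1) * (a - 2) * v 0 ^ 2 * v 2 ^ 2
    - (7 * a ^ 2 - 19 * a + 7) * v 0 * v 1 * v 2 ^ 2 + 2 * a * v 1 ^ 2 * v 2 ^ 2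
    - 2 * (2 * a - 1) * (a - 2) * v 0 * v 2 ^ 3 + a * v 1 * v 2 ^ 3
    - 2 * a * v 3 * v 0 ^ 2 * v 1 - 2 * a * v 3 * v 0 * v 1 ^ 2
    + 2 * (2 * a - 1) * (a - 2) * v 3 * v 0 ^ 2 * v 2
    + 4 * (a ^ 2 - 3 * a + 1) * v 3 * v 0 * v 1 * v 2 - 2 * a * v 3 * v 1 ^ 2 * v 2
    + 2 * (2 * a - 1) * (a - 2) * v 3 * v 0 * v 2 ^ 2 - 2 * a * v 3 * v 1 * v 2 ^ 2 := by
  simp [Q]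

/-- The parameter `b` can be normalised away. -/
theorem projEquiv_Qab_Q [CharZero K] {a b : K} (h0 : a ≠ 0) (h1 : a ≠ 1) (h2 : a ≠ -1) (hb : b ≠ 0) :
    ProjEquiv (Qab a b) (Q (-a)) := by
  have h1' : a - 1 ≠ 0 := sub_ne_zero.2 h1
  have h2' : a + 1 ≠ 0 := fun h => h2 (eq_neg_of_add_eq_zero_left h)
  -- Only the last row involves `b`, as a common factor: once t is a multiple of b, the form t F₃ +
  -- b F₄ is b times a form free of b.
  refine projEquiv_of_eval !![-2, 0, 2 * a, 0; 2 * (a - 1), 0, 0, 0; -4, -a, a, 0;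
    b * (4 * a ^ 2), b * (4 * a * (a + 1)), b * (4 * a * (a + 1)), -(b * (8 * a * (a + 1)))]
    ?_ (c := -16 * a ^ 3 * (a + 1) * (a - 1) * b) ?_ fun v => ?_
  · have : Matrix.det !![-2, 0, 2 * a, 0; 2 * (a - 1), 0, 0, 0; -4, -a, a, 0;
        b * (4 * a ^ 2), b * (4 * a * (a + 1)), b * (4 * a * (a + 1)), -(b * (8 * a * (a + 1)))] =
        32 * (b * a ^ 3 * (a - 1) * (a + 1)) := by
      simp [Matrix.det_succ_row_zero, Fin.sum_univ_succ, Fin.succAbove]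
      ring
    rw [this]
    simp [hb, h0, h1', h2']
  · simp [hb, h0, h1', h2']
  · rw [eval_Qab, eval_F3, eval_F4, eval_Q]
    simp only [Matrix.mulVec, dotProduct, Fin.sum_univ_four, Matrix.of_apply, Matrix.cons_val]
    ring

end Normalise

end QuarticMonoid

open MvPolynomial

namespace QuarticMonoid

/-! ### Coordinates for the model configuration. -/

section NormalForm

variable {K : Type*} [Field K]

/-- Twelve points with the incidences of the model configuration. -/
structure IsModel (q : Fin 12 → Fin 3 → K) : Prop where
  linearIndependent : ∀ i j, i ≠ j → LinearIndependent K ![q i, q j]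
  exists_line : ∀ l ∈ TripleSystem.model, ∃ c : Fin 3 → K, c ⬝ᵥ q l.1 = 0 ∧ c ⬝ᵥ q l.2.1 = 0 ∧
    c ⬝ᵥ q l.2.2 = 0 ∧ ∀ m, m ≠ l.1 → m ≠ l.2.1 → m ≠ l.2.2 → c ⬝ᵥ q m ≠ 0

/-- Standard coordinates for the points of the model configuration. -/
def modelPoint (a : K) : Fin 12 → Fin 3 → K :=
  ![![2, 0, 1], ![0, 2, 1], ![2, 2 - 2 * a, 4 - a], ![2 * a + 2, 2, 3 * a + 4], ![1, 1 - a, 2],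
    ![a + 1, 1, a + 2], ![1, 0, 1], ![0, 1, 1], ![2 * a + 2, 2 - 2 * a, a + 4], ![2, 2, a + 4],
    ![0, 0, 1], ![2, 2, 3]]

/-- The point of intersection of two different lines. -/
lemma exists_smul_of_incident {c d X M P Q R S U : Fin 3 → K} (hcX : c ⬝ᵥ X = 0)
    (hdX : d ⬝ᵥ X = 0) (hX : X ≠ 0) (hM : M ≠ 0) (hcP : c ⬝ᵥ P = 0) (hcQ : c ⬝ᵥ Q = 0)
    (hdR : d ⬝ᵥ R = 0) (hdS : d ⬝ᵥ S = 0) (hcR : c ⬝ᵥ R ≠ 0) (hd : d ⬝ᵥ U ≠ 0)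
    {α β γ δ : K} (h1 : M = α • P + β • Q) (h2 : M = γ • R + δ • S) :
    ∃ t : K, t ≠ 0 ∧ X = t • M := by
  have hcM : c ⬝ᵥ M = 0 := by simp [h1, hcP, hcQ]
  have hdM : d ⬝ᵥ M = 0 := by simp [h2, hdR, hdS]
  have hc0 : c ≠ 0 := by
    rintro rfl
    exact hcR (zero_dotProduct _)
  have hli : ¬ LinearIndependent K ![M, X] := by
    intro hli
    obtain ⟨s, rfl⟩ := exists_smul_of_dotProduct_eq_zero hc0 hli hcM hcX hdM hdX
    rw [smul_dotProduct, smul_eq_mul] at hdR hd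
    rw [(mul_eq_zero.1 hdR).resolve_right hcR, zero_mul] at hd
    exact hd rfl
  obtain ⟨t, ht⟩ := exists_smul_of_not_linearIndependent hM hli
  refine ⟨t, ?_, ht⟩
  rintro rfl
  exact hX (by rw [ht, zero_smul])

variable {q : Fin 12 → Fin 3 → K}

lemma IsModel.ne_zero (hq : IsModel q) (i : Fin 12) : q i ≠ 0 := by
  obtain ⟨j, hj⟩ : ∃ j : Fin 12, i ≠ j := ⟨i + 1, by revert i; decide⟩
  exact (hq.linearIndependent i j hj).ne_zero 0

/-- The model configuration in coordinates in which four of the points are normalised. -/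
lemma IsModel.exists_eq_modelPoint [CharZero K] (hq : IsModel q)
    (h6 : ∃ t : K, t ≠ 0 ∧ q 6 = t • ![1, 0, 1]) (h7 : ∃ t : K, t ≠ 0 ∧ q 7 = t • ![0, 1, 1])
    (h10 : ∃ t : K, t ≠ 0 ∧ q 10 = t • ![0, 0, 1])
    (h11 : ∃ t : K, t ≠ 0 ∧ q 11 = t • ![2, 2, 3]) :
    ∃ a : K, a ∉ ({-2, -1, -1 / 2, 0, 1} : Set K) ∧
      ∀ i, ∃ t : K, t ≠ 0 ∧ q i = t • modelPoint a i := by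
  have key : ∀ {c M X : Fin 3 → K}, (∃ t : K, t ≠ 0 ∧ X = t • M) → (c ⬝ᵥ X = 0 ↔ c ⬝ᵥ M = 0) := by
    rintro c M X ⟨t, ht, rfl⟩
    rw [dotProduct_smul, smul_eq_zero_iff_right ht]
  obtain ⟨A, hA0, hA6, hA10, hA⟩ := hq.exists_line (0, 6, 10) (by simp [TripleSystem.model])
  obtain ⟨B, hB0, hB7, hB11, hB⟩ := hq.exists_line (0, 7, 11) (by simp [TripleSystem.model])
  obtain ⟨D, hD9, hD10, hD11, hD⟩ := hq.exists_line (9, 10, 11) (by simp [TripleSystem.model])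
  obtain ⟨E, hE5, hE6, hE7, hE⟩ := hq.exists_line (5, 6, 7) (by simp [TripleSystem.model])
  obtain ⟨F, hF0, hF5, hF9, hF⟩ := hq.exists_line (0, 5, 9) (by simp [TripleSystem.model])
  obtain ⟨G, hG1, hG6, hG11, hG⟩ := hq.exists_line (1, 6, 11) (by simp [TripleSystem.model])
  obtain ⟨H, hH1, hH7, hH10, hH⟩ := hq.exists_line (1, 7, 10) (by simp [TripleSystem.model])
  obtain ⟨I, hI2, hI7, hI9, hI⟩ := hq.exists_line (2, 7, 9) (by simp [TripleSystem.model])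
  obtain ⟨J, hJ2, hJ5, hJ11, hJ⟩ := hq.exists_line (2, 5, 11) (by simp [TripleSystem.model])
  obtain ⟨L, hL3, hL6, hL9, hL⟩ := hq.exists_line (3, 6, 9) (by simp [TripleSystem.model])
  obtain ⟨N, hN3, hN5, hN10, hN⟩ := hq.exists_line (3, 5, 10) (by simp [TripleSystem.model])
  obtain ⟨O, hO4, hO3, hO11, hO⟩ := hq.exists_line (4, 3, 11) (by simp [TripleSystem.model])
  obtain ⟨R, hR4, hR1, hR9, hR⟩ := hq.exists_line (4, 1, 9) (by simp [TripleSystem.model])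
  obtain ⟨S, hS8, hS1, hS5, hS⟩ := hq.exists_line (8, 1, 5) (by simp [TripleSystem.model])
  obtain ⟨T, hT8, hT2, hT6, hT⟩ := hq.exists_line (8, 2, 6) (by simp [TripleSystem.model])
  dsimp only at *
  -- The position of the point 9 on the line through 10 and 11 is the only parameter. Every later
  -- point is the intersection of two lines through points already found.
  have h9 : ∃ a : K, ∃ t : K, t ≠ 0 ∧ q 9 = t • ![2, 2, a + 4] := by
    obtain ⟨s, u, h⟩ := exists_combination (c := D)
      (fun h => hD 0 (by decide) (by decide) (by decide) (by rw [h, zero_dotProduct]))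
      (hq.linearIndependent 11 10 (by decide)) hD11 hD10 hD9
    obtain ⟨t10, ht10, e10⟩ := h10
    obtain ⟨t11, ht11, e11⟩ := h11
    have hs : s ≠ 0 := by
      rintro rfl
      have := LinearIndependent.pair_iff.1 (hq.linearIndependent 9 10 (by decide)) 1 (-u) (by
        rw [h]; module)
      exact one_ne_zero this.1
    -- After division by s t₁₁ the last coordinate is 3 + u t₁₀/(s t₁₁), which is to be a + 4.
    refine ⟨u * t10 / (s * t11) - 1, s * t11, mul_ne_zero hs ht11, ?_⟩
    rw [h, e10, e11]
    funext i
    fin_cases i <;> simp <;> field_simp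
    ring
  obtain ⟨a, h9⟩ := h9
  have h0 : ∃ t : K, t ≠ 0 ∧ q 0 = t • ![2, 0, 1] :=
    exists_smul_of_incident hA0 hB0 (hq.ne_zero 0) (fun h => by simpa using congrFun h 0)
      ((key h6).1 hA6) ((key h10).1 hA10) ((key h7).1 hB7) ((key h11).1 hB11)
      ((key h7).not.1 (hA 7 (by decide) (by decide) (by decide)))
      (hB 1 (by decide) (by decide) (by decide))
      (α := 2) (β := -1) (γ := -2) (δ := 1) (by funext i; fin_cases i <;> simp; norm_num)
      (by funext i; fin_cases i <;> simp; norm_num)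
  have h5 : ∃ t : K, t ≠ 0 ∧ q 5 = t • ![a + 1, 1, a + 2] :=
    exists_smul_of_incident hE5 hF5 (hq.ne_zero 5) (fun h => by simpa using congrFun h 1)
      ((key h6).1 hE6) ((key h7).1 hE7) ((key h0).1 hF0) ((key h9).1 hF9)
      ((key h0).not.1 (hE 0 (by decide) (by decide) (by decide)))
      (hF 1 (by decide) (by decide) (by decide))
      (α := a + 1) (β := 1) (γ := a / 2) (δ := 1 / 2)
      (by funext i; fin_cases i <;> simp; ring)
      (by funext i; fin_cases i <;> simp; ring)
  have h1 : ∃ t : K, t ≠ 0 ∧ q 1 = t • ![0, 2, 1] :=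
    exists_smul_of_incident hG1 hH1 (hq.ne_zero 1) (fun h => by simpa using congrFun h 1)
      ((key h6).1 hG6) ((key h11).1 hG11) ((key h7).1 hH7) ((key h10).1 hH10)
      ((key h7).not.1 (hG 7 (by decide) (by decide) (by decide)))
      (hH 2 (by decide) (by decide) (by decide))
      (α := -2) (β := 1) (γ := 2) (δ := -1)
      (by funext i; fin_cases i <;> simp; norm_num)
      (by funext i; fin_cases i <;> simp; norm_num)
  have h2 : ∃ t : K, t ≠ 0 ∧ q 2 = t • ![2, 2 - 2 * a, 4 - a] :=
    exists_smul_of_incident hI2 hJ2 (hq.ne_zero 2) (fun h => by simpa using congrFun h 0)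
      ((key h7).1 hI7) ((key h9).1 hI9) ((key h5).1 hJ5) ((key h11).1 hJ11)
      ((key h5).not.1 (hI 5 (by decide) (by decide) (by decide)))
      (hJ 1 (by decide) (by decide) (by decide))
      (α := -2 * a) (β := 1) (γ := 2) (δ := -a)
      (by funext i; fin_cases i <;> simp <;> ring)
      (by funext i; fin_cases i <;> simp <;> ring)
  have h3 : ∃ t : K, t ≠ 0 ∧ q 3 = t • ![2 * a + 2, 2, 3 * a + 4] :=
    exists_smul_of_incident hL3 hN3 (hq.ne_zero 3) (fun h => by simpa using congrFun h 1)
      ((key h6).1 hL6) ((key h9).1 hL9) ((key h5).1 hN5) ((key h10).1 hN10)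
      ((key h5).not.1 (hL 5 (by decide) (by decide) (by decide)))
      (hN 1 (by decide) (by decide) (by decide))
      (α := 2 * a) (β := 1) (γ := 2) (δ := a)
      (by funext i; fin_cases i <;> simp; ring)
      (by funext i; fin_cases i <;> simp <;> ring)
  have h4 : ∃ t : K, t ≠ 0 ∧ q 4 = t • ![1, 1 - a, 2] :=
    exists_smul_of_incident hO4 hR4 (hq.ne_zero 4) (fun h => by simpa using congrFun h 0)
      ((key h3).1 hO3) ((key h11).1 hO11) ((key h1).1 hR1) ((key h9).1 hR9)
      ((key h1).not.1 (hO 1 (by decide) (by decide) (by decide)))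
      (hR 0 (by decide) (by decide) (by decide))
      (α := 1 / 2) (β := -a / 2) (γ := -a / 2) (δ := 1 / 2)
      (by funext i; fin_cases i <;> simp <;> ring)
      (by funext i; fin_cases i <;> simp <;> ring)
  have h8 : ∃ t : K, t ≠ 0 ∧ q 8 = t • ![2 * a + 2, 2 - 2 * a, a + 4] :=
    exists_smul_of_incident hS8 hT8 (hq.ne_zero 8) (fun h => by
        have e0 := congrFun h 0
        have e1 := congrFun h 1
        simp at e0 e1
        have : (4 : K) = 0 := by linear_combination e0 + e1
        norm_num at this)
      ((key h1).1 hS1) ((key h5).1 hS5) ((key h2).1 hT2) ((key h6).1 hT6)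
      ((key h2).not.1 (hS 2 (by decide) (by decide) (by decide)))
      (hT 0 (by decide) (by decide) (by decide))
      (α := -a) (β := 2) (γ := 1) (δ := 2 * a)
      (by funext i; fin_cases i <;> simp <;> ring)
      (by funext i; fin_cases i <;> simp <;> ring)
  refine ⟨a, ?_, ?_⟩
  · have hbad : ∀ {c : Fin 3 → K} {P Q M : Fin 3 → K} {i j m : Fin 12} (α β : K),
        (∃ t : K, t ≠ 0 ∧ q i = t • P) → (∃ t : K, t ≠ 0 ∧ q j = t • Q) →
        (∃ t : K, t ≠ 0 ∧ q m = t • M) → c ⬝ᵥ q i = 0 → c ⬝ᵥ q j = 0 → c ⬝ᵥ q m ≠ 0 →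
        M = α • P + β • Q → False := by
      intro c P Q M i j m α β hi hj hm ci cj cm h
      rw [key hi] at ci
      rw [key hj] at cj
      rw [ne_eq, key hm, h, dotProduct_add, dotProduct_smul, dotProduct_smul, ci, cj] at cm
      simp at cm
    rintro (rfl | rfl | rfl | rfl | rfl)
    · exact hbad 1 2 h0 h5 h1 hF0 hF5 (hF 1 (by decide) (by decide) (by decide))
        (by funext i; fin_cases i <;> norm_num)
    · exact hbad 1 4 h0 h5 h2 hF0 hF5 (hF 2 (by decide) (by decide) (by decide))
        (by funext i; fin_cases i <;> norm_num)
    · exact hbad (1 / 2) 2 h0 h7 h3 hB0 hB7 (hB 3 (by decide) (by decide) (by decide))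
        (by funext i; fin_cases i <;> norm_num)
    · exact hbad 0 2 h0 h5 h2 hF0 hF5 (hF 2 (by decide) (by decide) (by decide))
        (by funext i; fin_cases i <;> norm_num)
    · exact hbad 2 1 h6 h10 h2 hA6 hA10 (hA 2 (by decide) (by decide) (by decide))
        (by funext i; fin_cases i <;> norm_num)
  · intro i
    fin_cases i
    exacts [h0, h1, h2, h3, h4, h5, h6, h7, h8, h9, h10, h11]

/-- The model configuration is unique up to projective equivalence and one parameter. -/
theorem IsModel.exists_matrix [CharZero K] (hq : IsModel q) :
    ∃ (M : Matrix (Fin 3) (Fin 3) K) (a : K), M.det ≠ 0 ∧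
      a ∉ ({-2, -1, -1 / 2, 0, 1} : Set K) ∧
      ∀ i, ∃ t : K, t ≠ 0 ∧ q i = t • Matrix.mulVec M (modelPoint a i) := by
  obtain ⟨A, hA0, hA6, hA10, hA⟩ := hq.exists_line (0, 6, 10) (by simp [TripleSystem.model])
  obtain ⟨E, hE5, hE6, hE7, hE⟩ := hq.exists_line (5, 6, 7) (by simp [TripleSystem.model])
  obtain ⟨H, hH1, hH7, hH10, hH⟩ := hq.exists_line (1, 7, 10) (by simp [TripleSystem.model])
  dsimp only at *
  set B : Matrix (Fin 3) (Fin 3) K := Matrix.of fun i j => ![q 10 i, q 6 i, q 7 i] j with hB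
  have hBv : ∀ v, Matrix.mulVec B v = v 0 • q 10 + v 1 • q 6 + v 2 • q 7 := by
    intro v
    funext i
    simp [hB, Matrix.mulVec, dotProduct, Fin.sum_univ_three, mul_comm]
  have hBdet : B.det ≠ 0 := by
    intro h
    obtain ⟨v, hv, hBv0⟩ := Matrix.exists_mulVec_eq_zero_iff.2 h
    rw [hBv] at hBv0
    have h2 : v 2 = 0 := by
      have := congrArg (A ⬝ᵥ ·) hBv0
      simp only [dotProduct_add, dotProduct_smul, hA6, hA10, mul_zero, zero_add,
        dotProduct_zero, smul_eq_mul] at this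
      exact (mul_eq_zero.1 this).resolve_right (hA 7 (by decide) (by decide) (by decide))
    rw [h2, zero_smul, add_zero] at hBv0
    obtain ⟨h0, h1⟩ := LinearIndependent.pair_iff.1 (hq.linearIndependent 10 6 (by decide)) _ _ hBv0
    apply hv
    funext i
    fin_cases i
    exacts [h0, h1, h2]
  obtain ⟨w, hw⟩ : ∃ w, Matrix.mulVec B w = q 11 :=
    ⟨Matrix.mulVec B⁻¹ (q 11), by
      rw [Matrix.mulVec_mulVec, Matrix.mul_nonsing_inv _ (isUnit_iff_ne_zero.2 hBdet),
        Matrix.one_mulVec]⟩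
  rw [hBv] at hw
  have hw0 : w 0 ≠ 0 := by
    intro h
    apply hE 11 (by decide) (by decide) (by decide)
    simp [← hw, h, hE6, hE7]
  have hw1 : w 1 ≠ 0 := by
    intro h
    apply hH 11 (by decide) (by decide) (by decide)
    simp [← hw, h, hH7, hH10]
  have hw2 : w 2 ≠ 0 := by
    intro h
    apply hA 11 (by decide) (by decide) (by decide)
    simp [← hw, h, hA6, hA10]
  -- Chosen so that (0,0,1), (1,0,1), (0,1,1) go to multiples of `q 10`, `q 6`, `q 7`, and (2,2,3)
  -- goes to `q 11`.
  set M := B * !![w 0, w 0, -w 0; w 1 / 2, 0, 0; 0, w 2 / 2, 0] with hM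
  have hMdet : M.det ≠ 0 := by
    rw [hM, Matrix.det_mul]
    refine mul_ne_zero hBdet ?_
    simp [Matrix.det_fin_three, hw0, hw1, hw2]
  have hMv : ∀ v : Fin 3 → K, Matrix.mulVec M v = (w 0 * (v 0 + v 1 - v 2)) • q 10 +
      (w 1 / 2 * v 0) • q 6 + (w 2 / 2 * v 1) • q 7 := by
    intro v
    rw [hM, ← Matrix.mulVec_mulVec, hBv]
    congr 3
    · simp [Matrix.mulVec, dotProduct, Fin.sum_univ_three]
      ring
    · simp [Matrix.mulVec, dotProduct, Fin.sum_univ_three]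
    · simp [Matrix.mulVec, dotProduct, Fin.sum_univ_three]
  have hunit := isUnit_iff_ne_zero.2 hMdet
  set r : Fin 12 → Fin 3 → K := fun i => Matrix.mulVec M⁻¹ (q i) with hr
  have hMr : ∀ i, Matrix.mulVec M (r i) = q i := fun i => by
    rw [hr, Matrix.mulVec_mulVec, Matrix.mul_nonsing_inv _ hunit, Matrix.one_mulVec]
  have hrM : ∀ i v, q i = Matrix.mulVec M v → r i = v := fun i v h => by
    rw [hr]
    simp only
    rw [h, Matrix.mulVec_mulVec, Matrix.nonsing_inv_mul _ hunit, Matrix.one_mulVec]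
  have hdot : ∀ (c : Fin 3 → K) i, Matrix.vecMul c M ⬝ᵥ r i = c ⬝ᵥ q i := fun c i => by
    rw [← Matrix.dotProduct_mulVec, hMr]
  have hmodel : IsModel r := by
    refine ⟨fun i j hij => ?_, fun l hl => ?_⟩
    · rw [LinearIndependent.pair_iff]
      intro s t h
      refine LinearIndependent.pair_iff.1 (hq.linearIndependent i j hij) s t ?_
      have := congrArg (Matrix.mulVec M) h
      rwa [Matrix.mulVec_add, Matrix.mulVec_smul, Matrix.mulVec_smul, hMr, hMr,
        Matrix.mulVec_zero] at this
    · obtain ⟨c, h1, h2, h3, h4⟩ := hq.exists_line l hl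
      refine ⟨Matrix.vecMul c M, ?_⟩
      simp only [hdot]
      exact ⟨h1, h2, h3, h4⟩
  obtain ⟨a, ha, h⟩ := hmodel.exists_eq_modelPoint
    ⟨2 / w 1, by simp [hw1], hrM _ _ (by
      rw [Matrix.mulVec_smul, hMv]; simp [smul_smul, hw1])⟩
    ⟨2 / w 2, by simp [hw2], hrM _ _ (by
      rw [Matrix.mulVec_smul, hMv]; simp [smul_smul, hw2])⟩
    ⟨-(w 0)⁻¹, by simp [hw0], hrM _ _ (by
      rw [Matrix.mulVec_smul, hMv]; simp [hw0])⟩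
    ⟨1, one_ne_zero, hrM _ _ (by
      rw [Matrix.mulVec_smul, hMv, ← hw, one_smul]
      congr 3
      · simp
        ring_nf
      · simp
      · simp)⟩
  refine ⟨M, a, hMdet, ha, fun i => ?_⟩
  obtain ⟨t, ht, hi⟩ := h i
  exact ⟨t, ht, by rw [← hMr i, hi, Matrix.mulVec_smul]⟩

end NormalForm

end QuarticMonoid

open MvPolynomial

namespace QuarticMonoid

/-! ### The forms F₃ and F₄ at the model points. -/

section Forms

variable {K : Type*} [Field K]

lemma isHomogeneous_F3 (a : K) : (F3 a).IsHomogeneous 3 := by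
  have hC : ∀ r : K, (C r : Poly4 K).IsHomogeneous 0 := fun r => isHomogeneous_C _ r
  have hX : ∀ i : Fin 4, (X i : Poly4 K).IsHomogeneous 1 := fun i => isHomogeneous_X _ i
  have h1 : ∀ i r, (C r * (X i : Poly4 K) ^ 3).IsHomogeneous 3 := fun i r => by
    simpa using (hC r).mul ((hX i).pow 3)
  have h2 : ∀ i j r, (C r * (X i : Poly4 K) ^ 2 * X j).IsHomogeneous 3 := fun i j r => by
    simpa using ((hC r).mul ((hX i).pow 2)).mul (hX j)
  have h3 : ∀ i j r, (C r * (X i : Poly4 K) * X j ^ 2).IsHomogeneous 3 := fun i j r => by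
    simpa using ((hC r).mul (hX i)).mul ((hX j).pow 2)
  have h4 : ∀ i j l r, (C r * (X i : Poly4 K) * X j * X l).IsHomogeneous 3 := fun i j l r => by
    simpa using (((hC r).mul (hX i)).mul (hX j)).mul (hX l)
  exact ((((((((h1 _ _).add (h2 _ _ _)).sub (h2 _ _ _)).add (h3 _ _ _)).add (h3 _ _ _)).sub
    (h4 _ _ _ _)).add (h1 _ _)).sub (h2 _ _ _)).add (h3 _ _ _)

lemma isHomogeneous_F4 (a : K) : (F4 a).IsHomogeneous 4 := by
  have hC : ∀ r : K, (C r : Poly4 K).IsHomogeneous 0 := fun r => isHomogeneous_C _ r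
  have hX : ∀ i : Fin 4, (X i : Poly4 K).IsHomogeneous 1 := fun i => isHomogeneous_X _ i
  have h1 : ∀ i r, (C r * (X i : Poly4 K)).IsHomogeneous 1 := fun i r => by
    simpa using (hC r).mul (hX i)
  have h2 : ∀ i, ((2 : Poly4 K) * X i).IsHomogeneous 1 := fun i => h1 i 2
  have h3 : ∀ i, ((3 : Poly4 K) * X i).IsHomogeneous 1 := fun i => h1 i 3
  exact (((hX 1).mul ((((h1 _ _).sub (h1 _ _)).add (hX _)).sub (hX _))).mul
    ((((((h1 _ _).add (h1 _ _)).sub (h1 _ _)).add (h3 _)).add (hX _)).sub (h2 _))).mul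
    ((((h1 _ _).add (h2 _)).add (h2 _)).sub (h2 _))

lemma isHomogeneous_Qab (a b : K) : (Qab a b).IsHomogeneous 4 :=
  ((isHomogeneous_X _ 3).mul (isHomogeneous_F3 a)).add
    (by simpa using (isHomogeneous_C _ b).mul (isHomogeneous_F4 a))

/-- The inclusion of the plane `t = 0`. -/
def planeMatrix (K : Type*) [Field K] : Matrix (Fin 4) (Fin 3) K :=
  !![1, 0, 0; 0, 1, 0; 0, 0, 1; 0, 0, 0]

lemma planeMatrix_mulVec (v : Fin 3 → K) :
    Matrix.mulVec (planeMatrix K) v = ![v 0, v 1, v 2, 0] := by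
  funext i
  fin_cases i <;> simp [planeMatrix, Matrix.mulVec, dotProduct, Fin.sum_univ_three]

/-- The four lines `F₄ = 0`. -/
def lineA (K : Type*) [Field K] : Fin 3 → K := ![0, 1, 0]
/-- The four lines `F₄ = 0`. -/
def lineB (a : K) : Fin 3 → K := ![3 * a + 1, -1, -2 * a]
/-- The four lines `F₄ = 0`. -/
def lineC (a : K) : Fin 3 → K := ![2 * a + 3, a + 1, -2 * a - 2]
/-- The four lines `F₄ = 0`. -/
def lineD (a : K) : Fin 3 → K := ![a + 2, 2, -2]

lemma eval_F4_eq (a : K) (v : Fin 4 → K) : eval v (F4 a) =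
    (lineA K ⬝ᵥ (v ∘ Fin.castSucc)) * (lineB a ⬝ᵥ (v ∘ Fin.castSucc)) *
      (lineC a ⬝ᵥ (v ∘ Fin.castSucc)) * (lineD a ⬝ᵥ (v ∘ Fin.castSucc)) := by
  rw [eval_F4]
  simp [lineA, lineB, lineC, lineD, dotProduct, Fin.sum_univ_three]
  ring

/-- Nine of these points lie by threes on three of the lines of F₄ and leave a pencil of cubics; the
tenth point, 7, singles out one member. -/
lemma eval_F3_modelPoint (a : K) (i : Fin 12) (hi : i ∈ ({0, 6, 10, 4, 3, 11, 8, 1, 5, 7} : Finset (Fin 12))) :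
    eval (modelPoint a i) (linSubst (planeMatrix K) (F3 a)) = 0 := by
  rw [eval_linSubst, planeMatrix_mulVec, eval_F3]
  fin_cases hi <;> simp [modelPoint] <;> ring

end Forms

/-! ### Recovering the surface from the twelve points. -/

section Recognition

variable {K : Type*} [Field K] [CharZero K] {f g : MvPolynomial (Fin 3) K}

theorem exists_projEquiv_Qab (hf : f.IsHomogeneous 3) (hg : g.IsHomogeneous 4)
    {q : Fin 12 → Fin 3 → K} (hq : IsModel q) (hfq : ∀ i, eval (q i) f = 0)
    (hgq : ∀ i, eval (q i) g = 0)
    (hline : ∀ c : Fin 3 → K, c ≠ 0 → ∃ R, c ⬝ᵥ R = 0 ∧ eval R f ≠ 0)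
    (hgf : ∀ l, g ≠ linForm l * f) :
    ∃ a b : K, a ∉ ({-2, -1, -1 / 2, 0, 1} : Set K) ∧ b ≠ 0 ∧
      ProjEquiv (monoidForm f g) (Qab a b) := by
  obtain ⟨M, a, hM, ha, hqM⟩ := hq.exists_matrix
  have ha' := ha
  simp only [Set.mem_insert_iff, Set.mem_singleton_iff, not_or] at ha'
  obtain ⟨ha2, ha1, hah, ha0, ha1'⟩ := ha'
  have hunit := isUnit_iff_ne_zero.2 hM
  have hMinv : ∀ v, Matrix.mulVec M (Matrix.mulVec M⁻¹ v) = v := fun v => by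
    rw [Matrix.mulVec_mulVec, Matrix.mul_nonsing_inv _ hunit, Matrix.one_mulVec]
  set f' := linSubst M f with hf'
  set g' := linSubst M g with hg'
  have hf'h : f'.IsHomogeneous 3 := IsHomogeneous.linSubst M hf
  have hg'h : g'.IsHomogeneous 4 := IsHomogeneous.linSubst M hg
  set p := modelPoint a with hp
  have hpi : ∀ i j, i ≠ j → LinearIndependent K ![p i, p j] := by
    intro i j hij
    obtain ⟨t, ht, hi⟩ := hqM i
    obtain ⟨u, hu, hj⟩ := hqM j
    rw [LinearIndependent.pair_iff]
    intro x y hxy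
    have h1 := LinearIndependent.pair_iff.1 (hq.linearIndependent i j hij) (x / t) (y / u) (by
      have := congrArg (Matrix.mulVec M) hxy
      rw [Matrix.mulVec_add, Matrix.mulVec_smul, Matrix.mulVec_smul, Matrix.mulVec_zero] at this
      rw [hi, hj, smul_smul, smul_smul, div_mul_cancel₀ _ ht, div_mul_cancel₀ _ hu, this])
    exact ⟨(div_eq_zero_iff.1 h1.1).resolve_right ht, (div_eq_zero_iff.1 h1.2).resolve_right hu⟩
  have hf'p : ∀ i, eval (p i) f' = 0 := by
    intro i
    obtain ⟨t, ht, hi⟩ := hqM i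
    have := hfq i
    rw [hi, eval_smul_of_isHomogeneous hf] at this
    rw [hf', eval_linSubst]
    exact (mul_eq_zero.1 this).resolve_left (pow_ne_zero _ ht)
  have hg'p : ∀ i, eval (p i) g' = 0 := by
    intro i
    obtain ⟨t, ht, hi⟩ := hqM i
    have := hgq i
    rw [hi, eval_smul_of_isHomogeneous hg] at this
    rw [hg', eval_linSubst]
    exact (mul_eq_zero.1 this).resolve_left (pow_ne_zero _ ht)
  have hline' : ∀ c : Fin 3 → K, c ≠ 0 → ∃ R, c ⬝ᵥ R = 0 ∧ eval R f' ≠ 0 := by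
    intro c hc
    obtain ⟨R, hR, hfR⟩ := hline (Matrix.vecMul c M⁻¹) fun h => hc (by
      have := congrArg (Matrix.vecMul · M) h
      simpa [Matrix.vecMul_vecMul, Matrix.nonsing_inv_mul _ hunit] using this)
    refine ⟨Matrix.mulVec M⁻¹ R, ?_, ?_⟩
    · rw [Matrix.dotProduct_mulVec, hR]
    · rwa [hf', eval_linSubst, hMinv]
  have hA0 : lineA K ≠ 0 := fun h => by simpa [lineA] using congrFun h 1
  have hB0 : lineB a ≠ 0 := fun h => by simpa [lineB] using congrFun h 1
  have hC0 : lineC a ≠ 0 := fun h => by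
    have := congrFun h 1
    simp only [lineC, Matrix.cons_val, Pi.zero_apply] at this
    exact ha1 (eq_neg_of_add_eq_zero_left this)
  have hD0 : lineD a ≠ 0 := fun h => by simpa [lineD] using congrFun h 1
  have hA : IsTrisecant f' p (lineA K) {0, 6, 10} := ⟨rfl, hA0, fun i hi => by
    fin_cases hi <;> simp [lineA, p, modelPoint, dotProduct, Fin.sum_univ_three], hline' _ hA0⟩
  have hB : IsTrisecant f' p (lineB a) {4, 3, 11} := ⟨rfl, hB0, fun i hi => by
    fin_cases hi <;> simp [lineB, p, modelPoint, dotProduct, Fin.sum_univ_three] <;> ring,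
    hline' _ hB0⟩
  have hC : IsTrisecant f' p (lineC a) {8, 1, 5} := ⟨rfl, hC0, fun i hi => by
    fin_cases hi <;> simp [lineC, p, modelPoint, dotProduct, Fin.sum_univ_three] <;> ring,
    hline' _ hC0⟩
  have hD : ∀ i ∈ ({2, 7, 9} : Finset (Fin 12)), lineD a ⬝ᵥ p i = 0 := fun i hi => by
    fin_cases hi <;> simp [lineD, p, modelPoint, dotProduct, Fin.sum_univ_three] <;> ring
  have hne : ∀ i ∈ ({2, 7, 9} : Finset (Fin 12)),
      lineA K ⬝ᵥ p i ≠ 0 ∧ lineB a ⬝ᵥ p i ≠ 0 ∧ lineC a ⬝ᵥ p i ≠ 0 := by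
    intro i hi
    refine ⟨mt (hA.mem_of_dotProduct hf'h hpi hf'p) ?_, mt (hB.mem_of_dotProduct hf'h hpi hf'p) ?_,
      mt (hC.mem_of_dotProduct hf'h hpi hf'p) ?_⟩ <;> revert i <;> decide
  have hAB : Disjoint ({0, 6, 10} : Finset (Fin 12)) {4, 3, 11} := by decide
  have hAC : Disjoint ({0, 6, 10} : Finset (Fin 12)) {8, 1, 5} := by decide
  have hBC : Disjoint ({4, 3, 11} : Finset (Fin 12)) {8, 1, 5} := by decide
  obtain ⟨r, s, hrs⟩ := exists_eq_C_mul_add_of_isTrisecant hf'h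
    (IsHomogeneous.linSubst (planeMatrix K) (isHomogeneous_F3 a)) hpi hf'p hA hB hC hAB hAC hBC
    (fun i hi => eval_F3_modelPoint a i (by revert i; decide))
    (fun i hi => eval_F3_modelPoint a i (by revert i; decide))
    (fun i hi => eval_F3_modelPoint a i (by revert i; decide))
  -- At the point 7 both cubics vanish, the product of the three lines does not.
  have hs : s = 0 := by
    have h := congrArg (eval (p 7)) hrs
    rw [eval_F3_modelPoint a 7 (by decide)] at h
    simp only [map_add, map_mul, eval_C, hf'p, mul_zero, zero_add, eval_linForm] at h
    obtain ⟨h1, h2, h3⟩ := hne 7 (by decide)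
    simpa [h1, h2, h3] using h.symm
  have hF3 : ∀ v : Fin 3 → K, eval ![v 0, v 1, v 2, 0] (F3 a) = r * eval v f' := by
    intro v
    have h := congrArg (eval v) hrs
    rw [eval_linSubst, planeMatrix_mulVec, hs] at h
    simpa using h
  have hr : r ≠ 0 := by
    rintro rfl
    -- There F₃(a) takes the value a + 1.
    have := hF3 ![0, 1, 0]
    rw [eval_F3] at this
    simp at this
    exact ha1 (eq_neg_of_add_eq_zero_left this)
  obtain ⟨l, m, hlm⟩ := exists_eq_add_of_isTrisecant hf'h hg'h hpi hf'p hA hB hC hAB hAC hBC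
    (fun i _ => hg'p i) (fun i _ => hg'p i) (fun i _ => hg'p i)
  have hm : ∀ i ∈ ({2, 7, 9} : Finset (Fin 12)), m ⬝ᵥ p i = 0 := by
    intro i hi
    have h := congrArg (eval (p i)) hlm
    simp only [map_add, map_mul, hf'p, hg'p, mul_zero, zero_add, eval_linForm] at h
    obtain ⟨h1, h2, h3⟩ := hne i hi
    simpa [h1, h2, h3] using h.symm
  -- Two of the three remaining points determine the fourth line up to a factor.
  obtain ⟨b, rfl⟩ := exists_smul_of_dotProduct_eq_zero hD0 (hpi 2 7 (by decide))
    (hD 2 (by decide)) (hD 7 (by decide)) (hm 2 (by decide)) (hm 7 (by decide))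
  have hb : b ≠ 0 := by
    rintro rfl
    apply hgf (Matrix.vecMul l M⁻¹)
    apply MvPolynomial.funext
    intro v
    have h := congrArg (eval (Matrix.mulVec M⁻¹ v)) hlm
    rw [hg', eval_linSubst, hMinv] at h
    rw [h]
    simp only [map_add, map_mul, eval_linForm, hf', eval_linSubst, hMinv, zero_smul,
      zero_dotProduct, mul_zero, add_zero]
    rw [Matrix.dotProduct_mulVec]
  -- Replacing t by r t - l cancels the multiple l f of the cubic and turns f into r f, which is F₃.
  refine ⟨a, b, ha, hb, projEquiv_of_eval
    !![M 0 0, M 0 1, M 0 2, 0; M 1 0, M 1 1, M 1 2, 0; M 2 0, M 2 1, M 2 2, 0;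
      -l 0, -l 1, -l 2, r] ?_ one_ne_zero fun v => ?_⟩
  · have : Matrix.det !![M 0 0, M 0 1, M 0 2, 0; M 1 0, M 1 1, M 1 2, 0; M 2 0, M 2 1, M 2 2, 0;
        -l 0, -l 1, -l 2, r] = M.det * r := by
      rw [Matrix.det_fin_three]
      simp [Matrix.det_succ_row_zero, Fin.sum_univ_succ, Fin.succAbove]
      ring
    rw [this]
    exact mul_ne_zero hM hr
  · set v' : Fin 3 → K := v ∘ Fin.castSucc with hv'
    set w := Matrix.mulVec !![M 0 0, M 0 1, M 0 2, 0; M 1 0, M 1 1, M 1 2, 0;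
      M 2 0, M 2 1, M 2 2, 0; -l 0, -l 1, -l 2, r] v with hw
    have h1 : w ∘ Fin.castSucc = Matrix.mulVec M v' := by
      funext i
      fin_cases i <;>
        simp [hw, hv', Matrix.mulVec, dotProduct, Fin.sum_univ_four, Fin.sum_univ_three]
    have h2 : w 3 = r * v 3 - l ⬝ᵥ v' := by
      simp [hw, hv', dotProduct, Fin.sum_univ_four, Fin.sum_univ_three]
      ring
    have h3 : eval v (F3 a) = r * eval v' f' := by
      rw [← hF3, eval_F3, eval_F3]
      simp [hv']
    have h4 := congrArg (eval v') hlm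
    rw [eval_monoidForm, h1, h2, ← eval_linSubst, ← eval_linSubst, eval_Qab, eval_F4_eq, h3,
      ← hf', ← hg', h4]
    simp only [map_add, map_mul, eval_linForm, smul_dotProduct, smul_eq_mul, ← hv']
    ring

end Recognition

end QuarticMonoid

open MvPolynomial

namespace QuarticMonoid

/-! ### From a triple point to the equation t f + g. -/

section TriplePoint

variable {K : Type*} [Field K]

lemma pderiv_comm {σ : Type*} (i j : σ) (f : MvPolynomial σ K) :
    pderiv i (pderiv j f) = pderiv j (pderiv i f) := by
  classical
  induction f using MvPolynomial.induction_on with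
  | C a => simp
  | add p q hp hq => simp only [map_add, hp, hq]
  | mul_X p l hp =>
    have hX : ∀ i j : σ, pderiv i (pderiv j (X l : MvPolynomial σ K)) = 0 := by
      intro i j
      rw [pderiv_X, Pi.single_apply]
      split_ifs <;> simp
    simp only [pderiv_mul, map_add, hp, hX]
    ring

/-- The derivative of `F` in the direction `p`. -/
noncomputable def polar (F : Poly4 K) (p : Fin 4 → K) : Poly4 K := ∑ i, C (p i) * pderiv i F

lemma eval_polar (F : Poly4 K) (p u : Fin 4 → K) :
    eval u (polar F p) = ∑ i, p i * eval u (pderiv i F) := by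
  simp [polar]

lemma isHomogeneous_polar {F : Poly4 K} {d : ℕ} (hF : F.IsHomogeneous d) (p : Fin 4 → K) :
    (polar F p).IsHomogeneous (d - 1) :=
  IsHomogeneous.sum _ _ _ fun i _ => by
    simpa using (isHomogeneous_C _ (p i)).mul (hF.pderiv (i := i))

/-- A quartic with a triple point at `p` is linear along the lines through `p`. -/
lemma eval_add_smul_of_isTriplePoint [CharZero K] {F : Poly4 K} {p : Fin 4 → K} (hF : F.IsHomogeneous 4)
    (hp : ∀ l : List (Fin 4), l.length ≤ 2 → eval p (iterPartial F l) = 0) (u : Fin 4 → K) (s : K) :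
    eval (u + s • p) F = eval u F + s * eval u (polar F p) := by
  have h0 : (linePoly F p u).coeff 0 = 0 := by
    rw [coeff_zero_linePoly]
    exact hp [] (by simp)
  have h1 : (linePoly F p u).coeff 1 = 0 := by
    rw [coeff_one_linePoly]
    exact Finset.sum_eq_zero fun i _ => mul_eq_zero_of_right _ (hp [i] (by simp))
  have h2 : (linePoly F p u).coeff 2 = 0 := by
    have h := congrArg (fun q => Polynomial.coeff q 1) (derivative_linePoly F p u)
    simp only [Polynomial.coeff_derivative, Polynomial.finsetSum_coeff, Polynomial.coeff_C_mul,
      coeff_one_linePoly] at h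
    rw [Finset.sum_eq_zero] at h
    · norm_num at h
      exact h
    · exact fun i _ => mul_eq_zero_of_right _ (Finset.sum_eq_zero fun j _ =>
        mul_eq_zero_of_right _ (hp [j, i] (by simp)))
  -- The triple point removes the coefficients of order 0, 1, 2 at `p`. Only two of the five remain,
  -- so F is affine in s.
  have h3 : ∀ s : K, eval (u + s • p) F =
      (linePoly F p u).coeff 3 * s + (linePoly F p u).coeff 4 := by
    intro s
    have := eval_add_smul_of_isHomogeneous hF p u s 1
    simp only [Finset.sum_range_succ, Finset.sum_range_zero, h0, h1, h2, one_smul] at this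
    rw [add_comm, this]
    norm_num
  have h4 : linePoly F u p = Polynomial.C ((linePoly F p u).coeff 4) +
      Polynomial.C ((linePoly F p u).coeff 3) * Polynomial.X := by
    refine Polynomial.funext fun t => ?_
    rw [eval_linePoly, h3]
    simp
    ring
  have h5 : (linePoly F p u).coeff 3 = eval u (polar F p) := by
    rw [eval_polar, ← coeff_one_linePoly, h4]
    simp
  have h6 : (linePoly F p u).coeff 4 = eval u F := by
    rw [← coeff_zero_linePoly F u p, h4]
    simp
  rw [h3, h5, h6]
  ring

/-- A third derivative of a quartic is a linear form, whose value at `p` is, by Euler's formula, the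
same third derivative of the polar. If the polar were zero, all third derivatives would vanish at
`p`. -/
lemma polar_ne_zero {F : Poly4 K} {p : Fin 4 → K} (hF : F.IsHomogeneous 4)
    (hp : ∃ l : List (Fin 4), l.length = 3 ∧ eval p (iterPartial F l) ≠ 0) : polar F p ≠ 0 := by
  intro h
  obtain ⟨l, hl, hne⟩ := hp
  obtain ⟨a, b, c, rfl⟩ := List.length_eq_three.1 hl
  apply hne
  change eval p (pderiv a (pderiv b (pderiv c F))) = 0
  have h1 : (pderiv a (pderiv b (pderiv c F))).IsHomogeneous 1 := (hF.pderiv.pderiv).pderiv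
  have h2 := congrArg (eval p) h1.sum_X_mul_pderiv
  rw [one_smul] at h2
  have h3 := congrArg (fun G => eval p (pderiv a (pderiv b (pderiv c G)))) h
  simp only [polar, map_sum, map_zero, pderiv_C_mul] at h3
  rw [← h2, map_sum, ← h3]
  refine Finset.sum_congr rfl fun i _ => ?_
  rw [map_mul, map_mul, eval_X, eval_C, pderiv_comm i a, pderiv_comm i b, pderiv_comm i c]

lemma exists_matrix_col {p : Fin 4 → K} (hp : p ≠ 0) :
    ∃ M : Matrix (Fin 4) (Fin 4) K, M.det ≠ 0 ∧ ∀ i, M i 3 = p i := by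
  obtain ⟨j, hj⟩ := Function.ne_iff.1 hp
  refine ⟨((1 : Matrix (Fin 4) (Fin 4) K).updateCol j p).submatrix id (Equiv.swap j 3), ?_, ?_⟩
  · rw [Matrix.det_permute', ← Matrix.cramer_apply, Matrix.cramer_one]
    refine mul_ne_zero ?_ hj
    rcases Int.units_eq_one_or (Equiv.Perm.sign (Equiv.swap j 3)) with h | h <;> simp [h]
  · intro i
    simp

/-- A quartic monoid in coordinates in which its triple point is `(0 : 0 : 0 : 1)`. -/
theorem exists_eq_monoidForm [CharZero K] {F : Poly4 K} {p : Fin 4 → K} (hF : IsQuarticMonoid F p) :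
    ∃ (M : Matrix (Fin 4) (Fin 4) K) (f g : MvPolynomial (Fin 3) K), M.det ≠ 0 ∧
      (∀ i, M i 3 = p i) ∧ f.IsHomogeneous 3 ∧ g.IsHomogeneous 4 ∧ f ≠ 0 ∧
      changeCoord M F = monoidForm f g := by
  obtain ⟨hF4, hp0, hp2, hp3⟩ := hF
  obtain ⟨M, hM, hMp⟩ := exists_matrix_col hp0
  have hlin := eval_add_smul_of_isTriplePoint hF4 hp2
  have hv : ∀ v : Fin 4 → K, Matrix.mulVec M v =
      Matrix.mulVec (M * planeMatrix K) (v ∘ Fin.castSucc) + v 3 • p := by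
    intro v
    rw [← Matrix.mulVec_mulVec, planeMatrix_mulVec]
    funext i
    simp [Matrix.mulVec, dotProduct, Fin.sum_univ_four, hMp]
    ring
  refine ⟨M, linSubst (M * planeMatrix K) (polar F p), linSubst (M * planeMatrix K) F, hM, hMp,
    IsHomogeneous.linSubst _ (isHomogeneous_polar hF4 p), IsHomogeneous.linSubst _ hF4, ?_, ?_⟩
  · intro h
    apply polar_ne_zero hF4 hp3
    apply MvPolynomial.funext
    intro x
    have hx : x = Matrix.mulVec M (Matrix.mulVec M⁻¹ x) := by
      rw [Matrix.mulVec_mulVec, Matrix.mul_nonsing_inv _ (isUnit_iff_ne_zero.2 hM),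
        Matrix.one_mulVec]
    rw [hx, hv]
    generalize (Matrix.mulVec M⁻¹ x) = v
    have h1 := congrArg (eval (v ∘ Fin.castSucc)) h
    rw [eval_linSubst, map_zero] at h1
    generalize Matrix.mulVec (M * planeMatrix K) (v ∘ Fin.castSucc) = u at h1 ⊢
    -- Expanding from `u` and from `u + v 3 • p` shows that the polar is constant in the direction
    -- `p`, so its vanishing on the plane t = 0 makes it zero.
    have h2 := hlin u (v 3 + 1)
    have h3 := hlin (u + v 3 • p) 1
    rw [hlin u (v 3), show u + v 3 • p + (1 : K) • p = u + (v 3 + 1) • p by module, h2, h1] at h3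
    rw [map_zero]
    linear_combination -h3
  · apply MvPolynomial.funext
    intro v
    rw [eval_changeCoord, eval_monoidForm, hv, hlin, eval_linSubst, eval_linSubst]
    ring

end TriplePoint

/-! ### Change of coordinates and of the base field. -/

section Transfer

variable {K : Type*} [Field K]

lemma mulVec_mulVec_inv {n : Type*} [Fintype n] [DecidableEq n] {M : Matrix n n K}
    (hM : M.det ≠ 0) (v : n → K) : Matrix.mulVec M (Matrix.mulVec M⁻¹ v) = v := by
  rw [Matrix.mulVec_mulVec, Matrix.mul_nonsing_inv _ (isUnit_iff_ne_zero.2 hM), Matrix.one_mulVec]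

lemma inv_mulVec_mulVec {n : Type*} [Fintype n] [DecidableEq n] {M : Matrix n n K}
    (hM : M.det ≠ 0) (v : n → K) : Matrix.mulVec M⁻¹ (Matrix.mulVec M v) = v := by
  rw [Matrix.mulVec_mulVec, Matrix.nonsing_inv_mul _ (isUnit_iff_ne_zero.2 hM), Matrix.one_mulVec]

lemma encard_lines_changeCoord {M : Matrix (Fin 4) (Fin 4) K} (hM : M.det ≠ 0) (F : Poly4 K) :
    (lines (changeCoord M F)).encard = (lines F).encard := by
  let e : (Fin 4 → K) ≃ₗ[K] (Fin 4 → K) := LinearEquiv.ofLinearMap M.mulVecLin M⁻¹.mulVecLin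
    (LinearMap.ext fun v => mulVec_mulVec_inv hM v) (LinearMap.ext fun v => inv_mulVec_mulVec hM v)
  have he : ∀ v, e v = Matrix.mulVec M v := fun _ => rfl
  have h : lines F = (Submodule.map e.toLinearMap) '' lines (changeCoord M F) := by
    ext L
    constructor
    · rintro ⟨hL, hF⟩
      refine ⟨L.map e.symm.toLinearMap, ⟨?_, ?_⟩, ?_⟩
      · rw [← hL]
        exact LinearEquiv.finrank_map_eq e.symm L
      · rintro _ ⟨v, hv, rfl⟩
        rw [eval_changeCoord, ← he]
        simpa using hF v hv
      · rw [← Submodule.map_comp]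
        simp
    · rintro ⟨L, ⟨hL, hF⟩, rfl⟩
      refine ⟨?_, ?_⟩
      · rw [← hL]
        exact LinearEquiv.finrank_map_eq e L
      · rintro _ ⟨v, hv, rfl⟩
        have := hF v hv
        rwa [eval_changeCoord, ← he] at this
  rw [h, Set.InjOn.encard_image]
  exact (Submodule.map_injective_of_injective e.injective).injOn

end Transfer

section BaseChange

variable {K k : Type*} [Field K] [Field k] [Algebra K k]

local notation "φ" => algebraMap K k

lemma map_linForm {σ : Type*} [Fintype σ] (c : σ → K) :
    map φ (linForm c) = linForm (φ ∘ c) := by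
  simp [linForm]

lemma map_monoidForm (f g : MvPolynomial (Fin 3) K) :
    map φ (monoidForm f g) = monoidForm (map φ f) (map φ g) := by
  simp [monoidForm, map_rename]

lemma map_linSubst {σ τ : Type*} [Fintype τ] (M : Matrix σ τ K) (f : MvPolynomial σ K) :
    map φ (linSubst M f) = linSubst (M.map φ) (map φ f) := by
  simp [linSubst, map_bind₁]

lemma map_linePoly {σ : Type*} (f : MvPolynomial σ K) (v w : σ → K) :
    (linePoly f v w).map φ = linePoly (map φ f) (φ ∘ v) (φ ∘ w) := by
  induction f using MvPolynomial.induction_on with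
  | C a => simp [linePoly]
  | add p q hp hq =>
    simp only [linePoly, map_add, Polynomial.map_add] at hp hq ⊢
    rw [hp, hq]
  | mul_X p j hp =>
    simp only [linePoly] at hp
    simp [linePoly, map_mul, Polynomial.map_mul, hp]

lemma eval_map_comp {σ : Type*} (f : MvPolynomial σ K) (v : σ → K) :
    eval (φ ∘ v) (map φ f) = φ (eval v f) := by
  rw [eval_map, eval₂_comp]

end BaseChange

end QuarticMonoid

open MvPolynomial

namespace QuarticMonoid

/-! ### Lines under extension of scalars. -/

section BaseChangeLines

variable {K k : Type*} [Field K] [Field k] [Algebra K k]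

local notation "φ" => algebraMap K k

lemma linearIndependent_pair_algebraMap {n : ℕ} {v w : Fin n → K} :
    LinearIndependent k ![φ ∘ v, φ ∘ w] ↔ LinearIndependent K ![v, w] := by
  rw [← linearIndependent_algebraMap_comp_iff (S := k) (v := ![v, w])]
  rw [show (fun i => φ ∘ (![v, w] : Fin 2 → Fin n → K) i) = ![φ ∘ v, φ ∘ w] by
    funext i; fin_cases i <;> rfl]

lemma exists_eq_span_pair {n : ℕ} {L : Submodule K (Fin n → K)} (hL : Module.finrank K L = 2) :
    ∃ x y : Fin n → K, LinearIndependent K ![x, y] ∧ L = Submodule.span K {x, y} := by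
  let b := Module.finBasisOfFinrankEq K L hL
  have h := b.linearIndependent.map' (Submodule.subtype _) (Submodule.ker_subtype _)
  rw [show (Submodule.subtype _ ∘ b : Fin 2 → Fin n → K) = ![(b 0).1, (b 1).1] by
    funext i; fin_cases i <;> rfl] at h
  refine ⟨(b 0).1, (b 1).1, h, ?_⟩
  symm
  have h2 := finrank_span_eq_card h
  rw [Matrix.range_cons, Matrix.range_cons, Matrix.range_empty, Set.union_empty,
    Set.singleton_union, Fintype.card_fin] at h2
  refine Submodule.eq_of_le_of_finrank_le ?_ (by rw [h2, hL])
  rw [Submodule.span_le]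
  rintro u (rfl | rfl)
  exacts [(b 0).2, (b 1).2]

/-- The subspace over an extension field spanned by a subspace. -/
def extendScalars (k : Type*) [Field k] [Algebra K k] {n : ℕ} (L : Submodule K (Fin n → K)) :
    Submodule k (Fin n → k) :=
  Submodule.span k ((fun v : Fin n → K => algebraMap K k ∘ v) '' L)

lemma extendScalars_span_pair {n : ℕ} (x y : Fin n → K) :
    extendScalars k (Submodule.span K {x, y}) = Submodule.span k {φ ∘ x, φ ∘ y} := by
  apply le_antisymm
  · rw [extendScalars, Submodule.span_le]
    rintro _ ⟨v, hv, rfl⟩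
    obtain ⟨s, t, rfl⟩ := Submodule.mem_span_pair.1 hv
    refine Submodule.mem_span_pair.2 ⟨φ s, φ t, ?_⟩
    funext i
    simp [Algebra.smul_def]
  · rw [Submodule.span_le]
    rintro u (rfl | rfl)
    · exact Submodule.subset_span ⟨x, Submodule.subset_span (by simp), rfl⟩
    · exact Submodule.subset_span ⟨y, Submodule.subset_span (by simp), rfl⟩

/-- Linear independence over K persists over k, so a vector outside `L` remains independent of a
basis of `L`. -/
lemma comp_mem_extendScalars {n : ℕ} {L : Submodule K (Fin n → K)} (hL : Module.finrank K L = 2)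
    {v : Fin n → K} : φ ∘ v ∈ extendScalars k L ↔ v ∈ L := by
  refine ⟨fun h => ?_, fun h => Submodule.subset_span ⟨v, h, rfl⟩⟩
  obtain ⟨x, y, hxy, rfl⟩ := exists_eq_span_pair hL
  by_contra hv
  have h1 : LinearIndependent K (Fin.cons v ![x, y] : Fin 3 → Fin n → K) := by
    rw [linearIndependent_finCons]
    refine ⟨hxy, ?_⟩
    rwa [Matrix.range_cons, Matrix.range_cons, Matrix.range_empty, Set.union_empty,
      Set.singleton_union]
  rw [← linearIndependent_algebraMap_comp_iff (S := k), show (fun i => φ ∘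
    (Fin.cons v ![x, y] : Fin 3 → Fin n → K) i) = Fin.cons (φ ∘ v) ![φ ∘ x, φ ∘ y] by
      funext i; fin_cases i <;> rfl, linearIndependent_finCons] at h1
  apply h1.2
  rwa [Matrix.range_cons, Matrix.range_cons, Matrix.range_empty, Set.union_empty,
    Set.singleton_union, ← extendScalars_span_pair]

/-- Over an infinite field the restriction of `F` to the line vanishes as a polynomial, hence also
at the points over k. -/
lemma extendScalars_mem_lines [Infinite K] [Infinite k] {F : Poly4 K} (hF : F.IsHomogeneous 4)
    {L : Submodule K (Fin 4 → K)} (hL : L ∈ lines F) :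
    extendScalars k L ∈ lines (map φ F) := by
  obtain ⟨x, y, hxy, rfl⟩ := exists_eq_span_pair hL.1
  have hF' : (map φ F).IsHomogeneous 4 := hF.map φ
  rw [extendScalars_span_pair]
  constructor
  · have h2 := finrank_span_eq_card (linearIndependent_pair_algebraMap (k := k).2 hxy)
    rwa [Matrix.range_cons, Matrix.range_cons, Matrix.range_empty, Set.union_empty,
      Set.singleton_union, Fintype.card_fin] at h2
  · intro v hv
    obtain ⟨s, t, rfl⟩ := Submodule.mem_span_pair.1 hv
    have h0 : linePoly F x y = 0 := by
      refine Polynomial.funext fun t => ?_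
      rw [eval_linePoly, Polynomial.eval_zero]
      exact hL.2 _ (Submodule.mem_span_pair.2 ⟨1, t, by simp⟩)
    rw [eval_add_smul_of_isHomogeneous hF', ← map_linePoly, h0]
    simp

lemma injOn_extendScalars (F : Poly4 K) : Set.InjOn (extendScalars k) (lines F) := by
  intro L hL L' hL' h
  ext v
  rw [← comp_mem_extendScalars (k := k) hL.1, ← comp_mem_extendScalars (k := k) hL'.1, h]

lemma encard_lines_le_map [Infinite K] [Infinite k] {F : Poly4 K} (hF : F.IsHomogeneous 4) :
    (lines F).encard ≤ (lines (map φ F)).encard :=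
  Set.encard_le_encard_of_injOn (fun _ hL => extendScalars_mem_lines hF hL) (injOn_extendScalars F)

/-- An injection into a finite set that is no larger is onto. -/
lemma exists_eq_extendScalars [Infinite K] [Infinite k] {F : Poly4 K} (hF : F.IsHomogeneous 4)
    (h : (lines (map φ F)).encard ≤ (lines F).encard) (hfin : (lines F).encard ≠ ⊤)
    {L : Submodule k (Fin 4 → k)} (hL : L ∈ lines (map φ F)) :
    ∃ L' ∈ lines F, L = extendScalars k L' := by
  have h1 : extendScalars k '' lines F ⊆ lines (map φ F) := by
    rintro _ ⟨L', hL', rfl⟩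
    exact extendScalars_mem_lines hF hL'
  have hfin' : (lines (map φ F)).Finite := by
    rw [← Set.encard_ne_top_iff]
    exact ne_top_of_le_ne_top hfin h
  have h2 := hfin'.eq_of_subset_of_encard_le' h1 (by
    rwa [(injOn_extendScalars F).encard_image])
  rw [← h2] at hL
  obtain ⟨L', hL', rfl⟩ := hL
  exact ⟨L', hL', rfl⟩

end BaseChangeLines

/-! ### Singularities in monoid coordinates. -/

section Smooth

variable {K : Type*} [Field K]

lemma coeff_one_linePoly_monoidForm [Infinite K] (f g : MvPolynomial (Fin 3) K)
    (x w : Fin 4 → K) : (linePoly (monoidForm f g) x w).coeff 1 =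
      w 3 * eval (x ∘ Fin.castSucc) f + ∑ i : Fin 3, w i.castSucc *
        (x 3 * eval (x ∘ Fin.castSucc) (pderiv i f) + eval (x ∘ Fin.castSucc) (pderiv i g)) := by
  have h : linePoly (monoidForm f g) x w =
      (Polynomial.C (x 3) + Polynomial.C (w 3) * Polynomial.X) *
        linePoly f (x ∘ Fin.castSucc) (w ∘ Fin.castSucc) +
        linePoly g (x ∘ Fin.castSucc) (w ∘ Fin.castSucc) := by
    refine Polynomial.funext fun t => ?_
    rw [eval_linePoly, eval_monoidForm, show (x + t • w) ∘ Fin.castSucc =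
      x ∘ Fin.castSucc + t • (w ∘ Fin.castSucc) from rfl]
    simp only [Polynomial.eval_add, Polynomial.eval_mul, Polynomial.eval_C, Polynomial.eval_X,
      eval_linePoly, Pi.add_apply, Pi.smul_apply, smul_eq_mul]
    ring
  rw [h, Polynomial.coeff_add, add_mul, Polynomial.coeff_add, Polynomial.coeff_C_mul, mul_assoc,
    Polynomial.coeff_C_mul, Polynomial.coeff_X_mul, coeff_zero_linePoly, coeff_one_linePoly,
    coeff_one_linePoly]
  simp only [mul_add, Finset.sum_add_distrib, Finset.mul_sum, Function.comp_apply]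
  rw [add_comm (∑ i, x 3 * _), add_assoc]
  congr 2
  exact Finset.sum_congr rfl fun i _ => by ring

lemma linePoly_changeCoord [Infinite K] (M : Matrix (Fin 4) (Fin 4) K) (F : Poly4 K)
    (x w : Fin 4 → K) : linePoly (changeCoord M F) x w =
      linePoly F (Matrix.mulVec M x) (Matrix.mulVec M w) := by
  refine Polynomial.funext fun t => ?_
  rw [eval_linePoly, eval_linePoly, eval_changeCoord, Matrix.mulVec_add, Matrix.mulVec_smul]

/-- If t ∇f + ∇g = 0 at a common zero v ≠ 0, all directional derivatives vanish at (v, t). This is a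
singular point of the surface over the closure, and it projects to v ≠ 0, so it is not the triple
point. -/
lemma smoothOff_of_noOtherSingularity [Infinite K] {F : Poly4 K} {p : Fin 4 → K}
    (hs : NoOtherSingularity F p) {M : Matrix (Fin 4) (Fin 4) K}
    (hM : M.det ≠ 0) (hMp : ∀ i, M i 3 = p i) {f g : MvPolynomial (Fin 3) K}
    (hfg : changeCoord M F = monoidForm f g) :
    SmoothOff (map (algebraMap K (AlgebraicClosure K)) f)
      (map (algebraMap K (AlgebraicClosure K)) g) := by
  set k := AlgebraicClosure K
  set ψ := algebraMap K k with hψ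
  have : Infinite k := IsAlgClosed.instInfinite
  intro v hv hfv hgv t
  by_contra! hcon
  set N := M.map ψ with hN
  have hNdet : N.det ≠ 0 := by
    rw [hN, ← RingHom.mapMatrix_apply, ← RingHom.map_det]
    exact (map_ne_zero ψ).2 hM
  have hG : changeCoord N (map ψ F) = monoidForm (map ψ f) (map ψ g) := by
    rw [← map_monoidForm, ← hfg]
    exact (map_linSubst M F).symm
  set x : Fin 4 → k := Fin.snoc (α := fun _ => k) v t with hx
  have hx' : x ∘ Fin.castSucc = v := by
    funext i
    simp [hx]
  have hx3 : x 3 = t := Fin.snoc_last (α := fun _ => k) _ _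
  have hx0 : x ≠ 0 := by
    intro h
    rw [h] at hx'
    exact hv hx'.symm
  have hderiv : ∀ w, (linePoly (map ψ F) (Matrix.mulVec N x) (Matrix.mulVec N w)).coeff 1 = 0 := by
    intro w
    rw [← linePoly_changeCoord, hG, coeff_one_linePoly_monoidForm, hx', hx3, hfv, mul_zero,
      zero_add]
    exact Finset.sum_eq_zero fun i _ => mul_eq_zero_of_right _ (hcon i)
  obtain ⟨c, hc⟩ := hs (Matrix.mulVec N x) (fun h => hx0 (by
      rw [← inv_mulVec_mulVec hNdet x, h, Matrix.mulVec_zero])) (by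
      rw [aeval_def, ← eval_map, ← hψ, ← eval_changeCoord, hG, eval_monoidForm, hx', hfv, hgv]
      simp) fun j => by
      rw [aeval_def, ← eval_map, ← hψ, ← pderiv_map]
      have h1 := hderiv (Matrix.mulVec N⁻¹ (Pi.single j 1))
      rw [mulVec_mulVec_inv hNdet, coeff_one_linePoly] at h1
      simpa [Pi.single_apply] using h1
  have h2 : Matrix.mulVec N x = Matrix.mulVec N (c • Pi.single 3 1) := by
    rw [hc, Matrix.mulVec_smul, Matrix.mulVec_single_one]
    funext i
    simp [hN, hMp]
    exact Or.inl rfl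
  have h3 : x = c • Pi.single 3 1 := by
    rw [← inv_mulVec_mulVec hNdet x, h2, inv_mulVec_mulVec hNdet]
  apply hv
  rw [← hx', h3]
  funext i
  have h4 : i.castSucc ≠ (3 : Fin 4) := (Fin.castSucc_lt_last i).ne
  simp [h4]

end Smooth

end QuarticMonoid

open MvPolynomial

namespace QuarticMonoid

/-! ### Rationality of the twelve points. -/

section Descent

variable {K k : Type*} [Field K] [Field k] [Algebra K k]

local notation "φ" => algebraMap K k

lemma dotProduct_algebraMap_comp {n : ℕ} (c v : Fin n → K) :
    (φ ∘ c) ⬝ᵥ (φ ∘ v) = φ (c ⬝ᵥ v) := by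
  simp [dotProduct]

/-- If all lines of a monoid are defined over a smaller field, so are the zeros of `f` and `g`. -/
lemma exists_eq_smul_comp [Infinite K] [Infinite k] {f g : MvPolynomial (Fin 3) K}
    (hF : (monoidForm f g).IsHomogeneous 4)
    (h : (lines (map φ (monoidForm f g))).encard ≤ (lines (monoidForm f g)).encard)
    (hfin : (lines (monoidForm f g)).encard ≠ ⊤) {z : Fin 3 → k} (hz : z ≠ 0)
    (hfz : ∀ r : k, eval (r • z) (map φ f) = 0) (hgz : ∀ r : k, eval (r • z) (map φ g) = 0) :
    ∃ (q : Fin 3 → K) (t : k), t ≠ 0 ∧ φ ∘ q = t • z := by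
  set L := Submodule.span k {(Pi.single 3 1 : Fin 4 → k), Fin.snoc (α := fun _ => k) z 0} with hL
  have hcomp : ∀ x ∈ L, ∃ t : k, x ∘ Fin.castSucc = t • z := by
    intro x hx
    obtain ⟨s, t, rfl⟩ := Submodule.mem_span_pair.1 hx
    refine ⟨t, ?_⟩
    funext i
    have h1 : i.castSucc ≠ (3 : Fin 4) := (Fin.castSucc_lt_last i).ne
    simp [h1]
  have hmem : L ∈ lines (map φ (monoidForm f g)) := by
    refine ⟨finrank_span_snoc hz, fun x hx => ?_⟩
    obtain ⟨t, ht⟩ := hcomp x hx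
    rw [map_monoidForm, eval_monoidForm, ht, hfz, hgz, mul_zero, add_zero]
  -- The line joining the triple point to `z` lies on the surface over k, hence comes from K; a
  -- K-rational point on it off the triple point projects to a multiple of `z`.
  obtain ⟨L', hL', hLL'⟩ := exists_eq_extendScalars hF h hfin hmem
  obtain ⟨x, hx, hx0⟩ := exists_mem_comp_ne_zero hL'.1
  have h1 : φ ∘ x ∈ L := by
    rw [hLL', comp_mem_extendScalars hL'.1]
    exact hx
  obtain ⟨t, ht⟩ := hcomp _ h1
  refine ⟨x ∘ Fin.castSucc, t, ?_, ht⟩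
  rintro rfl
  apply hx0
  funext i
  have := congrFun ht i
  rw [zero_smul] at this
  exact (map_eq_zero φ).1 this

/-- Twelve points in the model configuration, defined over a smaller field. -/
lemma exists_isModel [Infinite K] [Infinite k] {f : MvPolynomial (Fin 3) K}
    (hf : f.IsHomogeneous 3) {e : Fin 12 → Fin 3 → k}
    (he : ∀ i j, i ≠ j → LinearIndependent k ![e i, e j]) (hfe : ∀ i, eval (e i) (map φ f) = 0)
    (hline : ∀ c : Fin 3 → K, c ≠ 0 → ∃ R, c ⬝ᵥ R = 0 ∧ eval R f ≠ 0)
    (hmodel : ∀ l ∈ TripleSystem.model, ∃ c : Fin 3 → k, c ≠ 0 ∧ c ⬝ᵥ e l.1 = 0 ∧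
      c ⬝ᵥ e l.2.1 = 0 ∧ c ⬝ᵥ e l.2.2 = 0) {q : Fin 12 → Fin 3 → K} {t : Fin 12 → k}
    (ht : ∀ i, t i ≠ 0) (hq : ∀ i, φ ∘ q i = t i • e i) : IsModel q := by
  have hli : ∀ i j, i ≠ j → LinearIndependent K ![q i, q j] := by
    intro i j hij
    rw [← linearIndependent_pair_algebraMap (k := k), hq, hq, LinearIndependent.pair_iff]
    intro a b h
    rw [smul_smul, smul_smul] at h
    obtain ⟨h1, h2⟩ := LinearIndependent.pair_iff.1 (he i j hij) _ _ h
    exact ⟨(mul_eq_zero.1 h1).resolve_right (ht i), (mul_eq_zero.1 h2).resolve_right (ht j)⟩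
  have hfq : ∀ i, eval (q i) f = 0 := by
    intro i
    apply (algebraMap K k).injective
    rw [← eval_map_comp, hq, eval_smul_of_isHomogeneous (hf.map φ), hfe, mul_zero, map_zero]
  refine ⟨hli, fun l hl => ?_⟩
  have hne : l.1 ≠ l.2.1 ∧ l.1 ≠ l.2.2 ∧ l.2.1 ≠ l.2.2 := by
    have h : TripleSystem.model.all
        (fun l => l.1 ≠ l.2.1 ∧ l.1 ≠ l.2.2 ∧ l.2.1 ≠ l.2.2) = true := by decide
    simpa using List.all_eq_true.1 h l hl
  obtain ⟨d, hd, h1, h2, h3⟩ := hmodel l hl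
  obtain ⟨c, hc, h1', h2'⟩ := exists_dotProduct_eq_zero (q l.1) (q l.2.1)
  have hdq : ∀ i, d ⬝ᵥ e i = 0 → d ⬝ᵥ (φ ∘ q i) = 0 := by
    intro i h
    rw [hq, dotProduct_smul, h, smul_zero]
  have hc0 : (φ ∘ c) ≠ 0 := by
    intro h
    apply hc
    funext i
    exact (map_eq_zero φ).1 (congrFun h i)
  obtain ⟨r, hr⟩ := exists_smul_of_dotProduct_eq_zero hd
    (linearIndependent_pair_algebraMap.2 (hli _ _ hne.1)) (hdq _ h1) (hdq _ h2)
    (c' := φ ∘ c) (by rw [dotProduct_algebraMap_comp, h1', map_zero])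
    (by rw [dotProduct_algebraMap_comp, h2', map_zero])
  have h3' : c ⬝ᵥ q l.2.2 = 0 := by
    apply (algebraMap K k).injective
    rw [← dotProduct_algebraMap_comp, hr, smul_dotProduct, hdq _ h3, smul_zero, map_zero]
  refine ⟨c, h1', h2', h3', fun m hm1 hm2 hm3 hm => ?_⟩
  obtain ⟨R, hR, hfR⟩ := hline c hc
  refine hfR (eval_eq_zero_of_card_lt (d := 2) hf hc (p := q)
    (S := {l.1, l.2.1, l.2.2, m}) (fun i _ j _ hij => hli i j hij) ?_ ?_ (fun i _ => hfq i) R hR)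
  · rw [Finset.card_insert_of_notMem (by simp [hne, hm1.symm]),
      Finset.card_insert_of_notMem (by simp [hne, hm2.symm]),
      Finset.card_insert_of_notMem (by simp [hm3.symm])]
    simp
  · intro i hi
    simp only [Finset.mem_insert, Finset.mem_singleton] at hi
    rcases hi with rfl | rfl | rfl | rfl
    exacts [h1', h2', h3', hm]

end Descent

/-! ### The bound over K and the surfaces that attain it. -/

section Maximum

variable {K : Type*} [Field K] [CharZero K]

lemma encard_lines_le_encard_lines_map {F : Poly4 K} (hF : F.IsHomogeneous 4)
    {M : Matrix (Fin 4) (Fin 4) K} (hM : M.det ≠ 0) {f g : MvPolynomial (Fin 3) K}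
    (hfg : changeCoord M F = monoidForm f g) :
    (monoidForm f g).IsHomogeneous 4 ∧ (lines F).encard = (lines (monoidForm f g)).encard ∧
    (lines (monoidForm f g)).encard ≤ (lines (monoidForm
      (map (algebraMap K (AlgebraicClosure K)) f)
      (map (algebraMap K (AlgebraicClosure K)) g))).encard := by
  have h4 : (monoidForm f g).IsHomogeneous 4 := by
    rw [← hfg]
    exact IsHomogeneous.linSubst M hF
  refine ⟨h4, by rw [← hfg, encard_lines_changeCoord hM], ?_⟩
  have : Infinite (AlgebraicClosure K) := IsAlgClosed.instInfinite
  rw [← map_monoidForm]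
  exact encard_lines_le_map h4

theorem IsQuarticMonoid.encard_lines_le {F : Poly4 K} {p : Fin 4 → K} (hF : IsQuarticMonoid F p)
    (hs : NoOtherSingularity F p) : (lines F).encard ≤ 31 := by
  obtain ⟨M, f, g, hM, hMp, hf, hg, hf0, hfg⟩ := exists_eq_monoidForm hF
  obtain ⟨-, h1, h2⟩ := encard_lines_le_encard_lines_map hF.1 hM hfg
  rw [h1]
  refine h2.trans (QuarticMonoid.encard_lines_le (hf.map _) (hg.map _) ?_
    (smoothOff_of_noOtherSingularity hs hM hMp hfg)).1
  rwa [ne_eq, map_eq_zero_iff _ (map_injective _ (algebraMap K _).injective)]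

/-- The count over K is squeezed against the bound 31 over the closure, so all lines there are
defined over K; the model configuration found over the closure then descends to K. -/
theorem IsQuarticMonoid.exists_projEquiv_Qab {F : Poly4 K} {p : Fin 4 → K}
    (hF : IsQuarticMonoid F p) (hs : NoOtherSingularity F p) (h31 : (lines F).encard = 31) :
    ∃ a b : K, a ∉ ({-2, -1, -1 / 2, 0, 1} : Set K) ∧ b ≠ 0 ∧ ProjEquiv F (Qab a b) := by
  obtain ⟨M, f, g, hM, hMp, hf, hg, hf0, hfg⟩ := exists_eq_monoidForm hF
  obtain ⟨h4, h1, h2⟩ := encard_lines_le_encard_lines_map hF.1 hM hfg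
  set k := AlgebraicClosure K
  set ψ := algebraMap K k
  have hInf : Infinite k := IsAlgClosed.instInfinite
  have hfψ := hf.map ψ
  have hgψ := hg.map ψ
  have hf0' : map ψ f ≠ 0 := by
    rwa [ne_eq, map_eq_zero_iff _ (map_injective _ ψ.injective)]
  have hsm := smoothOff_of_noOtherSingularity hs hM hMp hfg
  have hrel := isRelPrime_of_smoothOff hfψ hgψ hf0' hsm
  obtain ⟨hle, heq⟩ := QuarticMonoid.encard_lines_le hfψ hgψ hf0' hsm
  rw [h31] at h1
  rw [← h1] at h2
  obtain ⟨e, he, hfe, hge, hlinek, hmodel⟩ := heq (le_antisymm hle h2)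
  have hline : ∀ c : Fin 3 → K, c ≠ 0 → ∃ R, c ⬝ᵥ R = 0 ∧ eval R f ≠ 0 := by
    intro c hc
    by_contra! h
    obtain ⟨R, hR, hfR⟩ := hlinek (ψ ∘ c) (fun h => hc (by
      funext i
      exact (map_eq_zero ψ).1 (congrFun h i)))
    obtain ⟨u, hu⟩ := linForm_dvd hc h
    rw [hu, map_mul, map_linForm, map_mul, eval_linForm] at hfR
    exact hfR (mul_eq_zero_of_left hR _)
  have hex : ∀ i, ∃ (q : Fin 3 → K) (t : k), t ≠ 0 ∧ ψ ∘ q = t • e i := by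
    intro i
    obtain ⟨j, hj⟩ : ∃ j : Fin 12, i ≠ j := ⟨i + 1, by revert i; decide⟩
    refine exists_eq_smul_comp h4 ?_ ?_ ((he i j hj).ne_zero 0) (fun r => ?_) (fun r => ?_)
    · rw [← h1, map_monoidForm]
      exact hle
    · rw [← h1]
      exact ENat.natCast_ne_top 31
    · rw [eval_smul_of_isHomogeneous hfψ, hfe, mul_zero]
    · rw [eval_smul_of_isHomogeneous hgψ, hge, mul_zero]
  choose q t ht hq using hex
  have hvan : ∀ {d : ℕ} {G : MvPolynomial (Fin 3) K}, G.IsHomogeneous d →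
      (∀ i, eval (e i) (map ψ G) = 0) → ∀ i, eval (q i) G = 0 := by
    intro d G hG hGe i
    apply ψ.injective
    rw [← eval_map_comp, hq, eval_smul_of_isHomogeneous (hG.map ψ), hGe, mul_zero, map_zero]
  obtain ⟨a, b, ha, hb, hab⟩ := QuarticMonoid.exists_projEquiv_Qab hf hg
    (exists_isModel hf he hfe hline hmodel ht hq) (hvan hf hfe) (hvan hg hge) hline (by
      rintro l rfl
      have h3 := hrel dvd_rfl (by rw [map_mul]; exact Dvd.intro_left _ rfl)
      have h5 := h3.map (eval (0 : Fin 3 → k))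
      have h6 := eval_smul_of_isHomogeneous hfψ 0 0
      rw [zero_smul, zero_pow (by norm_num), zero_mul] at h6
      rw [h6] at h5
      exact not_isUnit_zero h5)
  refine ⟨a, b, ha, hb, ProjEquiv.trans ?_ hab⟩
  refine ⟨Matrix.GeneralLinearGroup.mkOfDetNeZero M hM, 1, one_ne_zero, ?_⟩
  rw [C_1, one_mul, ← hfg]
  rfl

end Maximum

end QuarticMonoid

open MvPolynomial

namespace QuarticMonoid

/-! ### Lower bound for the number of lines. -/

section CountBelow

variable {k : Type*} [Field k]

lemma exists_isGraph_of_ne_zero {c : Fin 3 → k} (hc : c ≠ 0) (l : Fin 3 → k) :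
    ∃ L : Submodule k (Fin 4 → k), Module.finrank k L = 2 ∧ IsGraph L c l := by
  obtain ⟨v, w, hvw, hv, hw⟩ := exists_linearIndependent_pair hc
  set V : Fin 4 → k := Fin.snoc (α := fun _ => k) v (l ⬝ᵥ v) with hV
  set W : Fin 4 → k := Fin.snoc (α := fun _ => k) w (l ⬝ᵥ w) with hW
  have hV' : ∀ s t : k, (s • V + t • W) ∘ Fin.castSucc = s • v + t • w := by
    intro s t
    funext i
    simp [hV, hW]
  have hV3 : ∀ s t : k, (s • V + t • W) 3 = l ⬝ᵥ (s • v + t • w) := by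
    intro s t
    have h1 : V 3 = l ⬝ᵥ v := Fin.snoc_last (α := fun _ => k) _ _
    have h2 : W 3 = l ⬝ᵥ w := Fin.snoc_last (α := fun _ => k) _ _
    simp [h1, h2]
  have hli : LinearIndependent k ![V, W] := by
    rw [LinearIndependent.pair_iff]
    intro s t h
    refine LinearIndependent.pair_iff.1 hvw s t ?_
    rw [← hV', h]
    rfl
  refine ⟨Submodule.span k {V, W}, ?_, hc, fun x => ⟨?_, ?_⟩⟩
  · have h2 := finrank_span_eq_card hli
    rwa [Matrix.range_cons, Matrix.range_cons, Matrix.range_empty, Set.union_empty,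
      Set.singleton_union, Fintype.card_fin] at h2
  · intro hx
    obtain ⟨s, t, rfl⟩ := Submodule.mem_span_pair.1 hx
    rw [hV', hV3]
    simp [hv, hw]
  · rintro ⟨hx, hx3⟩
    obtain ⟨s, t, hst⟩ := exists_combination hc hvw hv hw hx
    refine Submodule.mem_span_pair.2 ⟨s, t, ?_⟩
    funext i
    refine Fin.lastCases ?_ (fun j => ?_) i
    · exact (hV3 s t).trans (by rw [← hst, ← hx3]; rfl)
    · exact congrFun ((hV' s t).trans hst.symm) j

lemma IsGraph.single_notMem {L : Submodule k (Fin 4 → k)} {c l : Fin 3 → k}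
    (hG : IsGraph L c l) : Pi.single 3 1 ∉ L := by
  intro h
  have h0 : (Pi.single 3 1 : Fin 4 → k) ∘ Fin.castSucc = 0 := by
    funext i
    have h1 : i.castSucc ≠ (3 : Fin 4) := (Fin.castSucc_lt_last i).ne
    simp [h1]
  have h3 := ((hG.mem_iff _).1 h).2
  rw [h0] at h3
  simp at h3

lemma IsGraph.dotProduct_eq_zero {L : Submodule k (Fin 4 → k)} {c l c' l' : Fin 3 → k}
    (hG : IsGraph L c l) (hG' : IsGraph L c' l') {u : Fin 3 → k} (hu : c ⬝ᵥ u = 0) :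
    c' ⬝ᵥ u = 0 := by
  have h0 : (Fin.snoc (α := fun _ => k) u (l ⬝ᵥ u) : Fin 4 → k) ∘ Fin.castSucc = u := by
    funext i
    simp
  have h1 := (hG.mem_iff (Fin.snoc (α := fun _ => k) u (l ⬝ᵥ u))).2 (by
    rw [h0]
    exact ⟨hu, Fin.snoc_last (α := fun _ => k) _ _⟩)
  have h2 := ((hG'.mem_iff _).1 h1).1
  rwa [h0] at h2

/-- The lines joining the triple point to the common zeros of `f` and `g`, and those over the
trisecants. -/
theorem card_add_card_trisecants_le [Infinite k] {f g : MvPolynomial (Fin 3) k}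
    (hf : f.IsHomogeneous 3) (hg : g.IsHomogeneous 4) {ι : Type*} [Fintype ι]
    {p : ι → Fin 3 → k} (hp : ∀ i j, i ≠ j → LinearIndependent k ![p i, p j]) (hp0 : ∀ i, p i ≠ 0)
    (hfp : ∀ i, eval (p i) f = 0) (hgp : ∀ i, eval (p i) g = 0) :
    ((Fintype.card ι + (trisecants f p).card : ℕ) : ℕ∞) ≤ (lines (monoidForm f g)).encard := by
  classical
  set A : ι → Submodule k (Fin 4 → k) := fun i =>
    Submodule.span k {Pi.single 3 1, Fin.snoc (α := fun _ => k) (p i) 0} with hA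
  have hcomp : ∀ i, ∀ x ∈ A i, ∃ t : k, x ∘ Fin.castSucc = t • p i := by
    intro i x hx
    obtain ⟨s, t, rfl⟩ := Submodule.mem_span_pair.1 hx
    refine ⟨t, ?_⟩
    funext j
    have h1 : j.castSucc ≠ (3 : Fin 4) := (Fin.castSucc_lt_last j).ne
    simp [h1]
  have hAmem : ∀ i, A i ∈ lines (monoidForm f g) := by
    intro i
    refine ⟨finrank_span_snoc (hp0 i), fun x hx => ?_⟩
    obtain ⟨t, ht⟩ := hcomp i x hx
    rw [eval_monoidForm, ht, eval_smul_of_isHomogeneous hf, eval_smul_of_isHomogeneous hg, hfp,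
      hgp, mul_zero, mul_zero, mul_zero, add_zero]
  have hAinj : Function.Injective A := by
    intro i j hij
    by_contra hne
    have h1 : (Fin.snoc (α := fun _ => k) (p i) 0 : Fin 4 → k) ∈ A j := by
      rw [← hij]
      exact Submodule.subset_span (by simp)
    obtain ⟨t, ht⟩ := hcomp j _ h1
    have h2 : p i = t • p j := by
      rw [← ht]
      funext m
      simp
    exact one_ne_zero (LinearIndependent.pair_iff.1 (hp i j hne) 1 (-t) (by rw [h2]; module)).1
  have hex : ∀ t ∈ trisecants f p, ∃ L ∈ lines (monoidForm f g), ∃ c l, IsGraph L c l ∧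
      IsTrisecant f p c t := by
    intro t ht
    obtain ⟨c, hc⟩ := mem_trisecants.1 ht
    obtain ⟨R, hR, hfR⟩ := hc.exists_eval_ne_zero
    -- Along the trisecant g = l f, so the graph t = -l lies on the surface.
    obtain ⟨l, H, -, hgl⟩ := exists_eq_linForm_mul_add hf hg hp hc.ne_zero hR hfR hc.card_eq
      hc.dotProduct_eq_zero (fun i _ => hfp i) (fun i _ => hgp i)
    obtain ⟨L, hL, hG⟩ := exists_isGraph_of_ne_zero hc.ne_zero (-l)
    refine ⟨L, ⟨hL, fun x hx => ?_⟩, c, -l, hG, hc⟩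
    obtain ⟨h1, h2⟩ := (hG.mem_iff x).1 hx
    rw [eval_monoidForm, h2, hgl]
    simp only [map_add, map_mul, eval_linForm, h1, neg_dotProduct]
    ring
  choose! B hB c l hG hc using hex
  have hBinj : Set.InjOn B (trisecants f p) := by
    intro t ht t' ht' h
    obtain ⟨i, hi, j, hj, hij⟩ := Finset.one_lt_card.1 (show 1 < t.card by
      rw [(hc t ht).card_eq]; norm_num)
    have hdot : ∀ i ∈ t, c t' ⬝ᵥ p i = 0 := fun i hi =>
      (hG t ht).dotProduct_eq_zero (h ▸ hG t' ht') ((hc t ht).dotProduct_eq_zero i hi)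
    exact (hc t ht).eq hf hp hfp (hc t' ht') hij (hdot i hi) (hdot j hj) hi hj
  have hdisj : Disjoint (Set.range A) (B '' (trisecants f p)) := by
    rw [Set.disjoint_left]
    rintro _ ⟨i, rfl⟩ ⟨t, ht, h⟩
    apply (hG t ht).single_notMem
    rw [h]
    exact Submodule.subset_span (by simp)
  calc ((Fintype.card ι + (trisecants f p).card : ℕ) : ℕ∞)
      = (Set.range A ∪ B '' (trisecants f p)).encard := by
        rw [Set.encard_union_eq hdisj, hBinj.encard_image, Set.encard_coe_eq_coe_finsetCard,
          ← Set.image_univ, hAinj.encard_image, Set.encard_univ, ENat.card_eq_coe_fintype_card]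
        norm_cast
    _ ≤ _ := Set.encard_le_encard (by
        rintro _ (⟨i, rfl⟩ | ⟨t, ht, rfl⟩)
        exacts [hAmem i, hB t ht])

end CountBelow

end QuarticMonoid

open MvPolynomial

namespace QuarticMonoid

/-! ### Multiplicity of a monoid form at the triple point. -/

section IterPartial

variable {K : Type*} [Field K]

lemma pderiv_castSucc_monoidForm (f g : MvPolynomial (Fin 3) K) (i : Fin 3) :
    pderiv i.castSucc (monoidForm f g) = monoidForm (pderiv i f) (pderiv i g) := by
  have h : (3 : Fin 4) ≠ i.castSucc := (Fin.castSucc_lt_last i).ne'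
  simp only [monoidForm, map_add, pderiv_mul, pderiv_X_of_ne h, zero_mul, zero_add,
    pderiv_rename (Fin.castSucc_injective 3)]

lemma pderiv_three_monoidForm (f g : MvPolynomial (Fin 3) K) :
    pderiv 3 (monoidForm f g) = monoidForm 0 f := by
  classical
  have h : ∀ f : MvPolynomial (Fin 3) K, pderiv 3 (rename Fin.castSucc f) = 0 := by
    intro f
    refine pderiv_eq_zero_of_notMem_vars fun h => ?_
    obtain ⟨i, -, hi⟩ := Finset.mem_image.1 (vars_rename _ f h)
    exact (Fin.castSucc_lt_last i).ne hi
  simp [monoidForm, h]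

/-- The shape t a + b is preserved: a plane derivative acts on both forms, and the derivative in t
turns the pair (a, b) into (0, a). -/
lemma iterPartial_monoidForm {f g : MvPolynomial (Fin 3) K} (hf : f.IsHomogeneous 3)
    (hg : g.IsHomogeneous 4) (l : List (Fin 4)) :
    ∃ a b : MvPolynomial (Fin 3) K, a.IsHomogeneous (3 - l.length) ∧
      b.IsHomogeneous (4 - l.length) ∧ (l.length ≤ 3 → iterPartial (monoidForm f g) l = monoidForm a b) := by
  induction l with
  | nil => exact ⟨f, g, hf, hg, fun _ => rfl⟩
  | cons i l ih =>
    obtain ⟨a, b, ha, hb, h⟩ := ih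
    rw [List.length_cons, ← Nat.sub_sub, ← Nat.sub_sub]
    refine Fin.lastCases ?_ (fun j => ?_) i
    · by_cases hl : l.length ≤ 3
      · refine ⟨0, a, isHomogeneous_zero _ _ _, ?_, fun _ => ?_⟩
        · rwa [show 4 - l.length - 1 = 3 - l.length by omega]
        · rw [← pderiv_three_monoidForm a b, ← h hl]
          rfl
      · exact ⟨0, 0, isHomogeneous_zero _ _ _, isHomogeneous_zero _ _ _, fun h' => by
          change l.length + 1 ≤ 3 at h'
          omega⟩
    · refine ⟨pderiv j a, pderiv j b, ha.pderiv, hb.pderiv, fun hl => ?_⟩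
      change l.length + 1 ≤ 3 at hl
      rw [← pderiv_castSucc_monoidForm, ← h (by omega)]
      rfl

/-- At the triple point the plane coordinates are zero, and after at most two derivatives both forms
still have positive degree. -/
lemma isQuarticMonoid_monoidForm {f g : MvPolynomial (Fin 3) K} (hf : f.IsHomogeneous 3)
    (hg : g.IsHomogeneous 4) (h4 : (monoidForm f g).IsHomogeneous 4)
    (h : ∃ l : List (Fin 4), l.length = 3 ∧
      eval (Pi.single 3 1) (iterPartial (monoidForm f g) l) ≠ 0) :
    IsQuarticMonoid (monoidForm f g) (Pi.single 3 1) := by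
  refine ⟨h4, fun h => one_ne_zero (α := K) (by simpa using congrFun h 3), fun l hl => ?_, h⟩
  obtain ⟨a, b, ha, hb, hab⟩ := iterPartial_monoidForm hf hg l
  have h0 : (Pi.single 3 1 : Fin 4 → K) ∘ Fin.castSucc = 0 := by
    funext i
    have h1 : i.castSucc ≠ (3 : Fin 4) := (Fin.castSucc_lt_last i).ne
    simp [h1]
  have hz : ∀ {d : ℕ} {G : MvPolynomial (Fin 3) K}, G.IsHomogeneous (d + 1) → eval 0 G = 0 := by
    intro d G hG
    have := eval_smul_of_isHomogeneous hG 0 0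
    simpa using this
  rw [hab (by omega), eval_monoidForm, h0]
  rw [show 3 - l.length = (2 - l.length) + 1 by omega] at ha
  rw [show 4 - l.length = (3 - l.length) + 1 by omega] at hb
  rw [hz ha, hz hb, mul_zero, add_zero]

end IterPartial

/-! ### The integral example a = 2, b = 1. -/

section Forms

variable {K : Type*} [Field K]

lemma Qab_eq_monoidForm [Infinite K] (a b : K) : Qab a b = monoidForm (linSubst (planeMatrix K) (F3 a))
    (C b * linSubst (planeMatrix K) (F4 a)) := by
  apply MvPolynomial.funext
  intro v
  rw [eval_Qab, eval_monoidForm, map_mul, eval_linSubst, eval_linSubst, planeMatrix_mulVec, eval_F3,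
    eval_F3, eval_F4, eval_F4, eval_C]
  simp only [Function.comp_apply, Matrix.cons_val]
  rfl

lemma isHomogeneous_C_mul_linSubst_F4 (a b : K) :
    (C b * linSubst (planeMatrix K) (F4 a)).IsHomogeneous 4 := by
  have h := (isHomogeneous_C (Fin 3) b).mul
    (IsHomogeneous.linSubst (planeMatrix K) (isHomogeneous_F4 a))
  rwa [zero_add] at h

/-- Integral coordinates of the common zeros of `F₃(2)` and `F₄(2)`. -/
def zeroPoint : Fin 12 → Fin 3 → ℤ :=
  ![![2, 0, 1], ![0, 2, 1], ![1, -1, 1], ![3, 1, 5], ![1, -1, 2], ![3, 1, 4], ![1, 0, 1],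
    ![0, 1, 1], ![3, -1, 3], ![1, 1, 3], ![0, 0, 1], ![2, 2, 3]]

/-- The cubic form `F₃(2)` over the integers. -/
def cubicForm (v : Fin 3 → ℤ) : ℤ :=
  v 0 * v 0 * v 0 + 19 * (v 0 * v 0 * v 1) - 3 * (v 0 * v 0 * v 2) + 13 * (v 0 * v 1 * v 1) +
    2 * (v 0 * v 2 * v 2) - 24 * (v 0 * v 1 * v 2) + 3 * (v 1 * v 1 * v 1) -
    9 * (v 1 * v 1 * v 2) + 6 * (v 1 * v 2 * v 2)

/-- The quartic form `F₄(2)` over the integers. -/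
def quarticForm (v : Fin 3 → ℤ) : ℤ :=
  v 1 * (7 * v 0 - v 1 - 4 * v 2) * (7 * v 0 + 3 * v 1 - 6 * v 2) * (4 * v 0 + 2 * v 1 - 2 * v 2)

lemma eval_cubicForm (v : Fin 3 → ℤ) :
    eval (fun i => (v i : K)) (linSubst (planeMatrix K) (F3 2)) = cubicForm v := by
  rw [eval_linSubst, planeMatrix_mulVec, eval_F3]
  simp only [cubicForm, Matrix.cons_val]
  push_cast
  ring

lemma eval_quarticForm (v : Fin 3 → ℤ) :
    eval (fun i => (v i : K)) (C 1 * linSubst (planeMatrix K) (F4 2)) = quarticForm v := by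
  rw [map_mul, eval_linSubst, planeMatrix_mulVec, eval_F4]
  simp only [quarticForm, Matrix.cons_val]
  push_cast
  simp
  ring

/-- The cross product of two of the points. -/
def joinLine (i j : Fin 12) : Fin 3 → ℤ :=
  ![zeroPoint i 1 * zeroPoint j 2 - zeroPoint i 2 * zeroPoint j 1,
    zeroPoint i 2 * zeroPoint j 0 - zeroPoint i 0 * zeroPoint j 2,
    zeroPoint i 0 * zeroPoint j 1 - zeroPoint i 1 * zeroPoint j 0]

/-- A linear form over the integers. -/
def dotForm (c v : Fin 3 → ℤ) : ℤ := c 0 * v 0 + c 1 * v 1 + c 2 * v 2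

lemma dotForm_cast (c v : Fin 3 → ℤ) :
    (fun i => (c i : K)) ⬝ᵥ (fun i => (v i : K)) = dotForm c v := by
  simp [dotProduct, Fin.sum_univ_three, dotForm]

lemma joinLine_ne_zero : ∀ i j, i ≠ j → ∃ m, joinLine i j m ≠ 0 := by decide

end Forms

section Example

variable {K : Type*} [Field K] [CharZero K]

/-- A singular point is a common zero of F₃ and F₄, hence a multiple of one of the twelve points. At
each of these a 2 × 2 minor of the Jacobian of F₃ and F₄ is nonzero, so no t makes t ∇F₃ + ∇F₄
vanish there. -/
lemma eq_zero_of_partials {x y z t : K}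
    (e0 : t * (3 * x ^ 2 + 38 * x * y - 6 * x * z + 13 * y ^ 2 + 2 * z ^ 2 - 24 * y * z) +
      (588 * x ^ 2 * y + 308 * x * y ^ 2 - 756 * x * y * z + 16 * y ^ 3 - 192 * y ^ 2 * z +
        236 * y * z ^ 2) = 0)
    (e1 : t * (19 * x ^ 2 + 26 * x * y - 24 * x * z + 9 * y ^ 2 - 18 * y * z + 6 * z ^ 2) +
      (196 * x ^ 3 + 308 * x ^ 2 * y - 378 * x ^ 2 * z + 48 * x * y ^ 2 - 384 * x * y * z +
        236 * x * z ^ 2 - 24 * y ^ 3 - 18 * y ^ 2 * z + 120 * y * z ^ 2 - 48 * z ^ 3) = 0)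
    (e2 : t * (-3 * x ^ 2 + 4 * x * z - 24 * x * y - 9 * y ^ 2 + 12 * y * z) +
      (-378 * x ^ 2 * y - 192 * x * y ^ 2 + 472 * x * y * z - 6 * y ^ 3 + 120 * y ^ 2 * z -
        144 * y * z ^ 2) = 0)
    (h3 : x ^ 3 + 19 * x ^ 2 * y - 3 * x ^ 2 * z + 13 * x * y ^ 2 + 2 * x * z ^ 2 -
      24 * x * y * z + 3 * y ^ 3 - 9 * y ^ 2 * z + 6 * y * z ^ 2 = 0)
    (h4 : y * (7 * x - y - 4 * z) * (7 * x + 3 * y - 6 * z) * (4 * x + 2 * y - 2 * z) = 0) :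
    x = 0 ∧ y = 0 ∧ z = 0 := by
  have key : ∀ (i : Fin 12) (s : K), x = s * zeroPoint i 0 → y = s * zeroPoint i 1 →
      z = s * zeroPoint i 2 → s = 0 := by
    intro i s hx hy hz
    subst hx hy hz
    have hcube : ∀ D : K, D ≠ 0 → s ^ 3 * D = 0 → s = 0 := fun D hD h =>
      pow_eq_zero_iff (n := 3) (by norm_num) |>.1 ((mul_eq_zero.1 h).resolve_right hD)
    fin_cases i <;> simp only [zeroPoint, Fin.mk_one, Fin.zero_eta, Fin.reduceFinMk,
      Matrix.cons_val, Int.cast_ofNat, Int.cast_one, Int.cast_zero, Int.cast_neg] at e0 e1 e2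
    -- In this and the following cases the coefficients are partial derivatives of F₃ at the point,
    -- so that t cancels; the constant is the resulting minor of the Jacobian.
    · exact hcube (960) (by norm_num) (by linear_combination (2) * e1 - (34) * e0)
    · exact hcube (576) (by norm_num) (by linear_combination (6) * e1 - (6) * e0)
    · exact hcube (-96) (by norm_num) (by linear_combination (-2) * e1 - (2) * e0)
    · exact hcube (1440) (by norm_num) (by linear_combination (-6) * e2 - (12) * e0)
    · exact hcube (960) (by norm_num) (by linear_combination (22) * e2 - (-4) * e0)
    · exact hcube (-576) (by norm_num) (by linear_combination (18) * e2 - (-12) * e0)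
    · exact hcube (-6) (by norm_num) (by linear_combination (-1) * e1 - (1) * e0)
    · exact hcube (-90) (by norm_num) (by linear_combination (-9) * e1 - (-3) * e0)
    · exact hcube (960) (by norm_num) (by linear_combination (-38) * e2 - (36) * e0)
    · exact hcube (-576) (by norm_num) (by linear_combination (-18) * e2 - (12) * e0)
    · exact hcube (-96) (by norm_num) (by linear_combination (2) * e1 - (6) * e0)
    · exact hcube (2880) (by norm_num) (by linear_combination (54) * e2 - (-48) * e0)
  have fin : ∀ (i : Fin 12) (s : K), x = s * zeroPoint i 0 → y = s * zeroPoint i 1 →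
      z = s * zeroPoint i 2 → x = 0 ∧ y = 0 ∧ z = 0 := by
    intro i s hx hy hz
    have := key i s hx hy hz
    simp [hx, hy, hz, this]
  have three : ∀ a b c d : K, d ≠ 0 → d * (a * b * c) = 0 → a = 0 ∨ b = 0 ∨ c = 0 := by
    intro a b c d hd h
    simpa [hd, or_assoc] using h
  simp only [mul_eq_zero, or_assoc] at h4
  -- On each of the four lines of F₄ the cubic splits into three linear factors, which locate three
  -- of the points.
  rcases h4 with h | h | h | h
  · rcases three x (x - z) (x - 2 * z) 1 one_ne_zero (by
      rw [h] at h3; linear_combination h3) with h' | h' | h'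
    · exact fin 10 z (by simp [zeroPoint, h']) (by simp [zeroPoint, h]) (by simp [zeroPoint])
    · exact fin 6 z (by simp [zeroPoint]; linear_combination h') (by simp [zeroPoint, h])
        (by simp [zeroPoint])
    · exact fin 0 z (by simp [zeroPoint]; linear_combination h') (by simp [zeroPoint, h])
        (by simp [zeroPoint])
  · obtain rfl : y = 7 * x - 4 * z := by linear_combination -h
    rcases three (2 * x - z) (3 * x - 2 * z) (5 * x - 3 * z) 60 (by norm_num) (by
      linear_combination h3) with h' | h' | h'
    · exact fin 4 x (by simp [zeroPoint]) (by simp [zeroPoint]; linear_combination 4 * h')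
        (by simp [zeroPoint]; linear_combination -h')
    · exact fin 11 (x / 2) (by simp [zeroPoint])
        (by simp [zeroPoint]; linear_combination 2 * h')
        (by simp [zeroPoint]; linear_combination -h' / 2)
    · exact fin 3 (x / 3) (by simp [zeroPoint])
        (by simp [zeroPoint]; linear_combination 4 / 3 * h')
        (by simp [zeroPoint]; linear_combination -h' / 3)
  · obtain rfl : y = 2 * z - 7 / 3 * x := by linear_combination h / 3
    rcases three x (x - z) (4 * x - 3 * z) (-8 / 3) (by norm_num) (by
      linear_combination h3) with h' | h' | h'
    · exact fin 1 z (by simp [zeroPoint, h']) (by simp [zeroPoint, h', mul_comm])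
        (by simp [zeroPoint])
    · exact fin 8 (x / 3) (by simp [zeroPoint])
        (by simp [zeroPoint]; linear_combination -2 * h')
        (by simp [zeroPoint]; linear_combination -h')
    · exact fin 5 (x / 3) (by simp [zeroPoint])
        (by simp [zeroPoint]; linear_combination -2 / 3 * h')
        (by simp [zeroPoint]; linear_combination -h' / 3)
  · obtain rfl : z = 2 * x + y := by linear_combination -h / 2
    rcases three x (x + y) (x - y) 3 (by norm_num) (by linear_combination h3) with h' | h' | h'
    · exact fin 7 y (by simp [zeroPoint, h']) (by simp [zeroPoint]) (by simp [zeroPoint, h'])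
    · exact fin 2 x (by simp [zeroPoint]) (by simp [zeroPoint]; linear_combination h')
        (by simp [zeroPoint]; linear_combination h')
    · exact fin 9 x (by simp [zeroPoint]) (by simp [zeroPoint]; linear_combination -h')
        (by simp [zeroPoint]; linear_combination -h')

/-- The expanded form is convenient for computing the partial derivatives term by term. -/
lemma Qab_two_one : Qab (2 : K) 1 =
      C (1) * (X 0 ^ 3 * X 3) + C (19) * (X 0 ^ 2 * X 1 * X 3) + C (-3) * (X 0 ^ 2 * X 2 * X
      3) + C (13) * (X 0 * X 1 ^ 2 * X 3) + C (2) * (X 0 * X 2 ^ 2 * X 3) + C (-24) * (X 0 *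
      X 1 * X 2 * X 3) + C (3) * (X 1 ^ 3 * X 3) + C (-9) * (X 1 ^ 2 * X 2 * X 3) + C (6) *
      (X 1 * X 2 ^ 2 * X 3) + C (196) * (X 0 ^ 3 * X 1) + C (154) * (X 0 ^ 2 * X 1 ^ 2) + C
      (-378) * (X 0 ^ 2 * X 1 * X 2) + C (16) * (X 0 * X 1 ^ 3) + C (-192) * (X 0 * X 1 ^ 2
      * X 2) + C (236) * (X 0 * X 1 * X 2 ^ 2) + C (-6) * (X 1 ^ 4) + C (-6) * (X 1 ^ 3 * X
      2) + C (60) * (X 1 ^ 2 * X 2 ^ 2) + C (-48) * (X 1 * X 2 ^ 3) := by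
  apply MvPolynomial.funext
  intro v
  rw [eval_Qab, eval_F3, eval_F4]
  simp
  ring

lemma noOtherSingularity_Qab : NoOtherSingularity (Qab (2 : K) 1) (Pi.single 3 1) := by
  intro v _ hv h
  have h0 := h 0
  have h1 := h 1
  have h2 := h 2
  have h3 := h 3
  have hcast : ∀ (n : ℕ) [n.AtLeastTwo],
      algebraMap K (AlgebraicClosure K) (OfNat.ofNat n) = OfNat.ofNat n :=
    fun n _ => map_ofNat _ n
  simp [Qab_two_one, pderiv_X, hcast] at hv h0 h1 h2 h3
  obtain ⟨hx, hy, hz⟩ := eq_zero_of_partials (x := v 0) (y := v 1) (z := v 2) (t := v 3)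
    (by linear_combination h0) (by linear_combination h1) (by linear_combination h2)
    (by linear_combination h3) (by linear_combination hv - v 3 * h3)
  refine ⟨v 3, ?_⟩
  funext i
  fin_cases i <;> simp [hx, hy, hz]

end Example

end QuarticMonoid

open MvPolynomial

namespace QuarticMonoid

/-! ### Thirty-one lines on the example. -/

section Example

variable {K : Type*} [Field K] [CharZero K]

lemma isQuarticMonoid_Qab : IsQuarticMonoid (Qab (2 : K) 1) (Pi.single 3 1) := by
  have h4 := isHomogeneous_Qab (2 : K) 1
  have h : ∃ l : List (Fin 4), l.length = 3 ∧
      eval (Pi.single 3 1) (iterPartial (Qab (2 : K) 1) l) ≠ 0 :=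
    -- The term 3 y³ t of t F₃ survives.
    ⟨[1, 1, 1], rfl, by simp [iterPartial, Qab_two_one, pderiv_X]⟩
  rw [Qab_eq_monoidForm] at h4 h ⊢
  exact isQuarticMonoid_monoidForm (IsHomogeneous.linSubst _ (isHomogeneous_F3 2))
    (isHomogeneous_C_mul_linSubst_F4 2 1) h4 h

lemma linearIndependent_zeroPoint (i j : Fin 12) (hij : i ≠ j) :
    LinearIndependent K ![fun m => (zeroPoint i m : K), fun m => (zeroPoint j m : K)] := by
  obtain ⟨m, hm⟩ := joinLine_ne_zero i j hij
  have hm' : (joinLine i j m : K) ≠ 0 := Int.cast_ne_zero.2 hm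
  rw [LinearIndependent.pair_iff]
  intro s t h
  have h0 := congrFun h 0
  have h1 := congrFun h 1
  have h2 := congrFun h 2
  simp only [Pi.add_apply, Pi.smul_apply, smul_eq_mul, Pi.zero_apply] at h0 h1 h2
  have hst : s * joinLine i j m = 0 ∧ t * joinLine i j m = 0 := by
    fin_cases m <;> simp only [joinLine, Fin.mk_one, Fin.zero_eta, Fin.reduceFinMk,
      Matrix.cons_val] <;> push_cast
    · constructor
      · linear_combination (zeroPoint j 2 : K) * h1 - (zeroPoint j 1 : K) * h2
      · linear_combination (zeroPoint i 1 : K) * h2 - (zeroPoint i 2 : K) * h1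
    · constructor
      · linear_combination (zeroPoint j 0 : K) * h2 - (zeroPoint j 2 : K) * h0
      · linear_combination (zeroPoint i 2 : K) * h0 - (zeroPoint i 0 : K) * h2
    · constructor
      · linear_combination (zeroPoint j 1 : K) * h0 - (zeroPoint j 0 : K) * h1
      · linear_combination (zeroPoint i 0 : K) * h1 - (zeroPoint i 1 : K) * h0
  exact ⟨(mul_eq_zero.1 hst.1).resolve_right hm', (mul_eq_zero.1 hst.2).resolve_right hm'⟩

lemma isTrisecant_zeroPoint (l : Fin 12 × Fin 12 × Fin 12) (hl : l ∈ TripleSystem.model) :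
    IsTrisecant (linSubst (planeMatrix K) (F3 2)) (fun i m => (zeroPoint i m : K))
      (fun m => (joinLine l.1 l.2.1 m : K)) {l.1, l.2.1, l.2.2} := by
  have h : TripleSystem.model.all (fun l => l.1 ≠ l.2.1 ∧ l.1 ≠ l.2.2 ∧ l.2.1 ≠ l.2.2 ∧
      dotForm (joinLine l.1 l.2.1) (zeroPoint l.1) = 0 ∧
      dotForm (joinLine l.1 l.2.1) (zeroPoint l.2.1) = 0 ∧
      dotForm (joinLine l.1 l.2.1) (zeroPoint l.2.2) = 0 ∧
      dotForm (joinLine l.1 l.2.1) (fun m => 2 * zeroPoint l.1 m + zeroPoint l.2.1 m) = 0 ∧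
      cubicForm (fun m => 2 * zeroPoint l.1 m + zeroPoint l.2.1 m) ≠ 0) = true := by decide
  obtain ⟨h1, h2, h3, d1, d2, d3, d4, hR⟩ := of_decide_eq_true (List.all_eq_true.1 h l hl)
  refine ⟨?_, ?_, ?_, ?_⟩
  · rw [Finset.card_insert_of_notMem (by simp [h1, h2]),
      Finset.card_insert_of_notMem (by simp [h3])]
    simp
  · obtain ⟨m, hm⟩ := joinLine_ne_zero _ _ h1
    intro h
    exact hm (Int.cast_eq_zero.1 (congrFun h m))
  · intro i hi
    simp only [Finset.mem_insert, Finset.mem_singleton] at hi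
    rw [dotForm_cast]
    rcases hi with rfl | rfl | rfl <;> simp [d1, d2, d3]
  -- The point 2P + Q of the line lies off the cubic. The simpler P + Q would not do: for the labels
  -- 4, 1, 9 it is the third point.
  · refine ⟨fun m => ((2 * zeroPoint l.1 m + zeroPoint l.2.1 m : ℤ) : K), ?_, ?_⟩
    · rw [dotForm_cast (v := fun m => 2 * zeroPoint l.1 m + zeroPoint l.2.1 m), d4, Int.cast_zero]
    · rw [eval_cubicForm (fun m => 2 * zeroPoint l.1 m + zeroPoint l.2.1 m)]
      exact Int.cast_ne_zero.2 hR

/-- A monoid with `31` lines. -/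
theorem encard_lines_Qab : 31 ≤ (lines (Qab (2 : K) 1)).encard := by
  classical
  have hfp : ∀ i, cubicForm (zeroPoint i) = 0 := by decide
  have hgp : ∀ i, quarticForm (zeroPoint i) = 0 := by decide
  have h0 : ∀ i, ∃ m, zeroPoint i m ≠ 0 := by decide
  have h := card_add_card_trisecants_le (IsHomogeneous.linSubst (planeMatrix K) (isHomogeneous_F3 2))
    (g := C 1 * linSubst (planeMatrix K) (F4 2)) (isHomogeneous_C_mul_linSubst_F4 2 1)
    linearIndependent_zeroPoint (fun i h => by
      obtain ⟨m, hm⟩ := h0 i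
      exact hm (Int.cast_eq_zero.1 (congrFun h m)))
    (fun i => by rw [eval_cubicForm, hfp, Int.cast_zero])
    (fun i => by rw [eval_quarticForm, hgp, Int.cast_zero])
  rw [← Qab_eq_monoidForm, Fintype.card_fin] at h
  refine le_trans ?_ h
  have h19 : 19 ≤ (trisecants (linSubst (planeMatrix K) (F3 2))
      (fun i m => (zeroPoint i m : K))).card := by
    have hcard : (TripleSystem.model.map
        fun l => ({l.1, l.2.1, l.2.2} : Finset (Fin 12))).toFinset.card = 19 := by decide
    rw [← hcard]
    refine Finset.card_le_card fun t ht => ?_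
    obtain ⟨l, hl, rfl⟩ := List.mem_map.1 (List.mem_toFinset.1 ht)
    exact mem_trisecants.2 ⟨_, isTrisecant_zeroPoint l hl⟩
  exact_mod_cast Nat.add_le_add_left h19 12

end Example

end QuarticMonoid

/-! ### Assembly of the three statements. -/

theorem mainTheorem1 {K : Type*} [Field K] [CharZero K] :
    -- 31 is the maximum number of lines
    IsGreatest {n : ℕ∞ | ∃ (F : QuarticMonoid.Poly4 K) (p : Fin 4 → K),
      QuarticMonoid.IsQuarticMonoid F p ∧ QuarticMonoid.NoOtherSingularity F p ∧
        (QuarticMonoid.lines F).encard = n} 31 ∧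
    -- the surfaces attaining the maximum
    (∀ (F : QuarticMonoid.Poly4 K) (p : Fin 4 → K),
      QuarticMonoid.IsQuarticMonoid F p → QuarticMonoid.NoOtherSingularity F p →
      (QuarticMonoid.lines F).encard = 31 →
        ∃ a : K, a ∉ ({-1, 0, 1 / 2, 1, 2} : Set K) ∧
          QuarticMonoid.ProjEquiv F (QuarticMonoid.Q a)) ∧
    -- the parameter `b` can be normalised away
    (∀ a b : K, a ∉ ({-2, -1, -1 / 2, 0, 1} : Set K) → b ≠ 0 →
      QuarticMonoid.ProjEquiv (QuarticMonoid.Qab a b) (QuarticMonoid.Q (-a))) := by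
  refine ⟨⟨⟨QuarticMonoid.Qab 2 1, Pi.single 3 1, QuarticMonoid.isQuarticMonoid_Qab,
    QuarticMonoid.noOtherSingularity_Qab,
    le_antisymm (QuarticMonoid.isQuarticMonoid_Qab.encard_lines_le
      QuarticMonoid.noOtherSingularity_Qab) QuarticMonoid.encard_lines_Qab⟩, ?_⟩, ?_, ?_⟩
  · rintro _ ⟨F, p, hF, hs, rfl⟩
    exact hF.encard_lines_le hs
  · intro F p hF hs h31
    obtain ⟨a, b, ha, hb, hab⟩ := hF.exists_projEquiv_Qab hs h31
    simp only [Set.mem_insert_iff, Set.mem_singleton_iff, not_or] at ha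
    obtain ⟨h2, h1, h12, h0, h1'⟩ := ha
    -- The values excluded for `Q` are the negatives of those excluded for `Qab`.
    refine ⟨-a, ?_, hab.trans (QuarticMonoid.projEquiv_Qab_Q h0 h1' h1 hb)⟩
    simp only [Set.mem_insert_iff, Set.mem_singleton_iff, not_or]
    refine ⟨fun h => h1' ?_, fun h => h0 ?_, fun h => h12 ?_, fun h => h1 ?_, fun h => h2 ?_⟩ <;>
      linear_combination -h
  · intro a b ha hb
    simp only [Set.mem_insert_iff, Set.mem_singleton_iff, not_or] at ha
    exact QuarticMonoid.projEquiv_Qab_Q ha.2.2.2.1 ha.2.2.2.2 ha.2.1 hb
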